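/- Write $\hat f(\xi)=\int f(x)e^{-2\pi i\langle\xi,x\rangle}\,dx$, extended to $L^2$. Fix $\alpha\in(1,2]$ and $K,L\in\mathbb N$ with $L\ge 10$ and $\frac{3L}{2}\le K\le 3L-2$. *Generators.* Let $m_0:\mathbb R\to\mathbb C$ be a low pass filter, i.e. a measurable $1$-periodic function with $m_0(0)=1$ and $m_0(\xi)-1=O(\xi)$ as $\xi\to0$ (for instance a trigonometric polynomial with $m_0(0)=1$), such that $$|m_0(\xi)|^2=(\cos \pi\xi)^{2K}\sum_{n=0}^{L-1}\binom{K-1+n}{n}(\sin\pi\xi)^{2n}\qquad(\xi\in\mathbb R),$$ and let $m_1$ be a measurable $1$-periodic function with $|m_1(\xi)|^2=|m_0(\xi+\tfrac12)|^2$ for all $\xi\in\mathbb R$. Then the functions $$\hat\phi(\xi)=\prod_{j=0}^\infty m_0(2^{-j}\xi)\ (\xi\in\mathbb R),\qquad \hat\psi(\xi)=m_1(4\xi_1)\hat\phi(\xi_1)\hat\phi(2\xi_2)\hat\phi(2\xi_3)\ (\xi\in\mathbb R^3)$$ are square integrable, and so define $\phi\in L^2(\mathbb R)$ and $\psi\in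 L^2(\mathbb R^3)$. On $\mathbb R^3$ put $\phi(x)=\phi(x_1)\phi(x_2)\phi(x_3)$, $\tilde\psi(x)=\psi(x_2,x_1,x_3)$ and $\breve\psi(x)=\psi(x_3,x_2,x_1)$. *Systems.* For $j\in\mathbb N_0$ and $k=(k_1,k_2)\in\mathbb Z^2$ let $A_{2^j}=\mathrm{diag}(2^{j\alpha/2},2^{j/2},2^{j/2})$, $\tilde A_{2^j}=\mathrm{diag}(2^{j/2},2^{j\alpha/2},2^{j/2})$, $\breve A_{2^j}=\mathrm{diag}(2^{j/2},2^{j/2},2^{j\alpha/2})$; let $S_k,\tilde S_k,\breve S_k$ be the $3\times3$ identity matrix with its first row replaced by $(1,k_1,k_2)$, its second row by $(k_1,1,k_2)$, and its third row by $(k_1,k_2,1)$, respectively. For $c=(c_1,c_2)$ with $c_1,c_2>0$ let $M_c=\mathrm{diag}(c_1,c_2,c_2)$, $\tilde M_c=\mathrm{diag}(c_2,c_1,c_2)$, $\breve M_c=\mathrm{diag}(c_2,c_2,c_1)$. Let $$\Psi(\psi;c,\alpha)=\{2^{j(\alpha+2)/4}\psi(S_kA_{2^j}\cdot-m): j\ge0,\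 |k_1|,|k_2|\le\lceil 2^{j(\alpha-1)/2}\rceil,\ m\in M_c\mathbb Z^3\},$$ define $\tilde\Psi(\tilde\psi;c,\alpha)$ and $\breve\Psi(\breve\psi;c,\alpha)$ in the same way with $(\tilde S_k,\tilde A_{2^j},\tilde M_c)$ and $(\breve S_k,\breve A_{2^j},\breve M_c)$, and let $$SH(\phi,\psi,\tilde\psi,\breve\psi;c,\alpha)=\{\phi(\cdot-m):m\in c_1\mathbb Z^3\}\cup\Psi(\psi;c,\alpha)\cup\tilde\Psi(\tilde\psi;c,\alpha)\cup\breve\Psi(\breve\psi;c,\alpha),$$ all of these being families indexed by their parameters. A countable family $(f_i)$ in $L^2(\mathbb R^3)$ is a frame for a subspace $V\subseteq L^2(\mathbb R^3)$ if there are $0<A\le B<\infty$ with $A\|f\|^2\le\sum_i|\langle f,f_i\rangle|^2\le B\|f\|^2$ for all $f\in V$. Let $\mathcal P=\{\xi\in\mathbb R^3:|\xi_1|\ge1,\ |\xi_2|\le|\xi_1|,\ |\xi_3|\le|\xi_1|\}$ and $\check L^2(\mathcal P)=\{f\in L^2(\mathbb R^3):\hat f=0\text{ a.e. outside }\mathcal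 P\}$. **Theorem.** There is a constant $\hat c_1>0$ such that, for all $c=(c_1,c_2)$ with $0<c_2\le c_1\le\hat c_1$, the system $\Psi(\psi;c,\alpha)$ is a frame for $\check L^2(\mathcal P)$ and the full pyramid-adapted hybrid shearlet system $SH(\phi,\psi,\tilde\psi,\breve\psi;c,\alpha)$ is a frame for $L^2(\mathbb R^3)$. -/

import Mathlib

open MeasureTheory Filter Topology Asymptotics
open scoped FourierTransform ENNReal

noncomputable section

namespace Shearlet

/-- Euclidean three-space. -/
abbrev R3 : Type := EuclideanSpace ℝ (Fin 3)

/-- The complex Hilbert space `L²(ℝ³)`. -/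
abbrev L2R3 : Type := Lp (α := R3) ℂ 2

/-! ### Frames -/

/-- The countable family `v` satisfies the two frame inequalities, with finite positive frame
bounds, for every vector of the set `V`.  The members of `v` need not lie in `V`. -/
def IsFrameOn {ι H : Type*} [NormedAddCommGroup H] [InnerProductSpace ℂ H]
    (V : Set H) (v : ι → H) : Prop :=
  Countable ι ∧ ∃ A B : ℝ, 0 < A ∧ A ≤ B ∧ ∀ f ∈ V,
    Summable (fun i => ‖inner ℂ (v i) f‖ ^ 2) ∧
    A * ‖f‖ ^ 2 ≤ ∑' i, ‖inner ℂ (v i) f‖ ^ 2 ∧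
    ∑' i, ‖inner ℂ (v i) f‖ ^ 2 ≤ B * ‖f‖ ^ 2

/-- The functions `g i` are all square integrable and their classes in `L²(ℝ³)` form a frame
for the set `V`. -/
def IsL2FrameOn {ι : Type*} (V : Set L2R3) (g : ι → R3 → ℂ) : Prop :=
  ∃ hg : ∀ i, MemLp (g i) 2 volume, IsFrameOn V (fun i => (hg i).toLp (g i))

/-- The functions `g i` form a frame for the whole of `L²(ℝ³)`. -/
def IsL2Frame {ι : Type*} (g : ι → R3 → ℂ) : Prop :=
  IsL2FrameOn Set.univ g

/-! ### The Fourier side -/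

/-- `f` is square integrable and `F` is (a representative of) its `L²` Fourier transform,
normalized by `∫ f(x) exp(-2πi⟨ξ, x⟩) dx`. -/
def HasL2Fourier {E : Type*} [NormedAddCommGroup E] [InnerProductSpace ℝ E]
    [FiniteDimensional ℝ E] [MeasurableSpace E] [BorelSpace E] (f F : E → ℂ) : Prop :=
  ∃ hf : MemLp f 2 (volume : Measure E),
    ((𝓕 (hf.toLp f) : Lp ℂ 2 (volume : Measure E)) : E → ℂ) =ᵐ[volume] F

/-- The union of the two opposite frequency pyramids around the `ξ₁`-axis. -/
def pyramid : Set R3 :=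
  {ξ | 1 ≤ ξ 0 ∧ |ξ 1 / ξ 0| ≤ 1 ∧ |ξ 2 / ξ 0| ≤ 1} ∪
  {ξ | ξ 0 ≤ -1 ∧ |ξ 1 / ξ 0| ≤ 1 ∧ |ξ 2 / ξ 0| ≤ 1}

/-- The functions in `L²(ℝ³)` whose Fourier transform vanishes almost everywhere off the
pyramid. -/
def L2Pyramid : Set L2R3 :=
  {f | ∀ᵐ ξ ∂(volume : Measure R3), ξ ∉ pyramid → (𝓕 f : L2R3) ξ = 0}

/-! ### Filters and generators -/

/-- The (measurable, `1`-periodic) transfer function of a filter. -/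
structure IsFilter (m : ℝ → ℂ) : Prop where
  measurable : Measurable m
  periodic : Function.Periodic m 1

/-- A normalized low pass filter: `m(0) = 1` and `m(ξ) - 1 = O(ξ)` at the origin, so that the
product `∏ m(2⁻ʲ ξ)` converges absolutely.  Every trigonometric polynomial with `m(0) = 1` is
one. -/
structure IsLowPassFilter (m : ℝ → ℂ) : Prop extends IsFilter m where
  map_zero : m 0 = 1
  isBigO : (fun ξ => m ξ - 1) =O[𝓝 0] (fun ξ : ℝ => ξ)

/-- The prescribed squared modulus of the low pass filter. -/
def lowPassSq (K L : ℕ) (ξ : ℝ) : ℝ :=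
  Real.cos (Real.pi * ξ) ^ (2 * K) *
    ∑ n ∈ Finset.range L, ((K - 1 + n).choose n : ℝ) * Real.sin (Real.pi * ξ) ^ (2 * n)

/-- The Fourier transform `ξ ↦ ∏_{j ≥ 0} m₀(2⁻ʲ ξ)` of the univariate scaling function. -/
def scalingHat (m₀ : ℝ → ℂ) (ξ : ℝ) : ℂ := ∏' j : ℕ, m₀ (ξ / 2 ^ j)

/-- The Fourier transform of the shearlet generator. -/
def shearletHat (m₀ m₁ : ℝ → ℂ) (ξ : R3) : ℂ :=
  m₁ (4 * ξ 0) * scalingHat m₀ (ξ 0) * scalingHat m₀ (2 * ξ 1) * scalingHat m₀ (2 * ξ 2)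

/-- The trivariate tensor product scaling function. -/
def tensor3 (φ : ℝ → ℂ) (x : R3) : ℂ := φ (x 0) * φ (x 1) * φ (x 2)

/-- `(x₁, x₂, x₃) ↦ ψ(x₂, x₁, x₃)`. -/
def swap12 (ψ : R3 → ℂ) (x : R3) : ℂ := ψ !₂[x 1, x 0, x 2]

/-- `(x₁, x₂, x₃) ↦ ψ(x₃, x₂, x₁)`. -/
def swap13 (ψ : R3 → ℂ) (x : R3) : ℂ := ψ !₂[x 2, x 1, x 0]

/-! ### Scaling, shear and sampling matrices -/

/-- The matrix `A_{2^j}`. -/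
def scale₁ (α : ℝ) (j : ℕ) : Matrix (Fin 3) (Fin 3) ℝ :=
  Matrix.diagonal ![2 ^ (j * α / 2), 2 ^ ((j : ℝ) / 2), 2 ^ ((j : ℝ) / 2)]

def scale₂ (α : ℝ) (j : ℕ) : Matrix (Fin 3) (Fin 3) ℝ :=
  Matrix.diagonal ![2 ^ ((j : ℝ) / 2), 2 ^ (j * α / 2), 2 ^ ((j : ℝ) / 2)]

def scale₃ (α : ℝ) (j : ℕ) : Matrix (Fin 3) (Fin 3) ℝ :=
  Matrix.diagonal ![2 ^ ((j : ℝ) / 2), 2 ^ ((j : ℝ) / 2), 2 ^ (j * α / 2)]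

/-- The matrix `S_k`, `k = (k₁, k₂)`. -/
def shear₁ (k : ℤ × ℤ) : Matrix (Fin 3) (Fin 3) ℝ :=
  !![1, (k.1 : ℝ), (k.2 : ℝ); 0, 1, 0; 0, 0, 1]

def shear₂ (k : ℤ × ℤ) : Matrix (Fin 3) (Fin 3) ℝ :=
  !![1, 0, 0; (k.1 : ℝ), 1, (k.2 : ℝ); 0, 0, 1]

def shear₃ (k : ℤ × ℤ) : Matrix (Fin 3) (Fin 3) ℝ :=
  !![1, 0, 0; 0, 1, 0; (k.1 : ℝ), (k.2 : ℝ), 1]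

/-- The matrix `M_c`, `c = (c₁, c₂)`. -/
def sample₁ (c₁ c₂ : ℝ) : Matrix (Fin 3) (Fin 3) ℝ := Matrix.diagonal ![c₁, c₂, c₂]

def sample₂ (c₁ c₂ : ℝ) : Matrix (Fin 3) (Fin 3) ℝ := Matrix.diagonal ![c₂, c₁, c₂]

def sample₃ (c₁ c₂ : ℝ) : Matrix (Fin 3) (Fin 3) ℝ := Matrix.diagonal ![c₂, c₂, c₁]

/-! ### Shearlet systems -/

/-- The parameters `(j, k, m)` with `j ≥ 0`, `|k₁|, |k₂| ≤ ⌈2^{j(α-1)/2}⌉` and `m ∈ ℤ³`; the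
translate belonging to `m` is the lattice point `M m`. -/
def ShearIndex (α : ℝ) : Type :=
  {p : ℕ × (ℤ × ℤ) × (Fin 3 → ℤ) //
    |p.2.1.1| ≤ ⌈(2 : ℝ) ^ (p.1 * (α - 1) / 2)⌉ ∧ |p.2.1.2| ≤ ⌈(2 : ℝ) ^ (p.1 * (α - 1) / 2)⌉}

/-- The functions `x ↦ 2^{j(α+2)/4} ψ(S_k A_{2^j} x - M m)`, with the scaling matrices `A`, the
shear matrices `S` and the sampling matrix `M` as arguments. -/
def shearSystem (α : ℝ) (A : ℕ → Matrix (Fin 3) (Fin 3) ℝ)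
    (S : ℤ × ℤ → Matrix (Fin 3) (Fin 3) ℝ) (M : Matrix (Fin 3) (Fin 3) ℝ)
    (ψ : R3 → ℂ) (p : ShearIndex α) (x : R3) : ℂ :=
  ((2 ^ (p.1.1 * (α + 2) / 4) : ℝ) : ℂ) *
    ψ (WithLp.toLp 2 ((S p.1.2.1 * A p.1.1).mulVec x.ofLp - M.mulVec (fun i => (p.1.2.2 i : ℝ))))

/-- The system `Ψ(ψ; c, α)` attached to the pyramid around the `ξ₁`-axis. -/
def shear₁System (α c₁ c₂ : ℝ) (ψ : R3 → ℂ) : ShearIndex α → R3 → ℂ :=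
  shearSystem α (scale₁ α) shear₁ (sample₁ c₁ c₂) ψ

def shear₂System (α c₁ c₂ : ℝ) (ψ : R3 → ℂ) : ShearIndex α → R3 → ℂ :=
  shearSystem α (scale₂ α) shear₂ (sample₂ c₁ c₂) ψ

def shear₃System (α c₁ c₂ : ℝ) (ψ : R3 → ℂ) : ShearIndex α → R3 → ℂ :=
  shearSystem α (scale₃ α) shear₃ (sample₃ c₁ c₂) ψ

/-- The translates `x ↦ φ(x - c₁ m)`, `m ∈ ℤ³`. -/
def scalingSystem (c₁ : ℝ) (φ : R3 → ℂ) (m : Fin 3 → ℤ) (x : R3) : ℂ :=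
  φ (WithLp.toLp 2 (fun i => x i - c₁ * m i))

/-- The pyramid-adapted hybrid shearlet system `SH(φ, ψ₁, ψ₂, ψ₃; c, α)`: the union of the
scaling translates and of the three shearlet systems, as a family. -/
def pyramidSystem (α c₁ c₂ : ℝ) (φ ψ₁ ψ₂ ψ₃ : R3 → ℂ) :
    ((Fin 3 → ℤ) ⊕ ShearIndex α ⊕ ShearIndex α ⊕ ShearIndex α) → R3 → ℂ :=
  Sum.elim (scalingSystem c₁ φ)
    (Sum.elim (shear₁System α c₁ c₂ ψ₁)
      (Sum.elim (shear₂System α c₁ c₂ ψ₂) (shear₃System α c₁ c₂ ψ₃)))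

end Shearlet

end

/-! The argument takes place on the Fourier side, one layer at a time. Fix a scale j and a shear k,
let N be the inverse transpose of S_k A_{2^j} (composed with a coordinate permutation for the other
two pyramids), and write η = Nξ. By Plancherel the coefficients of f indexed by m are integrals of
exp(2πi⟨m, M_c η⟩) against g(ξ) = κ · conj(Ψ(η)) · F(ξ), where F is the transform of f and κ² = |det
N|.

Cut frequency space into the cells on which M_c η lies in the unit cube centred at a lattice point
n. On each cell Parseval's identity for Fourier series is exact. The cell n = 0 gives the main term,
the energy of F weighted by |Ψ(η)|² there. The other cells give aliasing terms, which are combined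
by Cauchy–Schwarz with weights summable over the lattice (`tsum_integral_sub_le`). In a cell n ≠ 0
some coordinate satisfies |η_i| ≥ |n_i| / (2c_i), so quadratic decay of Ψ makes the aliasing of
order c₁² (`decay_prod_le_cubeWeight`, `layer_bounds`).

Two facts about all layers together finish the proof. First, the bound for |Ψ|² has enough decay,
and enough vanishing at η₁ = 0, to be summed over every scale and shear while one factor of decay
per coordinate is kept for the cells (`tsum_majorant_le`); this gives the upper frame bound and a
uniform bound for the aliasing. Second, every frequency in the dilated pyramid `cone` is carried by
some layer into a fixed box inside the central cell where |Ψ|² ≥ A (`exists_shearParam`), so the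
main terms dominate the energy of F on `cone`. For small c₁ the aliasing is absorbed
(`lower_bound_of_remainder`). Functions in the pyramid space have all their energy in `cone`; for
the full system a low frequency box and the three permuted cones cover ℝ³.

The estimates for Ψ come from the filter. The cosine factors of the infinite product telescope to
sin(2πξ)/(2πξ), and the polynomial factors grow at most like |ξ|^(K+L-1) in squared modulus. Since L
+ 3 ≤ K, the scaling function decays quadratically (`exists_norm_scalingHat_le`). The high pass
filter supplies the zero at η₁ = 0. -/

noncomputable section

namespace Shearlet

open scoped ComplexConjugate RealInnerProductSpace

/-! ### The L² Fourier transform of functions with integrable transform -/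

section L2Fourier

variable {E : Type*} [NormedAddCommGroup E] [InnerProductSpace ℝ E]
    [FiniteDimensional ℝ E] [MeasurableSpace E] [BorelSpace E]

/-- The inverse Fourier transform is symmetric for the bilinear pairing of integrable functions. -/
theorem integral_fourierInv_mul_eq {f g : E → ℂ} (hf : Integrable f) (hg : Integrable g) :
    ∫ x, 𝓕⁻ f x * g x = ∫ x, f x * 𝓕⁻ g x := by
  have h := VectorFourier.integral_fourierIntegral_smul_eq_flip (e := Real.fourierChar)
    (L := -innerₗ E) (μ := volume) (ν := volume) Real.continuous_fourierChar
    (by simp only [LinearMap.neg_apply, innerₗ_apply_apply]; fun_prop) hf hg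
  have h1 : ∀ f : E → ℂ, VectorFourier.fourierIntegral Real.fourierChar volume (-innerₗ E) f
      = 𝓕⁻ f := by
    intro f
    ext x
    simp [VectorFourier.fourierIntegral, Real.fourierInv_eq]
  have h2 : (-innerₗ E).flip = -innerₗ E := by
    ext x y
    simp [real_inner_comm]
  rw [h2, h1, h1] at h
  simpa using h

theorem continuous_fourierInv {f : E → ℂ} (hf : Integrable f) : Continuous (𝓕⁻ f : E → ℂ) := by
  have h : (𝓕⁻ f : E → ℂ) =
      VectorFourier.fourierIntegral Real.fourierChar volume (-innerₗ E) f := by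
    ext x
    simp [VectorFourier.fourierIntegral, Real.fourierInv_eq]
  rw [h]
  exact VectorFourier.fourierIntegral_continuous Real.continuous_fourierChar
    (by simp only [LinearMap.neg_apply, innerₗ_apply_apply]; fun_prop) hf

/-- On `L¹ ∩ L²` the inverse `L²` Fourier transform is given by the integral formula. -/
theorem fourierInv_toLp_ae_eq {F : E → ℂ} (h1 : Integrable F) (h2 : MemLp F 2) :
    ((𝓕⁻ (h2.toLp F) : Lp ℂ 2 (volume : Measure E)) : E → ℂ) =ᵐ[volume] (𝓕⁻ F : E → ℂ) := by
  -- Both sides are locally integrable, so testing against smooth compactly supported functions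
  -- suffices. Such a test function is Schwartz, and against it the L² transform agrees with the
  -- distributional one.
  apply ae_eq_of_integral_contDiff_smul_eq
  · exact (Lp.memLp _).locallyIntegrable (by norm_num)
  · exact (continuous_fourierInv h1).locallyIntegrable
  · intro g g_smooth g_cpt
    have hg₁ : HasCompactSupport (Complex.ofRealCLM ∘ g) := g_cpt.comp_left rfl
    have hg₂ : ContDiff ℝ (⊤ : ℕ∞) (Complex.ofRealCLM ∘ g) := by fun_prop
    set G := hg₁.toSchwartzMap hg₂ with hG
    have key := congrArg (fun u => u G)
      (MeasureTheory.Lp.fourierInv_toTemperedDistribution_eq (h2.toLp F))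
    simp only [TemperedDistribution.fourierInv_apply, Lp.toTemperedDistribution_apply] at key
    have e1 : ∫ x, g x • (𝓕⁻ (h2.toLp F) : Lp ℂ 2 (volume : Measure E)) x
        = ∫ x, G x • (𝓕⁻ (h2.toLp F) : Lp ℂ 2 (volume : Measure E)) x := by
      simp [hG]
    have e2 : ∫ x, g x • (𝓕⁻ F : E → ℂ) x = ∫ x, G x * (𝓕⁻ F : E → ℂ) x := by
      simp [hG]
    rw [e1, e2, ← key, ← integral_fourierInv_mul_eq G.integrable h1]
    apply integral_congr_ae
    filter_upwards [h2.coeFn_toLp] with x hx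
    rw [hx, SchwartzMap.fourierInv_coe, smul_eq_mul]

theorem HasL2Fourier.congr {f g F : E → ℂ} (h : HasL2Fourier f F) (hfg : g =ᵐ[volume] f) :
    HasL2Fourier g F := by
  obtain ⟨hf, hF⟩ := h
  refine ⟨hf.ae_eq hfg.symm, ?_⟩
  rwa [MemLp.toLp_congr (hf.ae_eq hfg.symm) hf hfg]

/-- A square integrable function with integrable Fourier transform is a.e. the inverse Fourier
integral of its transform. -/
theorem HasL2Fourier.ae_eq_fourierInv {f F : E → ℂ} (h : HasL2Fourier f F) (h1 : Integrable F)
    (h2 : MemLp F 2) : f =ᵐ[volume] (𝓕⁻ F : E → ℂ) := by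
  obtain ⟨hf, hF⟩ := h
  have : (𝓕 (hf.toLp f) : Lp ℂ 2 (volume : Measure E)) = h2.toLp F :=
    Lp.ext (hF.trans h2.coeFn_toLp.symm)
  have h3 : hf.toLp f = 𝓕⁻ (h2.toLp F) := by
    rw [← this]
    exact (FourierTransform.fourierInv_fourier_eq _).symm
  refine hf.coeFn_toLp.symm.trans ?_
  rw [h3]
  exact fourierInv_toLp_ae_eq h1 h2

/-- A function in `L¹ ∩ L²` is the `L²` Fourier transform of its inverse Fourier integral. -/
theorem hasL2Fourier_fourierInv {F : E → ℂ} (h1 : Integrable F) (h2 : MemLp F 2) :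
    HasL2Fourier (𝓕⁻ F : E → ℂ) F := by
  have hae := fourierInv_toLp_ae_eq h1 h2
  have hm : MemLp (𝓕⁻ F : E → ℂ) 2 volume := (Lp.memLp _).ae_eq hae
  refine ⟨hm, ?_⟩
  have : hm.toLp _ = 𝓕⁻ (h2.toLp F) := by
    apply Lp.ext
    exact hm.coeFn_toLp.trans hae.symm
  rw [this, FourierTransform.fourier_fourierInv_eq]
  exact h2.coeFn_toLp

/-- The `L²` Fourier transform of an affine change of variables, for a function whose transform
is also integrable; `B'` is the contragredient of `B`. -/
theorem HasL2Fourier.comp_affine {f F : E → ℂ} (h : HasL2Fourier f F) (h1 : Integrable F)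
    (h2 : MemLp F 2) {B : E → E} (hB : Measure.QuasiMeasurePreserving B volume volume)
    (B' : E ≃ᵐ E) {b : ℝ} (hb : 0 < b)
    (hB' : Measure.map B' volume = ENNReal.ofReal b • (volume : Measure E))
    (hBB' : ∀ ξ x, ⟪B' ξ, B x⟫ = ⟪ξ, x⟫) (t : E) :
    HasL2Fourier (fun x => f (B x - t))
      (fun ξ => (b⁻¹ : ℝ) * ((Real.fourierChar (-⟪B' ξ, t⟫) : ℂ) * F (B' ξ))) := by
  have hchar : Measurable fun ξ : E => (Real.fourierChar (-⟪B' ξ, t⟫) : ℂ) := by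
    have : Continuous fun ξ : E => (Real.fourierChar (-⟪ξ, t⟫) : ℂ) :=
      continuous_subtype_val.comp (Real.continuous_fourierChar.comp (by fun_prop))
    exact this.measurable.comp B'.measurable
  have hb0 : ENNReal.ofReal b ≠ 0 := by simpa using hb
  have hcomp1 : Integrable (fun ξ => F (B' ξ)) := by
    have : Integrable F (Measure.map B' volume) := by
      rw [hB']; exact h1.smul_measure ENNReal.ofReal_ne_top
    exact (integrable_map_equiv B' F).1 this
  have hcomp2 : MemLp (fun ξ => F (B' ξ)) 2 := by
    have : MemLp F 2 (Measure.map B' volume) := by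
      rw [hB']; exact h2.smul_measure ENNReal.ofReal_ne_top
    exact this.comp_of_map B'.measurable.aemeasurable
  have hn : ∀ ξ, ‖(Real.fourierChar (-⟪B' ξ, t⟫) : ℂ)‖ = 1 := fun ξ => Circle.norm_coe _
  have hG1 : Integrable (fun ξ => (b⁻¹ : ℝ) * ((Real.fourierChar (-⟪B' ξ, t⟫) : ℂ) * F (B' ξ))) := by
    refine Integrable.const_mul ?_ _
    exact hcomp1.mono (hchar.aestronglyMeasurable.mul hcomp1.1) (by simp [hn])
  have hG2 : MemLp (fun ξ => ((b⁻¹ : ℝ) : ℂ) *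
      ((Real.fourierChar (-⟪B' ξ, t⟫) : ℂ) * F (B' ξ))) 2 := by
    refine MemLp.const_mul ?_ _
    exact hcomp2.mono (hchar.aestronglyMeasurable.mul hcomp2.1) (by simp [hn])
  -- Integrability turns both functions into genuine inverse Fourier integrals, and the claim
  -- becomes the substitution η = B'ξ. As f is known only almost everywhere, preimages of null sets
  -- under x ↦ Bx - t must be null.
  refine (hasL2Fourier_fourierInv hG1 hG2).congr ?_
  have hquasi : Measure.QuasiMeasurePreserving (fun x => B x - t) volume volume :=
    (measurePreserving_sub_right volume t).quasiMeasurePreserving.comp hB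
  filter_upwards [hquasi.ae (h.ae_eq_fourierInv h1 h2)] with x hx
  rw [hx, Real.fourierInv_eq, Real.fourierInv_eq]
  have hI : ∀ H : E → ℂ, ∫ η, H η = (b⁻¹ : ℝ) * ∫ ξ, H (B' ξ) := by
    intro H
    rw [← integral_map_equiv B' H, hB', integral_smul_measure, ENNReal.toReal_ofReal hb.le,
      Complex.real_smul, ← mul_assoc, ← Complex.ofReal_mul, inv_mul_cancel₀ hb.ne']
    simp
  rw [hI, ← integral_const_mul]
  congr 1
  ext ξ
  rw [inner_sub_right, hBB', sub_eq_add_neg, AddChar.map_add_eq_mul]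
  simp only [Circle.smul_def, smul_eq_mul, Circle.coe_mul]
  ring

/-- Plancherel's theorem in terms of a representative of the Fourier transform. -/
theorem HasL2Fourier.inner_toLp {v V : E → ℂ} (h : HasL2Fourier v V) (hv : MemLp v 2)
    (f : Lp ℂ 2 (volume : Measure E)) :
    inner ℂ (hv.toLp v) f = ∫ ξ, conj (V ξ) * (𝓕 f : Lp ℂ 2 (volume : Measure E)) ξ := by
  obtain ⟨_, hV⟩ := h
  rw [← Lp.inner_fourier_eq, L2.inner_def]
  apply integral_congr_ae
  filter_upwards [hV] with ξ hξ
  rw [hξ]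
  simp [mul_comm]

end L2Fourier

/-! ### Tensor products on ℝ³ -/

/-- The tensor product of three functions of one variable. -/
def tensor (f₁ f₂ f₃ : ℝ → ℂ) (x : R3) : ℂ := f₁ (x 0) * f₂ (x 1) * f₃ (x 2)

theorem integral_tensor (f₁ f₂ f₃ : ℝ → ℂ) :
    ∫ x : R3, tensor f₁ f₂ f₃ x = (∫ x, f₁ x) * (∫ x, f₂ x) * ∫ x, f₃ x := by
  have := integral_fintype_prod_volume_eq_prod (𝕜 := ℂ) (![f₁, f₂, f₃] : Fin 3 → ℝ → ℂ)
  simp only [Fin.prod_univ_three] at this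
  rw [← (PiLp.volume_preserving_toLp (Fin 3)).integral_comp
    (MeasurableEquiv.toLp 2 (Fin 3 → ℝ)).measurableEmbedding]
  simpa [tensor] using this

theorem integrable_tensor {f₁ f₂ f₃ : ℝ → ℂ} (h₁ : Integrable f₁) (h₂ : Integrable f₂)
    (h₃ : Integrable f₃) : Integrable (tensor f₁ f₂ f₃) := by
  have := Integrable.fintype_prod (𝕜 := ℂ) (f := ![f₁, f₂, f₃])
    (μ := fun _ : Fin 3 => (volume : Measure ℝ))
    (by intro i; fin_cases i <;> simpa)
  simp only [Fin.prod_univ_three] at this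
  rw [← (PiLp.volume_preserving_toLp (Fin 3)).integrable_comp_emb
    (MeasurableEquiv.toLp 2 (Fin 3 → ℝ)).measurableEmbedding]
  simpa [tensor, Function.comp_def, volume_pi] using this

theorem measurable_tensor {f₁ f₂ f₃ : ℝ → ℂ} (h₁ : Measurable f₁) (h₂ : Measurable f₂)
    (h₃ : Measurable f₃) : Measurable (tensor f₁ f₂ f₃) := by
  unfold tensor
  fun_prop

theorem fourierInv_tensor (f₁ f₂ f₃ : ℝ → ℂ) (x : R3) :
    (𝓕⁻ (tensor f₁ f₂ f₃) : R3 → ℂ) x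
      = tensor (𝓕⁻ f₁ : ℝ → ℂ) (𝓕⁻ f₂ : ℝ → ℂ) (𝓕⁻ f₃ : ℝ → ℂ) x := by
  simp only [tensor, Real.fourierInv_eq]
  rw [← integral_tensor]
  congr 1
  ext ξ
  simp only [tensor, PiLp.inner_apply, Fin.sum_univ_three, AddChar.map_add_eq_mul,
    Circle.smul_def, smul_eq_mul, Circle.coe_mul]
  ring

/-- Each factor is a.e. its inverse Fourier integral and these integrals multiply by Fubini; the
exceptional null sets on the line pull back to null sets under the coordinate projections. -/
theorem HasL2Fourier.tensor3 {φ F : ℝ → ℂ} (h : HasL2Fourier φ F) (h1 : Integrable F)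
    (h2 : MemLp F 2) (h2' : MemLp (tensor F F F) 2) :
    HasL2Fourier (tensor3 φ) (tensor F F F) := by
  refine (hasL2Fourier_fourierInv (integrable_tensor h1 h1 h1) h2').congr ?_
  have hae := h.ae_eq_fourierInv h1 h2
  have hq : ∀ i : Fin 3, Measure.QuasiMeasurePreserving (fun x : R3 => x i) volume volume := by
    intro i
    exact (Measure.quasiMeasurePreserving_eval (fun _ : Fin 3 => (volume : Measure ℝ)) i).comp
      (PiLp.volume_preserving_ofLp (Fin 3)).quasiMeasurePreserving
  filter_upwards [(hq 0).ae hae, (hq 1).ae hae, (hq 2).ae hae] with x h0 h1 h2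
  rw [fourierInv_tensor, Shearlet.tensor3, h0, h1, h2, tensor]

/-! ### Parseval's identity on lattice cubes -/

section Cube

variable {d : Type*}

/-- The half-open unit cube centred at the lattice point `n`. -/
def latticeCube (n : d → ℤ) : Set (d → ℝ) :=
  {x | ∀ i, x i ∈ Set.Ioc ((n i : ℝ) - 1 / 2) ((n i : ℝ) - 1 / 2 + 1)}

theorem iUnion_latticeCube : ⋃ n : d → ℤ, latticeCube n = Set.univ := by
  refine Set.eq_univ_of_forall fun x => Set.mem_iUnion.2 ⟨fun i => ⌈x i - 1 / 2⌉, fun i => ?_⟩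
  have h1 := Int.le_ceil (x i - 1 / 2)
  have h2 := Int.ceil_lt_add_one (x i - 1 / 2)
  constructor <;> linarith

theorem pairwise_disjoint_latticeCube :
    Pairwise (Function.onFun Disjoint (latticeCube (d := d))) := by
  intro n n' hnn'
  refine Set.disjoint_left.2 fun x hx hx' => hnn' (funext fun i => ?_)
  have h1 := hx i
  have h2 := hx' i
  simp only [Set.mem_Ioc] at h1 h2
  have h3 : (n i : ℝ) < n' i + 1 := by linarith
  have h4 : (n' i : ℝ) < n i + 1 := by linarith
  have h5 : n i < n' i + 1 := by exact_mod_cast h3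
  have h6 : n' i < n i + 1 := by exact_mod_cast h4
  omega

variable [Fintype d]

theorem measurableSet_latticeCube (n : d → ℤ) : MeasurableSet (latticeCube n) :=
  MeasurableSet.univ_pi' (fun _ => measurableSet_Ioc)

/-- The character `u ↦ exp(2πi ∑ mᵢ uᵢ)` of `ℝᵈ`. -/
def latticeChar (m : d → ℤ) (u : d → ℝ) : ℂ := Real.fourierChar (∑ i, (m i : ℝ) * u i)

theorem norm_latticeChar (m : d → ℤ) (u : d → ℝ) : ‖latticeChar m u‖ = 1 := Circle.norm_coe _

theorem measurable_latticeChar (m : d → ℤ) : Measurable (latticeChar m) := by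
  have : Continuous (latticeChar m) :=
    continuous_subtype_val.comp (Real.continuous_fourierChar.comp (by fun_prop))
  exact this.measurable

theorem mFourier_coe (m : d → ℤ) (u : d → ℝ) :
    UnitAddTorus.mFourier m (fun i => (u i : UnitAddCircle)) = latticeChar m u := by
  simp only [UnitAddTorus.mFourier, ContinuousMap.coe_mk, latticeChar, Real.fourierChar_apply,
    fourier_coe_apply, ← Complex.exp_sum]
  congr 1
  push_cast
  rw [Finset.mul_sum, Finset.sum_mul]
  refine Finset.sum_congr rfl fun i _ => ?_
  ring

section Torus

-- The circle carries Haar probability measure, for which the characters are orthonormal and a unit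
-- cube corresponds to the torus without a constant.
local instance torusMeasureSpace : MeasureSpace UnitAddCircle := ⟨AddCircle.haarAddCircle⟩

/-- Parseval's identity on the unit cube centred at a lattice point. -/
theorem tsum_integral_latticeCube (n : d → ℤ) {h : (d → ℝ) → ℂ} (hm : Measurable h)
    (hfin : ∫⁻ u in latticeCube n, ‖h u‖ₑ ^ 2 ≠ ∞) :
    ∑' m : d → ℤ, ‖∫ u in latticeCube n, latticeChar m u * h u‖ₑ ^ 2
      = ∫⁻ u in latticeCube n, ‖h u‖ₑ ^ 2 := by
  set a : d → ℝ := fun i => (n i : ℝ) - 1 / 2 with ha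
  set H : UnitAddTorus d → ℂ := fun x => h (UnitAddTorus.measurableEquivPiIoc a x).1 with hH
  have hHm : Measurable H :=
    hm.comp (measurable_subtype_coe.comp (UnitAddTorus.measurableEquivPiIoc a).measurable)
  have hval : ∀ u ∈ latticeCube n, H (fun i => (u i : UnitAddCircle)) = h u := by
    intro u hu
    have := (UnitAddTorus.measurableEquivPiIoc a).apply_symm_apply ⟨u, hu⟩
    rw [UnitAddTorus.coe_symm_measurableEquivPiIoc_apply] at this
    simp only [hH]
    rw [this]
  have hl : ∫⁻ x, ‖H x‖ₑ ^ 2 = ∫⁻ u in latticeCube n, ‖h u‖ₑ ^ 2 := by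
    rw [UnitAddTorus.lintegral_preimage _ a]
    exact setLIntegral_congr_fun (measurableSet_latticeCube n) fun u hu => by
      simp only [hval u hu]
  have hmem : MemLp H 2 volume := by
    refine ⟨hHm.aestronglyMeasurable, ?_⟩
    rw [eLpNorm_lt_top_iff_lintegral_rpow_enorm_lt_top (by norm_num) (by norm_num)]
    simp only [ENNReal.toReal_ofNat, ENNReal.rpow_ofNat]
    rw [hl]
    exact hfin.lt_top
  -- A Fourier coefficient pairs with the conjugate character, hence the index -m.
  have hcoef : ∀ m, UnitAddTorus.mFourierCoeff (hmem.toLp H) (-m)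
      = ∫ u in latticeCube n, latticeChar m u * h u := by
    intro m
    have : UnitAddTorus.mFourierCoeff (hmem.toLp H) (-m) = UnitAddTorus.mFourierCoeff H (-m) := by
      apply integral_congr_ae
      filter_upwards [hmem.coeFn_toLp] with x hx
      rw [hx]
    rw [this, UnitAddTorus.mFourierCoeff_eq_integral H (-m) a]
    refine setIntegral_congr_fun (measurableSet_latticeCube n) fun u hu => ?_
    simp only [neg_neg, smul_eq_mul, mFourier_coe, hval u hu]
  have hs := UnitAddTorus.hasSum_sq_mFourierCoeff (hmem.toLp H)
  have hs' := (Equiv.neg (d → ℤ)).hasSum_iff.2 hs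
  simp only [Function.comp_def, Equiv.neg_apply, hcoef] at hs'
  have hint : Integrable (fun t => ‖hmem.toLp H t‖ ^ 2) :=
    (Lp.memLp (hmem.toLp H)).integrable_norm_pow (by norm_num)
  have h1 : ∀ z : ℂ, ‖z‖ₑ ^ 2 = ENNReal.ofReal (‖z‖ ^ 2) := fun z => by
    rw [ENNReal.ofReal_pow (norm_nonneg z), ofReal_norm]
  simp_rw [← hl, h1]
  rw [← ENNReal.ofReal_tsum_of_nonneg (fun _ => by positivity) hs'.summable, hs'.tsum_eq,
    ofReal_integral_eq_lintegral_ofReal hint (Eventually.of_forall fun _ => by positivity)]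
  apply lintegral_congr_ae
  filter_upwards [hmem.coeFn_toLp] with x hx
  rw [hx]

end Torus

variable {X : Type*} [MeasurableSpace X] {μ : Measure X}

/-- Parseval's identity for the pull-back of a lattice cube under a map that scales the measure. -/
theorem tsum_integral_preimage_latticeCube (T : X ≃ᵐ (d → ℝ)) {τ : ℝ} (hτ : 0 < τ)
    (hT : Measure.map T μ = ENNReal.ofReal τ • (volume : Measure (d → ℝ))) (n : d → ℤ)
    {g : X → ℂ} (hm : Measurable g) (hfin : ∫⁻ x, ‖g x‖ₑ ^ 2 ∂μ ≠ ∞) :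
    ∑' m : d → ℤ, ‖∫ x in T ⁻¹' latticeCube n, latticeChar m (T x) * g x ∂μ‖ₑ ^ 2
      = ENNReal.ofReal τ * ∫⁻ x in T ⁻¹' latticeCube n, ‖g x‖ₑ ^ 2 ∂μ := by
  have hτ0 : ENNReal.ofReal τ ≠ 0 := by simpa using hτ
  have hres : Measure.map T (μ.restrict (T ⁻¹' latticeCube n))
      = ENNReal.ofReal τ • (volume : Measure (d → ℝ)).restrict (latticeCube n) := by
    rw [← Measure.restrict_smul, ← hT, Measure.restrict_map T.measurable
      (measurableSet_latticeCube n)]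
  set h : (d → ℝ) → ℂ := fun u => g (T.symm u) with hh
  have hhm : Measurable h := hm.comp T.symm.measurable
  have hL : ∫⁻ x in T ⁻¹' latticeCube n, ‖g x‖ₑ ^ 2 ∂μ
      = ENNReal.ofReal τ * ∫⁻ u in latticeCube n, ‖h u‖ₑ ^ 2 := by
    rw [← smul_eq_mul, ← lintegral_smul_measure, ← hres, lintegral_map_equiv]
    simp [hh]
  have hI : ∀ m, ∫ x in T ⁻¹' latticeCube n, latticeChar m (T x) * g x ∂μ
      = (τ : ℂ) * ∫ u in latticeCube n, latticeChar m u * h u := by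
    intro m
    have := integral_smul_measure (fun u => latticeChar m u * h u) (ENNReal.ofReal τ)
      (μ := (volume : Measure (d → ℝ)).restrict (latticeCube n))
    rw [← hres, integral_map_equiv, ENNReal.toReal_ofReal hτ.le, Complex.real_smul] at this
    simpa [hh] using this
  have hfin' : ∫⁻ u in latticeCube n, ‖h u‖ₑ ^ 2 ≠ ∞ := by
    intro htop
    rw [htop, ENNReal.mul_top hτ0] at hL
    exact hfin (top_le_iff.1 (hL ▸ setLIntegral_le_lintegral _ _))
  simp_rw [hI, enorm_mul, mul_pow]
  rw [ENNReal.tsum_mul_left, tsum_integral_latticeCube n hhm hfin', hL]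
  have : ‖(τ : ℂ)‖ₑ = ENNReal.ofReal τ := by
    rw [← ofReal_norm, Complex.norm_real, Real.norm_of_nonneg hτ.le]
  rw [this]
  ring

end Cube

/-! ### Sampling estimates: the central cell against the others -/

theorem enorm_le_tsum_enorm {ι : Type*} {f : ι → ℂ} {a : ℂ} (h : HasSum f a) :
    ‖a‖ₑ ≤ ∑' i, ‖f i‖ₑ := by
  refine le_of_tendsto (continuous_enorm.tendsto a |>.comp h) (Eventually.of_forall fun s => ?_)
  exact (enorm_sum_le s f).trans (ENNReal.sum_le_tsum s)

/-- The weighted Cauchy–Schwarz inequality for sums of extended nonnegative reals. -/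
theorem tsum_sq_le_mul_tsum_div {ι : Type*} (b w : ι → ℝ≥0∞) (h0 : ∀ i, w i ≠ 0)
    (ht : ∀ i, w i ≠ ∞) : (∑' i, b i) ^ 2 ≤ (∑' i, w i) * ∑' i, b i ^ 2 / w i := by
  let _ : MeasurableSpace ι := ⊤
  have hq : Real.HolderConjugate 2 2 := Real.HolderConjugate.two_two
  -- Hölder for counting measure, applied to the factorization b = √w · (b/√w).
  have h := ENNReal.lintegral_mul_le_Lp_mul_Lq (Measure.count : Measure ι) hq
    (f := fun i => w i ^ (1 / 2 : ℝ)) (g := fun i => b i / w i ^ (1 / 2 : ℝ))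
    measurable_from_top.aemeasurable measurable_from_top.aemeasurable
  simp only [lintegral_count, Pi.mul_apply] at h
  have e1 : ∀ i, w i ^ (1 / 2 : ℝ) * (b i / w i ^ (1 / 2 : ℝ)) = b i := fun i =>
    ENNReal.mul_div_cancel (by simp [h0 i, ht i]) (by simp [h0 i, ht i])
  have e2 : ∀ i, (w i ^ (1 / 2 : ℝ)) ^ (2 : ℝ) = w i := fun i => by
    rw [← ENNReal.rpow_mul]; norm_num
  have e3 : ∀ i, (b i / w i ^ (1 / 2 : ℝ)) ^ (2 : ℝ) = b i ^ 2 / w i := fun i => by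
    rw [ENNReal.div_rpow_of_nonneg _ _ (by norm_num), e2, ENNReal.rpow_two]
  simp only [e1, e2, e3] at h
  calc (∑' i, b i) ^ 2 ≤ ((∑' i, w i) ^ (1 / 2 : ℝ) * (∑' i, b i ^ 2 / w i) ^ (1 / 2 : ℝ)) ^ 2 := by
        gcongr
    _ = _ := by
        rw [mul_pow, ← ENNReal.rpow_two, ← ENNReal.rpow_two, ← ENNReal.rpow_mul,
          ← ENNReal.rpow_mul]
        norm_num

theorem enorm_sq_add_le (a b : ℂ) : ‖a + b‖ₑ ^ 2 ≤ 2 * (‖a‖ₑ ^ 2 + ‖b‖ₑ ^ 2) := by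
  have h1 : ∀ z : ℂ, ‖z‖ₑ ^ 2 = ENNReal.ofReal (‖z‖ ^ 2) := fun z => by
    rw [ENNReal.ofReal_pow (norm_nonneg z), ofReal_norm]
  rw [h1, h1, h1, ← ENNReal.ofReal_add (by positivity) (by positivity),
    show (2 : ℝ≥0∞) = ENNReal.ofReal 2 by simp, ← ENNReal.ofReal_mul (by norm_num)]
  apply ENNReal.ofReal_le_ofReal
  have := norm_add_le a b
  nlinarith [norm_nonneg (a + b), norm_nonneg a, norm_nonneg b, sq_nonneg (‖a‖ - ‖b‖)]

section Sampling

variable {d : Type*} [Fintype d] {X : Type*} [MeasurableSpace X] {μ : Measure X}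

/-- The contribution of the cubes away from the origin to the Fourier coefficients. -/
theorem tsum_integral_sub_le (T : X ≃ᵐ (d → ℝ)) {τ : ℝ} (hτ : 0 < τ)
    (hT : Measure.map T μ = ENNReal.ofReal τ • (volume : Measure (d → ℝ)))
    {g : X → ℂ} (hm : Measurable g) (hint : Integrable g μ) (hfin : ∫⁻ x, ‖g x‖ₑ ^ 2 ∂μ ≠ ∞)
    {w : (d → ℤ) → ℝ≥0∞} (hw0 : ∀ n, w n ≠ 0) (hwt : ∀ n, w n ≠ ∞) {δ : ℝ≥0∞} (hδ : δ ≠ ∞)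
    {D : X → ℝ≥0∞} (hD : ∀ n ≠ 0, ∀ x, T x ∈ latticeCube n → ‖g x‖ₑ ^ 2 ≤ δ * w n * D x) :
    ∑' m : d → ℤ, ‖∫ x, latticeChar m (T x) * g x ∂μ -
        ∫ x in T ⁻¹' latticeCube 0, latticeChar m (T x) * g x ∂μ‖ₑ ^ 2
      ≤ ENNReal.ofReal τ * (δ * (∑' n, w n)) * ∫⁻ x, D x ∂μ := by
  classical
  set a : (d → ℤ) → (d → ℤ) → ℂ :=
    fun n m => ∫ x in T ⁻¹' latticeCube n, latticeChar m (T x) * g x ∂μ with ha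
  have hmeas : ∀ n : d → ℤ, MeasurableSet (T ⁻¹' latticeCube n) := fun n =>
    T.measurable (measurableSet_latticeCube n)
  have hdisj : Pairwise (Function.onFun Disjoint fun n : d → ℤ => T ⁻¹' latticeCube n) :=
    fun n n' h => (pairwise_disjoint_latticeCube h).preimage _
  have hun : ⋃ n : d → ℤ, T ⁻¹' latticeCube n = Set.univ := by
    rw [← Set.preimage_iUnion, iUnion_latticeCube, Set.preimage_univ]
  have hint' : ∀ m : d → ℤ, Integrable (fun x => latticeChar m (T x) * g x) μ := fun m =>
    hint.mono (((measurable_latticeChar m).comp T.measurable).aestronglyMeasurable.mul hint.1)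
      (by simp [norm_latticeChar])
  have hsum : ∀ m, HasSum (fun n => a n m) (∫ x, latticeChar m (T x) * g x ∂μ) := by
    intro m
    have := hasSum_integral_iUnion (μ := μ) hmeas hdisj (f := fun x => latticeChar m (T x) * g x)
      (by rw [hun]; exact (hint' m).integrableOn)
    rwa [hun, setIntegral_univ] at this
  -- Setting the term n = 0 to zero leaves a series for the difference; the weights then buy
  -- summability over n for a square of a sum.
  have hstep : ∀ m, ‖∫ x, latticeChar m (T x) * g x ∂μ - a 0 m‖ₑ ^ 2
      ≤ (∑' n, w n) * ∑' n, (if n = 0 then 0 else ‖a n m‖ₑ) ^ 2 / w n := by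
    intro m
    have h1 := (hsum m).update 0 0
    rw [zero_sub, neg_add_eq_sub] at h1
    refine le_trans ?_ (tsum_sq_le_mul_tsum_div _ w hw0 hwt)
    gcongr
    refine (enorm_le_tsum_enorm h1).trans (le_of_eq (tsum_congr fun n => ?_))
    by_cases hn : n = 0
    · subst hn; simp
    · simp [hn]
  calc _ ≤ ∑' m, (∑' n, w n) * ∑' n, (if n = 0 then 0 else ‖a n m‖ₑ) ^ 2 / w n :=
        ENNReal.tsum_le_tsum hstep
    -- Tonelli brings the sum over m inside, where Parseval on the single cell n applies; its factor
    -- w n will cancel the denominator.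
    _ = (∑' n, w n) * ∑' n, (∑' m, (if n = 0 then 0 else ‖a n m‖ₑ) ^ 2) / w n := by
        rw [ENNReal.tsum_mul_left, ENNReal.tsum_comm]
        simp_rw [ENNReal.div_eq_inv_mul, ENNReal.tsum_mul_left]
    _ ≤ (∑' n, w n) * ∑' n : d → ℤ,
          ENNReal.ofReal τ * δ * ∫⁻ x in T ⁻¹' latticeCube n, D x ∂μ := by
        gcongr with n
        by_cases hn : n = 0
        · simp [hn]
        · simp only [hn, if_false, ha]
          rw [tsum_integral_preimage_latticeCube T hτ hT n hm hfin]
          refine ENNReal.div_le_of_le_mul ?_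
          calc _ ≤ ENNReal.ofReal τ * ∫⁻ x in T ⁻¹' latticeCube n, δ * w n * D x ∂μ := by
                gcongr 1
                exact setLIntegral_mono' (hmeas n) fun x hx => hD n hn x hx
            _ ≤ _ := ?_
          rw [lintegral_const_mul' _ _ (ENNReal.mul_ne_top hδ (hwt n))]
          exact le_of_eq (by ring)
    _ = _ := by
        rw [ENNReal.tsum_mul_left, ← lintegral_iUnion hmeas hdisj, hun, Measure.restrict_univ]
        ring

/-- Upper and lower bounds for the square sum of the Fourier coefficients of a function that is
small on the cubes away from the origin. -/
theorem tsum_integral_le (T : X ≃ᵐ (d → ℝ)) {τ : ℝ} (hτ : 0 < τ)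
    (hT : Measure.map T μ = ENNReal.ofReal τ • (volume : Measure (d → ℝ)))
    {g : X → ℂ} (hm : Measurable g) (hint : Integrable g μ) (hfin : ∫⁻ x, ‖g x‖ₑ ^ 2 ∂μ ≠ ∞)
    {w : (d → ℤ) → ℝ≥0∞} (hw0 : ∀ n, w n ≠ 0) (hwt : ∀ n, w n ≠ ∞) {δ : ℝ≥0∞} (hδ : δ ≠ ∞)
    {D : X → ℝ≥0∞} (hD : ∀ n ≠ 0, ∀ x, T x ∈ latticeCube n → ‖g x‖ₑ ^ 2 ≤ δ * w n * D x) :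
    ∑' m : d → ℤ, ‖∫ x, latticeChar m (T x) * g x ∂μ‖ₑ ^ 2
      ≤ ENNReal.ofReal τ * (2 * (∫⁻ x, ‖g x‖ₑ ^ 2 ∂μ + δ * (∑' n, w n) * ∫⁻ x, D x ∂μ)) := by
  have h1 := tsum_integral_preimage_latticeCube T hτ hT 0 hm hfin
  have h2 := tsum_integral_sub_le T hτ hT hm hint hfin hw0 hwt hδ hD
  calc _ ≤ ∑' m : d → ℤ, 2 * (‖∫ x in T ⁻¹' latticeCube 0, latticeChar m (T x) * g x ∂μ‖ₑ ^ 2 +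
          ‖∫ x, latticeChar m (T x) * g x ∂μ -
        ∫ x in T ⁻¹' latticeCube 0, latticeChar m (T x) * g x ∂μ‖ₑ ^ 2) := by
        refine ENNReal.tsum_le_tsum fun m => le_trans (le_of_eq ?_) (enorm_sq_add_le _ _)
        rw [add_sub_cancel]
    _ ≤ 2 * (ENNReal.ofReal τ * ∫⁻ x, ‖g x‖ₑ ^ 2 ∂μ +
          ENNReal.ofReal τ * (δ * (∑' n, w n)) * ∫⁻ x, D x ∂μ) := by
        rw [ENNReal.tsum_mul_left, ENNReal.tsum_add, h1]
        gcongr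
        exact Measure.restrict_le_self
    _ = _ := by ring

/-- The central part is the whole coefficient minus the aliasing part, so |a + b|² ≤ 2(|a|² + |b|²)
also bounds the central energy. -/
theorem lintegral_le_tsum_integral (T : X ≃ᵐ (d → ℝ)) {τ : ℝ} (hτ : 0 < τ)
    (hT : Measure.map T μ = ENNReal.ofReal τ • (volume : Measure (d → ℝ)))
    {g : X → ℂ} (hm : Measurable g) (hint : Integrable g μ) (hfin : ∫⁻ x, ‖g x‖ₑ ^ 2 ∂μ ≠ ∞)
    {w : (d → ℤ) → ℝ≥0∞} (hw0 : ∀ n, w n ≠ 0) (hwt : ∀ n, w n ≠ ∞) {δ : ℝ≥0∞} (hδ : δ ≠ ∞)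
    {D : X → ℝ≥0∞} (hD : ∀ n ≠ 0, ∀ x, T x ∈ latticeCube n → ‖g x‖ₑ ^ 2 ≤ δ * w n * D x) :
    ENNReal.ofReal τ * ∫⁻ x in T ⁻¹' latticeCube 0, ‖g x‖ₑ ^ 2 ∂μ
      ≤ 2 * (∑' m : d → ℤ, ‖∫ x, latticeChar m (T x) * g x ∂μ‖ₑ ^ 2 +
        ENNReal.ofReal τ * (δ * (∑' n, w n) * ∫⁻ x, D x ∂μ)) := by
  have h1 := tsum_integral_preimage_latticeCube T hτ hT 0 hm hfin
  have h2 := tsum_integral_sub_le T hτ hT hm hint hfin hw0 hwt hδ hD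
  rw [← h1]
  calc _ ≤ ∑' m : d → ℤ, 2 * (‖∫ x, latticeChar m (T x) * g x ∂μ‖ₑ ^ 2 +
          ‖∫ x, latticeChar m (T x) * g x ∂μ -
        ∫ x in T ⁻¹' latticeCube 0, latticeChar m (T x) * g x ∂μ‖ₑ ^ 2) := by
        refine ENNReal.tsum_le_tsum fun m => ?_
        rw [← enorm_neg (_ - _)]
        refine le_trans (le_of_eq ?_) (enorm_sq_add_le _ _)
        rw [neg_sub, add_sub_cancel]
    _ ≤ _ := by
        rw [ENNReal.tsum_mul_left, ENNReal.tsum_add, ← mul_assoc]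
        gcongr

end Sampling

/-! ### The low pass filter and the scaling function -/

/-- The polynomial factor of the squared modulus of the low pass filter. -/
def filterPoly (K L : ℕ) (y : ℝ) : ℝ := ∑ n ∈ Finset.range L, ((K - 1 + n).choose n : ℝ) * y ^ n

theorem lowPassSq_eq (K L : ℕ) (ξ : ℝ) : lowPassSq K L ξ =
    Real.cos (Real.pi * ξ) ^ (2 * K) * filterPoly K L (Real.sin (Real.pi * ξ) ^ 2) := by
  simp only [lowPassSq, filterPoly, pow_mul]

theorem one_le_filterPoly (K : ℕ) {L : ℕ} (hL : 1 ≤ L) {y : ℝ} (hy : 0 ≤ y) :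
    1 ≤ filterPoly K L y := by
  have := Finset.single_le_sum (f := fun n => ((K - 1 + n).choose n : ℝ) * y ^ n)
    (s := Finset.range L) (fun n _ => by positivity) (Finset.mem_range.2 hL)
  simpa [filterPoly] using this

/-- On [0, 1] a term of positive degree is at most its coefficient times y. A deviation from 1 that
is linear in y keeps the product over dyadic scales bounded. -/
theorem filterPoly_le_one_add (K L : ℕ) {y : ℝ} (hy : 0 ≤ y) (hy1 : y ≤ 1) :
    filterPoly K L y ≤ 1 + 2 ^ (K + L) * y := by
  induction L with
  | zero => simp [filterPoly]; positivity
  | succ L ih =>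
    rw [filterPoly, Finset.sum_range_succ, ← filterPoly]
    rcases Nat.eq_zero_or_pos L with h0 | hpos
    · subst h0
      simp [filterPoly]
      positivity
    · have h1 : ((K - 1 + L).choose L : ℝ) ≤ 2 ^ (K + L) := by
        have h2 : (K - 1 + L).choose L ≤ 2 ^ (K - 1 + L) := Nat.choose_le_two_pow _ _
        have h3 : 2 ^ (K - 1 + L) ≤ 2 ^ (K + L) := Nat.pow_le_pow_right (by norm_num) (by omega)
        exact_mod_cast h2.trans h3
      have h4 : y ^ L ≤ y := by
        calc y ^ L ≤ y ^ 1 := pow_le_pow_of_le_one hy hy1 hpos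
          _ = y := pow_one y
      have h5 : ((K - 1 + L).choose L : ℝ) * y ^ L ≤ 2 ^ (K + L) * y := by gcongr
      have h6 : (2 : ℝ) ^ (K + (L + 1)) = 2 ^ (K + L) * 2 := by rw [← add_assoc, pow_succ]
      rw [h6]
      linarith

/-- Each new binomial coefficient is at most the bound already reached, so the bound doubles. The
resulting exponent K + L - 1 must be beaten by the 2K coming from the cosines. -/
theorem filterPoly_le {K : ℕ} (hK : 1 ≤ K) (L : ℕ) {y : ℝ} (hy : 0 ≤ y) (hy1 : y ≤ 1) :
    filterPoly K L y ≤ 2 ^ (K + L - 1) := by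
  induction L with
  | zero => simp [filterPoly]
  | succ L ih =>
    rw [filterPoly, Finset.sum_range_succ, ← filterPoly]
    have h1 : ((K - 1 + L).choose L : ℝ) ≤ 2 ^ (K + L - 1) := by
      have h2 : (K - 1 + L).choose L ≤ 2 ^ (K - 1 + L) := Nat.choose_le_two_pow _ _
      rw [show K - 1 + L = K + L - 1 by omega] at h2 ⊢
      exact_mod_cast h2
    have h5 : ((K - 1 + L).choose L : ℝ) * y ^ L ≤ 2 ^ (K + L - 1) * 1 := by
      gcongr
      exact pow_le_one₀ hy hy1
    have h6 : (2 : ℝ) ^ (K + (L + 1) - 1) = 2 ^ (K + L - 1) * 2 := by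
      rw [← pow_succ]; congr 1; omega
    rw [h6]
    linarith

/-- The telescoping product formula for cosines at dyadic scales. -/
theorem prod_cos_mul_sin (x : ℝ) (n : ℕ) :
    (∏ j ∈ Finset.range n, Real.cos (x / 2 ^ j)) * (2 ^ n * Real.sin (2 * x / 2 ^ n))
      = Real.sin (2 * x) := by
  induction n with
  | zero => simp
  | succ n ih =>
    rw [Finset.prod_range_succ, ← ih]
    have h1 : 2 * x / 2 ^ (n + 1) = x / 2 ^ n := by rw [pow_succ]; field_simp
    have h2 : 2 * x / 2 ^ n = 2 * (x / 2 ^ n) := by ring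
    rw [h1, h2, Real.sin_two_mul]
    ring

theorem tendsto_two_pow_mul_sin (x : ℝ) :
    Tendsto (fun n : ℕ => (2 : ℝ) ^ n * Real.sin (x / 2 ^ n)) atTop (𝓝 x) := by
  rcases eq_or_ne x 0 with rfl | hx
  · simp
  have h1 : Tendsto (fun n : ℕ => x / (2 : ℝ) ^ n) atTop (𝓝 0) :=
    tendsto_const_nhds.div_atTop (tendsto_pow_atTop_atTop_of_one_lt (by norm_num))
  have h2 := (Real.continuous_sinc.tendsto 0).comp h1
  rw [Real.sinc_zero] at h2
  have h3 := h2.const_mul x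
  rw [mul_one] at h3
  refine h3.congr fun n => ?_
  have : x / (2 : ℝ) ^ n ≠ 0 := by positivity
  simp only [Function.comp_apply]
  rw [Real.sinc_of_ne_zero this]
  field_simp

section FilterProducts

variable {K L : ℕ}

/-- By 1 + t ≤ exp t and |sin x| ≤ |x| the j-th factor is at most exp(cξ²/4^j), and the geometric
series of exponents stays below 2cξ². -/
theorem prod_filterPoly_le_exp (n : ℕ) (ξ : ℝ) :
    ∏ j ∈ Finset.range n, filterPoly K L (Real.sin (Real.pi * (ξ / 2 ^ j)) ^ 2)
      ≤ Real.exp (2 ^ (K + L) * Real.pi ^ 2 * 2 * ξ ^ 2) := by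
  set c : ℝ := 2 ^ (K + L) * Real.pi ^ 2 with hc
  have hc0 : 0 ≤ c := by positivity
  induction n generalizing ξ with
  | zero => simp; positivity
  | succ n ih =>
    rw [Finset.prod_range_succ']
    have h1 : ∀ j : ℕ, ξ / 2 ^ (j + 1) = ξ / 2 / 2 ^ j := fun j => by
      rw [pow_succ]; field_simp
    simp_rw [h1]
    have h2 : filterPoly K L (Real.sin (Real.pi * (ξ / 2 ^ 0)) ^ 2) ≤ Real.exp (c * ξ ^ 2) := by
      refine (filterPoly_le_one_add K L (by positivity) (Real.sin_sq_le_one _)).trans ?_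
      have h3 : Real.sin (Real.pi * (ξ / 2 ^ 0)) ^ 2 ≤ (Real.pi * ξ) ^ 2 := by
        rw [pow_zero, div_one, sq_le_sq]
        exact Real.abs_sin_le_abs
      have h4 := Real.add_one_le_exp (c * ξ ^ 2)
      have h5 : (2 : ℝ) ^ (K + L) * Real.sin (Real.pi * (ξ / 2 ^ 0)) ^ 2
          ≤ 2 ^ (K + L) * (Real.pi * ξ) ^ 2 := by gcongr
      have h6 : (2 : ℝ) ^ (K + L) * (Real.pi * ξ) ^ 2 = c * ξ ^ 2 := by rw [hc]; ring
      linarith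
    have hnn : ∀ y : ℝ, 0 ≤ filterPoly K L (Real.sin y ^ 2) := fun y =>
      Finset.sum_nonneg fun n _ => by positivity
    calc _ ≤ Real.exp (c * 2 * (ξ / 2) ^ 2) * Real.exp (c * ξ ^ 2) :=
          mul_le_mul (ih (ξ / 2)) h2 (hnn _) (Real.exp_pos _).le
      _ = Real.exp (c * 2 * (ξ / 2) ^ 2 + c * ξ ^ 2) := (Real.exp_add _ _).symm
      _ ≤ _ := by
          apply Real.exp_le_exp.2
          nlinarith [mul_nonneg hc0 (sq_nonneg ξ)]

/-- Each halving of ξ removes one factor, estimated by its maximum; after J halvings the argument is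
at most 1 and the exponential bound takes over. -/
theorem prod_filterPoly_le_two_pow (hK : 1 ≤ K) (n J : ℕ) {ξ : ℝ} (hξ : |ξ| ≤ 2 ^ J) :
    ∏ j ∈ Finset.range n, filterPoly K L (Real.sin (Real.pi * (ξ / 2 ^ j)) ^ 2)
      ≤ Real.exp (2 ^ (K + L) * Real.pi ^ 2 * 2) * (2 ^ (K + L - 1)) ^ J := by
  have hnn : ∀ y : ℝ, 0 ≤ filterPoly K L (Real.sin y ^ 2) := fun y =>
    Finset.sum_nonneg fun n _ => by positivity
  induction J generalizing n ξ with
  | zero =>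
    refine (prod_filterPoly_le_exp n ξ).trans ?_
    rw [pow_zero, mul_one]
    apply Real.exp_le_exp.2
    have : ξ ^ 2 ≤ 1 := by rw [sq_le_one_iff_abs_le_one]; simpa using hξ
    exact mul_le_of_le_one_right (by positivity) this
  | succ J ih =>
    cases n with
    | zero =>
      simp only [Finset.range_zero, Finset.prod_empty]
      refine one_le_mul_of_one_le_of_one_le (Real.one_le_exp (by positivity)) ?_
      exact one_le_pow₀ (one_le_pow₀ (by norm_num))
    | succ n =>
      rw [Finset.prod_range_succ']
      have h1 : ∀ j : ℕ, ξ / 2 ^ (j + 1) = ξ / 2 / 2 ^ j := fun j => by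
        rw [pow_succ]; field_simp
      simp_rw [h1]
      have h2 : |ξ / 2| ≤ 2 ^ J := by
        rw [abs_div, abs_two, div_le_iff₀ (by norm_num), ← pow_succ]; exact hξ
      rw [pow_succ ((2 : ℝ) ^ (K + L - 1)) J, ← mul_assoc]
      exact mul_le_mul (ih n h2)
        (filterPoly_le hK L (by positivity) (Real.sin_sq_le_one _)) (hnn _) (by positivity)

/-- With 2^J ≤ |ξ| < 2^(J+1), the J + 1 crude factors amount to polynomial growth of degree K + L -
1. -/
theorem prod_filterPoly_le_pow (hK : 1 ≤ K) (n : ℕ) {ξ : ℝ} (hξ : 1 ≤ |ξ|) :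
    ∏ j ∈ Finset.range n, filterPoly K L (Real.sin (Real.pi * (ξ / 2 ^ j)) ^ 2)
      ≤ Real.exp (2 ^ (K + L) * Real.pi ^ 2 * 2) * 2 ^ (K + L - 1) * |ξ| ^ (K + L - 1) := by
  obtain ⟨J, h1, h2⟩ := exists_nat_pow_near hξ (by norm_num : (1 : ℝ) < 2)
  refine (prod_filterPoly_le_two_pow hK n (J + 1) h2.le).trans ?_
  rw [mul_assoc (Real.exp _)]
  refine mul_le_mul_of_nonneg_left ?_ (Real.exp_pos _).le
  calc ((2 : ℝ) ^ (K + L - 1)) ^ (J + 1) = 2 ^ (K + L - 1) * (2 ^ J) ^ (K + L - 1) := by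
        rw [pow_succ, mul_comm, ← pow_mul, ← pow_mul, mul_comm J]
    _ ≤ _ := by gcongr

variable {m₀ : ℝ → ℂ} (hm₀ : IsLowPassFilter m₀)

include hm₀ in
-- The linear error of m₀ at the origin makes ∑ |m₀(ξ/2^j) - 1| comparable to a geometric series, so
-- the product converges absolutely.
theorem tendsto_scalingHat (ξ : ℝ) :
    Tendsto (fun n : ℕ => ∏ j ∈ Finset.range n, m₀ (ξ / 2 ^ j)) atTop (𝓝 (scalingHat m₀ ξ)) := by
  have h1 : Tendsto (fun n : ℕ => ξ / (2 : ℝ) ^ n) atTop (𝓝 0) :=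
    tendsto_const_nhds.div_atTop (tendsto_pow_atTop_atTop_of_one_lt (by norm_num))
  have h2 : (fun n : ℕ => m₀ (ξ / 2 ^ n) - 1) =O[atTop] fun n : ℕ => ξ / (2 : ℝ) ^ n :=
    hm₀.isBigO.comp_tendsto h1
  have h3 : Summable fun n : ℕ => ξ / (2 : ℝ) ^ n := by
    have := (summable_geometric_two).mul_left ξ
    simpa [div_eq_mul_inv] using this
  have h4 : Summable fun n : ℕ => ‖m₀ (ξ / 2 ^ n) - 1‖ :=
    summable_of_isBigO_nat h3 h2.norm_left
  have h5 : Multipliable fun n : ℕ => 1 + (m₀ (ξ / 2 ^ n) - 1) :=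
    multipliable_one_add_of_summable h4
  simp only [add_sub_cancel] at h5
  exact h5.hasProd.tendsto_prod_nat

include hm₀ in
theorem measurable_scalingHat : Measurable (scalingHat m₀) := by
  refine measurable_of_tendsto_metrizable (f := fun n ξ => ∏ j ∈ Finset.range n, m₀ (ξ / 2 ^ j))
    (fun n => ?_) (tendsto_pi_nhds.2 (tendsto_scalingHat hm₀))
  have := hm₀.measurable
  fun_prop

variable (hq : ∀ ξ : ℝ, ‖m₀ ξ‖ ^ 2 = lowPassSq K L ξ)

include hq in
theorem norm_prod_sq (n : ℕ) (ξ : ℝ) :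
    ‖∏ j ∈ Finset.range n, m₀ (ξ / 2 ^ j)‖ ^ 2 =
      (∏ j ∈ Finset.range n, Real.cos (Real.pi * ξ / 2 ^ j)) ^ (2 * K) *
      ∏ j ∈ Finset.range n, filterPoly K L (Real.sin (Real.pi * (ξ / 2 ^ j)) ^ 2) := by
  rw [norm_prod, ← Finset.prod_pow, ← Finset.prod_pow, ← Finset.prod_mul_distrib]
  refine Finset.prod_congr rfl fun j _ => ?_
  rw [hq, lowPassSq_eq, mul_div_assoc]

include hm₀ hq in
theorem norm_scalingHat_sq_le_exp {ξ : ℝ} (hξ : |ξ| ≤ 1) :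
    ‖scalingHat m₀ ξ‖ ^ 2 ≤ Real.exp (2 ^ (K + L) * Real.pi ^ 2 * 2) := by
  refine le_of_tendsto ((tendsto_scalingHat hm₀ ξ).norm.pow 2) (Eventually.of_forall fun n => ?_)
  rw [norm_prod_sq hq]
  have hp := prod_filterPoly_le_exp (K := K) (L := L) n ξ
  have h1 : (∏ j ∈ Finset.range n, Real.cos (Real.pi * ξ / 2 ^ j)) ^ (2 * K) ≤ 1 := by
    rw [pow_mul, ← sq_abs, ← pow_mul]
    refine pow_le_one₀ (abs_nonneg _) ?_
    rw [Finset.abs_prod]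
    exact Finset.prod_le_one (fun _ _ => abs_nonneg _) fun _ _ => Real.abs_cos_le_one _
  have h2 : ξ ^ 2 ≤ 1 := by rwa [sq_le_one_iff_abs_le_one]
  have h3 : Real.exp (2 ^ (K + L) * Real.pi ^ 2 * 2 * ξ ^ 2)
      ≤ Real.exp (2 ^ (K + L) * Real.pi ^ 2 * 2) :=
    Real.exp_le_exp.2 (mul_le_of_le_one_right (by positivity) h2)
  have hnn : 0 ≤ ∏ j ∈ Finset.range n, filterPoly K L (Real.sin (Real.pi * (ξ / 2 ^ j)) ^ 2) :=
    Finset.prod_nonneg fun j _ => Finset.sum_nonneg fun n _ => by positivity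
  exact (mul_le_of_le_one_left hnn h1).trans (hp.trans h3)

include hm₀ hq in
-- The cosine product times 2^n sin(2πξ/2^n) equals sin(2πξ), of modulus at most 1. In the limit the
-- cosines contribute |2πξ|^(-2K) against the growth of the polynomial factors.
theorem norm_scalingHat_sq_mul_le (hK : 1 ≤ K) {ξ : ℝ} (hξ : 1 ≤ |ξ|) :
    ‖scalingHat m₀ ξ‖ ^ 2 * |ξ| ^ (2 * K) ≤
      Real.exp (2 ^ (K + L) * Real.pi ^ 2 * 2) * 2 ^ (K + L - 1) * |ξ| ^ (K + L - 1) := by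
  have h1 := ((tendsto_scalingHat hm₀ ξ).norm.pow 2).mul
    ((tendsto_two_pow_mul_sin (2 * (Real.pi * ξ))).pow (2 * K))
  have h2 : ‖scalingHat m₀ ξ‖ ^ 2 * (2 * (Real.pi * ξ)) ^ (2 * K) ≤
      Real.exp (2 ^ (K + L) * Real.pi ^ 2 * 2) * 2 ^ (K + L - 1) * |ξ| ^ (K + L - 1) := by
    refine le_of_tendsto h1 (Eventually.of_forall fun n => ?_)
    rw [norm_prod_sq hq, mul_right_comm, ← mul_pow, prod_cos_mul_sin]
    refine le_trans ?_ (prod_filterPoly_le_pow (L := L) hK n hξ)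
    refine mul_le_of_le_one_left
      (Finset.prod_nonneg fun j _ => Finset.sum_nonneg fun n _ => by positivity) ?_
    rw [pow_mul]
    exact pow_le_one₀ (by positivity) (Real.sin_sq_le_one _)
  refine le_trans ?_ h2
  rw [pow_mul, pow_mul, sq_abs]
  gcongr ?_ * ?_ ^ K
  nlinarith [Real.pi_gt_three, sq_nonneg ξ, mul_nonneg (sub_nonneg.2 Real.pi_gt_three.le)
    (sq_nonneg ξ), mul_nonneg (mul_nonneg (sub_nonneg.2 Real.pi_gt_three.le)
    (sub_nonneg.2 Real.pi_gt_three.le)) (sq_nonneg ξ)]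

include hm₀ hq in
/-- The Fourier transform of the scaling function decays quadratically. -/
theorem exists_norm_scalingHat_le (hLK : L + 3 ≤ K) :
    ∃ C : ℝ, 0 < C ∧ ∀ ξ, ‖scalingHat m₀ ξ‖ ≤ C * (1 + ξ ^ 2)⁻¹ := by
  set M : ℝ := Real.exp (2 ^ (K + L) * Real.pi ^ 2 * 2) * 2 ^ (K + L - 1) with hM
  have hM0 : 0 < M := by positivity
  refine ⟨2 * √M, by positivity, fun ξ => ?_⟩
  refine le_of_sq_le_sq ?_ (by positivity)
  rw [mul_pow, mul_pow, Real.sq_sqrt hM0.le, inv_pow, ← div_eq_mul_inv, le_div_iff₀ (by positivity)]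
  rcases le_total |ξ| 1 with h | h
  · have h1 := norm_scalingHat_sq_le_exp hm₀ hq h
    have h2 : Real.exp (2 ^ (K + L) * Real.pi ^ 2 * 2) ≤ M :=
      le_mul_of_one_le_right (Real.exp_pos _).le (one_le_pow₀ (by norm_num))
    have h3 : ξ ^ 2 ≤ 1 := by rwa [sq_le_one_iff_abs_le_one]
    have h4 : (1 + ξ ^ 2) ^ 2 ≤ 2 ^ 2 := by gcongr; linarith
    calc _ ≤ M * 2 ^ 2 := mul_le_mul (h1.trans h2) h4 (by positivity) hM0.le
      _ = _ := by ring
  · have h1 := norm_scalingHat_sq_mul_le hm₀ hq (by omega) h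
    have h2 : ‖scalingHat m₀ ξ‖ ^ 2 * |ξ| ^ 4 ≤ M := by
      -- Quadratic decay of the modulus needs four powers of |ξ| left over, and 4 + (K + L - 1) ≤ 2K
      -- is exactly L + 3 ≤ K.
      have h3 : 2 * K = 4 + (K + L - 1) + (2 * K - 4 - (K + L - 1)) := by omega
      have hpos : 0 < |ξ| := by linarith
      rw [h3, pow_add, pow_add] at h1
      have h5 : 1 ≤ |ξ| ^ (2 * K - 4 - (K + L - 1)) := one_le_pow₀ h
      have h6 : ‖scalingHat m₀ ξ‖ ^ 2 * |ξ| ^ 4 * |ξ| ^ (K + L - 1) ≤ M * |ξ| ^ (K + L - 1) := by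
        refine le_trans ?_ h1
        rw [mul_assoc]
        exact mul_le_mul_of_nonneg_left (le_mul_of_one_le_right (by positivity) h5) (by positivity)
      exact le_of_mul_le_mul_right h6 (by positivity)
    have h3 : 1 ≤ ξ ^ 2 := by rwa [one_le_sq_iff_one_le_abs]
    have h4 : (1 + ξ ^ 2) ^ 2 ≤ 4 * |ξ| ^ 4 := by
      rw [show |ξ| ^ 4 = (|ξ| ^ 2) ^ 2 by ring, sq_abs]
      nlinarith
    calc _ ≤ ‖scalingHat m₀ ξ‖ ^ 2 * (4 * |ξ| ^ 4) := by gcongr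
      _ ≤ _ := by linarith

include hm₀ hq in
-- The polynomial factors are at least 1, and the cosine product is a quotient of sines. Jordan's
-- inequality applies to its numerator because |2πξ| ≤ π/2.
theorem le_norm_scalingHat_sq (hL : 1 ≤ L) {ξ : ℝ} (hξ : |ξ| ≤ 1 / 4) :
    (2 / Real.pi) ^ (2 * K) ≤ ‖scalingHat m₀ ξ‖ ^ 2 := by
  refine ge_of_tendsto ((tendsto_scalingHat hm₀ ξ).norm.pow 2) (Eventually.of_forall fun n => ?_)
  rw [norm_prod_sq hq]
  have h1 : 1 ≤ ∏ j ∈ Finset.range n, filterPoly K L (Real.sin (Real.pi * (ξ / 2 ^ j)) ^ 2) := by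
    refine Finset.one_le_prod fun j _ => one_le_filterPoly K hL (by positivity)
  refine le_trans ?_ (le_mul_of_one_le_right ?_ h1)
  swap
  · rw [pow_mul]; positivity
  rw [pow_mul _ 2 K, pow_mul _ 2 K, ← sq_abs (∏ _ ∈ _, _)]
  gcongr
  rcases eq_or_ne ξ 0 with rfl | h0
  · simp only [mul_zero, zero_div, Real.cos_zero, Finset.prod_const_one, abs_one]
    rw [div_le_one Real.pi_pos]
    linarith [Real.pi_gt_three]
  have h2 := congrArg abs (prod_cos_mul_sin (Real.pi * ξ) n)
  rw [abs_mul] at h2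
  have h3 : |2 ^ n * Real.sin (2 * (Real.pi * ξ) / 2 ^ n)| ≤ |2 * (Real.pi * ξ)| := by
    rw [abs_mul, abs_of_pos (by positivity : (0 : ℝ) < 2 ^ n)]
    calc _ ≤ 2 ^ n * |2 * (Real.pi * ξ) / 2 ^ n| :=
          mul_le_mul_of_nonneg_left Real.abs_sin_le_abs (by positivity)
      _ = _ := by
          rw [abs_div, abs_of_pos (by positivity : (0 : ℝ) < 2 ^ n)]; field_simp
  have h4 : 2 / Real.pi * |2 * (Real.pi * ξ)| ≤ |Real.sin (2 * (Real.pi * ξ))| := by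
    apply Real.mul_abs_le_abs_sin
    rw [abs_mul, abs_mul, abs_two, abs_of_pos Real.pi_pos]
    nlinarith [Real.pi_pos]
  have h5 : 0 < |2 * (Real.pi * ξ)| := by positivity
  rw [← h2] at h4
  have h6 := h4.trans (mul_le_mul_of_nonneg_left h3 (abs_nonneg _))
  exact le_of_mul_le_mul_right h6 h5

end FilterProducts

/-! ### Quadratic decay and summable lattice weights -/

theorem tsum_prod_eq {ι κ : Type*} (f : ι × κ → ℝ≥0∞) : ∑' p, f p = ∑' i, ∑' k, f (i, k) :=
  ENNReal.tsum_prod (f := fun i k => f (i, k))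

/-- The quadratically decaying reference function. -/
def decay (x : ℝ) : ℝ := (1 + x ^ 2)⁻¹

theorem decay_pos (x : ℝ) : 0 < decay x := by unfold decay; positivity

theorem decay_le_one (x : ℝ) : decay x ≤ 1 :=
  inv_le_one_of_one_le₀ (by nlinarith [sq_nonneg x])

theorem decay_two_mul_le (x : ℝ) : decay (2 * x) ≤ decay x := by
  refine inv_anti₀ (by positivity) ?_
  nlinarith [sq_nonneg x]

theorem sq_mul_decay_le_one (x : ℝ) : x ^ 2 * decay x ≤ 1 := by
  unfold decay
  rw [← div_eq_mul_inv, div_le_one (by positivity)]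
  linarith

theorem continuous_decay : Continuous decay :=
  Continuous.inv₀ (by fun_prop) fun x => by positivity

theorem integrable_decay : Integrable decay := integrable_inv_one_add_sq

/-- The summable weight `1` at `0` and `4 / n²` at `n ≠ 0`. -/
def intWeight (n : ℤ) : ℝ := if n = 0 then 1 else 4 / (n : ℝ) ^ 2

theorem intWeight_pos (n : ℤ) : 0 < intWeight n := by
  unfold intWeight
  split_ifs with h
  · norm_num
  · have : (n : ℝ) ≠ 0 := by exact_mod_cast h
    positivity

theorem summable_intWeight : Summable intWeight := by
  have h1 : Summable fun n : ℤ => 4 * (1 / (n : ℝ) ^ 2) :=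
    (Real.summable_one_div_int_pow.2 (by norm_num)).mul_left 4
  have h2 : Summable fun n : ℤ => if n = 0 then (1 : ℝ) else 0 :=
    summable_of_ne_finset_zero (s := {0}) (fun n hn => by simp at hn; simp [hn])
  refine (h1.add h2).congr fun n => ?_
  unfold intWeight
  split_ifs with h
  · simp [h]
  · ring

theorem tsum_intWeight_ne_top : ∑' n, ENNReal.ofReal (intWeight n) ≠ ∞ := by
  rw [← ENNReal.ofReal_tsum_of_nonneg (fun n => (intWeight_pos n).le) summable_intWeight]
  exact ENNReal.ofReal_ne_top

/-- Lying within 1/2 of a nonzero integer n forces |t| ≥ |n|/2. -/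
theorem decay_mul_le_of_ne {n : ℤ} (hn : n ≠ 0) {t y : ℝ} (hy : y ≠ 0) (ht : |t - n| ≤ 1 / 2) :
    decay (y * t) ≤ (y ^ 2)⁻¹ * intWeight n := by
  have hn1 : (1 : ℝ) ≤ |(n : ℝ)| := by exact_mod_cast Int.one_le_abs hn
  have h1 : |(n : ℝ)| / 2 ≤ |t| := by
    have : |(n : ℝ)| ≤ |t| + |t - n| := by
      calc |(n : ℝ)| = |t - (t - n)| := by congr 1; ring
        _ ≤ _ := abs_sub _ _
    linarith
  have h2 : (n : ℝ) ^ 2 / 4 ≤ t ^ 2 := by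
    rw [← sq_abs (n : ℝ), ← sq_abs t]
    nlinarith
  have hn0 : (n : ℝ) ≠ 0 := by exact_mod_cast hn
  have hy2 : 0 < y ^ 2 := by positivity
  rw [intWeight, if_neg hn, decay, ← one_div, ← one_div, div_mul_div_comm, one_mul,
    div_le_div_iff₀ (by positivity) (by positivity)]
  nlinarith [mul_le_mul_of_nonneg_left h2 hy2.le]

theorem decay_mul_le (n : ℤ) {t y : ℝ} (hy : y ≠ 0) (ht : |t - n| ≤ 1 / 2) :
    decay (y * t) ≤ (1 + (y ^ 2)⁻¹) * intWeight n := by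
  have hy2 : 0 < (y ^ 2)⁻¹ := by positivity
  rcases eq_or_ne n 0 with rfl | hn
  · refine (decay_le_one _).trans ?_
    simp only [intWeight, if_true, mul_one]
    linarith
  · refine (decay_mul_le_of_ne hn hy ht).trans ?_
    have := intWeight_pos n
    gcongr
    linarith

theorem decay_le_intWeight {n : ℤ} {c η : ℝ} (hc : 0 < c) (hc1 : c ≤ 1)
    (h : |c * η - n| ≤ 1 / 2) : decay η ≤ intWeight n := by
  rcases eq_or_ne n 0 with rfl | hn
  · simpa [intWeight] using decay_le_one η
  · have := decay_mul_le_of_ne hn (inv_ne_zero hc.ne') h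
    rw [← mul_assoc, inv_mul_cancel₀ hc.ne', one_mul] at this
    refine this.trans (mul_le_of_le_one_left (intWeight_pos n).le ?_)
    simp only [inv_pow, inv_inv]
    exact pow_le_one₀ hc.le hc1

/-- Taking y = c⁻¹ in `decay_mul_le_of_ne` turns dense sampling into the factor c². This is the sole
source of smallness in the lower frame bound. -/
theorem decay_le_sq_mul_intWeight {n : ℤ} (hn : n ≠ 0) {c c₁ η : ℝ} (hc : 0 < c) (hc1 : c ≤ c₁)
    (h : |c * η - n| ≤ 1 / 2) : decay η ≤ c₁ ^ 2 * intWeight n := by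
  have := decay_mul_le_of_ne hn (inv_ne_zero hc.ne') h
  rw [← mul_assoc, inv_mul_cancel₀ hc.ne', one_mul] at this
  refine this.trans ?_
  have := intWeight_pos n
  simp only [inv_pow, inv_inv]
  gcongr

/-- The product weight on `ℤ³`. -/
def cubeWeight (n : Fin 3 → ℤ) : ℝ := intWeight (n 0) * intWeight (n 1) * intWeight (n 2)

theorem cubeWeight_pos (n : Fin 3 → ℤ) : 0 < cubeWeight n :=
  mul_pos (mul_pos (intWeight_pos _) (intWeight_pos _)) (intWeight_pos _)

/-- Triples as functions on `Fin 3`. -/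
def tripleEquiv : ℤ × ℤ × ℤ ≃ (Fin 3 → ℤ) where
  toFun p := ![p.1, p.2.1, p.2.2]
  invFun f := (f 0, f 1, f 2)
  left_inv p := rfl
  right_inv f := by ext i; fin_cases i <;> rfl

theorem tsum_cubeWeight_ne_top : ∑' n, ENNReal.ofReal (cubeWeight n) ≠ ∞ := by
  rw [← tripleEquiv.tsum_eq, tsum_prod_eq]
  simp_rw [tsum_prod_eq]
  have h : ∀ a b c : ℤ, ENNReal.ofReal (cubeWeight (tripleEquiv (a, b, c))) =
      ENNReal.ofReal (intWeight a) * (ENNReal.ofReal (intWeight b) *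
        ENNReal.ofReal (intWeight c)) := by
    intro a b c
    rw [← ENNReal.ofReal_mul (intWeight_pos _).le, ← ENNReal.ofReal_mul (intWeight_pos _).le,
      ← mul_assoc]
    rfl
  simp_rw [h, ENNReal.tsum_mul_left, ENNReal.tsum_mul_right]
  exact ENNReal.mul_ne_top tsum_intWeight_ne_top
    (ENNReal.mul_ne_top tsum_intWeight_ne_top tsum_intWeight_ne_top)

/-- A nonzero n has a nonzero coordinate; that factor yields c₁², the other two only their weights.
-/
theorem decay_prod_le_cubeWeight {n : Fin 3 → ℤ} (hn : n ≠ 0) {c₁ c₂ η₀ η₁ η₂ : ℝ}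
    (hc : 0 < c₂) (h21 : c₂ ≤ c₁) (hc1 : c₁ ≤ 1) (h0 : |c₁ * η₀ - n 0| ≤ 1 / 2)
    (h1 : |c₂ * η₁ - n 1| ≤ 1 / 2) (h2 : |c₂ * η₂ - n 2| ≤ 1 / 2) :
    decay η₀ * decay η₁ * decay η₂ ≤ c₁ ^ 2 * cubeWeight n := by
  have hc' : 0 < c₁ := hc.trans_le h21
  have e0 := decay_le_intWeight hc' hc1 h0
  have e1 := decay_le_intWeight hc (h21.trans hc1) h1
  have e2 := decay_le_intWeight hc (h21.trans hc1) h2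
  have p0 := intWeight_pos (n 0)
  have p1 := intWeight_pos (n 1)
  have p2 := intWeight_pos (n 2)
  have q0 := decay_pos η₀
  have q1 := decay_pos η₁
  have q2 := decay_pos η₂
  have hex : n 0 ≠ 0 ∨ n 1 ≠ 0 ∨ n 2 ≠ 0 := by
    by_contra hcon
    push Not at hcon
    exact hn (funext fun i => by fin_cases i <;> simp [hcon])
  rcases hex with h | h | h
  · have e := decay_le_sq_mul_intWeight h hc' le_rfl h0
    calc _ ≤ (c₁ ^ 2 * intWeight (n 0)) * intWeight (n 1) * intWeight (n 2) := by gcongr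
      _ = _ := by unfold cubeWeight; ring
  · have e := decay_le_sq_mul_intWeight h hc h21 h1
    calc _ ≤ intWeight (n 0) * (c₁ ^ 2 * intWeight (n 1)) * intWeight (n 2) := by gcongr
      _ = _ := by unfold cubeWeight; ring
  · have e := decay_le_sq_mul_intWeight h hc h21 h2
    calc _ ≤ intWeight (n 0) * intWeight (n 1) * (c₁ ^ 2 * intWeight (n 2)) := by gcongr
      _ = _ := by unfold cubeWeight; ring

/-! ### Sums over shears and scales -/

/-- After reindexing k by its distance to round(x/y), the number x/y - k lies within 1/2 of the new
integer index. -/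
theorem tsum_decay_sub_mul_le (x : ℝ) {y : ℝ} (hy : y ≠ 0) :
    ∑' k : ℤ, ENNReal.ofReal (decay (x - k * y)) ≤
      ENNReal.ofReal (1 + (y ^ 2)⁻¹) * ∑' n, ENNReal.ofReal (intWeight n) := by
  rw [← ENNReal.tsum_mul_left, ← (Equiv.subLeft (round (x / y))).tsum_eq
    (fun n => ENNReal.ofReal (1 + (y ^ 2)⁻¹) * ENNReal.ofReal (intWeight n))]
  refine ENNReal.tsum_le_tsum fun k => ?_
  rw [← ENNReal.ofReal_mul (by positivity)]
  apply ENNReal.ofReal_le_ofReal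
  have h1 : x - k * y = y * (x / y - k) := by field_simp
  rw [h1]
  apply decay_mul_le _ hy
  have := abs_sub_round (x / y)
  simp only [Equiv.subLeft_apply, Int.cast_sub]
  rw [show x / y - k - (round (x / y) - k) = x / y - round (x / y) by ring]
  exact this

/-- Telescoping: for g(y) = y²/(1 + y²) and ρ² ≤ 1/2 each term is at most 2(g(y) - g(ρy)), and 0 ≤ g
≤ 1. -/
theorem tsum_sq_mul_decay_sq_le {ρ : ℝ} (hρ : ρ ^ 2 ≤ 1 / 2) (x : ℝ) :
    ∑' j : ℕ, ENNReal.ofReal ((ρ ^ j * x) ^ 2 * decay (ρ ^ j * x) ^ 2) ≤ 2 := by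
  set g : ℝ → ℝ := fun y => y ^ 2 * decay y with hg
  have key : ∀ y, y ^ 2 * decay y ^ 2 ≤ 2 * (g y - g (ρ * y)) := by
    intro y
    simp only [hg, decay]
    have h1 : 0 < 1 + y ^ 2 := by positivity
    have h2 : 0 < 1 + (ρ * y) ^ 2 := by positivity
    have e : 2 * (y ^ 2 * (1 + y ^ 2)⁻¹ - (ρ * y) ^ 2 * (1 + (ρ * y) ^ 2)⁻¹)
        - y ^ 2 * (1 + y ^ 2)⁻¹ ^ 2
        = y ^ 2 * (2 * (1 - ρ ^ 2) * (1 + y ^ 2) - (1 + (ρ * y) ^ 2))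
          / ((1 + y ^ 2) ^ 2 * (1 + (ρ * y) ^ 2)) := by
      field_simp
      ring
    have h3 : 0 ≤ 2 * (1 - ρ ^ 2) * (1 + y ^ 2) - (1 + (ρ * y) ^ 2) := by
      nlinarith [mul_nonneg (sub_nonneg.2 hρ) (sq_nonneg y), sq_nonneg y]
    have h4 : 0 ≤ y ^ 2 * (2 * (1 - ρ ^ 2) * (1 + y ^ 2) - (1 + (ρ * y) ^ 2))
          / ((1 + y ^ 2) ^ 2 * (1 + (ρ * y) ^ 2)) := by positivity
    linarith
  refine ENNReal.tsum_le_of_sum_range_le fun n => ?_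
  rw [← ENNReal.ofReal_sum_of_nonneg (fun j _ => by positivity),
    show (2 : ℝ≥0∞) = ENNReal.ofReal 2 by simp]
  apply ENNReal.ofReal_le_ofReal
  have hsum : ∀ n : ℕ, ∑ j ∈ Finset.range n, (ρ ^ j * x) ^ 2 * decay (ρ ^ j * x) ^ 2
      ≤ 2 * (g x - g (ρ ^ n * x)) := by
    intro n
    induction n with
    | zero => simp
    | succ n ih =>
      rw [Finset.sum_range_succ]
      have := key (ρ ^ n * x)
      rw [← mul_assoc, ← pow_succ'] at this
      linarith
  have h1 := hsum n
  have h2 : g x ≤ 1 := sq_mul_decay_le_one x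
  have h3 : 0 ≤ g (ρ ^ n * x) := mul_nonneg (sq_nonneg _) (decay_pos _).le
  linarith

/-- The majorant of the Fourier transform of the shearlet generator that is summed over all scales
and shears. -/
def majorant (η₀ η₁ η₂ : ℝ) : ℝ := η₀ ^ 6 * decay η₀ ^ 4 * decay η₁ * decay η₂

theorem majorant_nonneg (η₀ η₁ η₂ : ℝ) : 0 ≤ majorant η₀ η₁ η₂ := by
  have h0 := decay_pos η₀
  have h1 := decay_pos η₁
  have h2 := decay_pos η₂
  unfold majorant
  positivity

/-- Each of the two shear sums costs 1 + y⁻² = (y² · decay y)⁻¹. The powers in `majorant` are chosen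
so that y² · decay(y)² survives, which is still summable over scales. -/
theorem tsum_majorant_shear_le (y x₁ x₂ : ℝ) :
    ∑' k : ℤ × ℤ, ENNReal.ofReal (majorant y (x₁ - k.1 * y) (x₂ - k.2 * y)) ≤
      ENNReal.ofReal (y ^ 2 * decay y ^ 2) * (∑' n, ENNReal.ofReal (intWeight n)) ^ 2 := by
  rcases eq_or_ne y 0 with rfl | hy
  · simp [majorant]
  have hd := decay_pos y
  have h : ∀ a b : ℤ, ENNReal.ofReal (majorant y (x₁ - a * y) (x₂ - b * y)) =
      ENNReal.ofReal (y ^ 6 * decay y ^ 4) * (ENNReal.ofReal (decay (x₁ - a * y)) *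
        ENNReal.ofReal (decay (x₂ - b * y))) := by
    intro a b
    rw [← ENNReal.ofReal_mul (decay_pos _).le, ← ENNReal.ofReal_mul (by positivity), ← mul_assoc]
    rfl
  rw [tsum_prod_eq]
  simp_rw [h, ENNReal.tsum_mul_left, ENNReal.tsum_mul_right]
  calc _ ≤ ENNReal.ofReal (y ^ 6 * decay y ^ 4) *
        ((ENNReal.ofReal (1 + (y ^ 2)⁻¹) * ∑' n, ENNReal.ofReal (intWeight n)) *
        (ENNReal.ofReal (1 + (y ^ 2)⁻¹) * ∑' n, ENNReal.ofReal (intWeight n))) := by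
        gcongr <;> exact tsum_decay_sub_mul_le _ hy
    _ = ENNReal.ofReal (y ^ 6 * decay y ^ 4) * (ENNReal.ofReal (1 + (y ^ 2)⁻¹) *
        ENNReal.ofReal (1 + (y ^ 2)⁻¹)) * (∑' n, ENNReal.ofReal (intWeight n)) ^ 2 := by ring
    _ = _ := by
        rw [← ENNReal.ofReal_mul (by positivity), ← ENNReal.ofReal_mul (by positivity)]
        congr 2
        unfold decay
        field_simp
        ring

/-- The shear bound does not depend on the points x₁, x₂, so the factors b j by which the last two
coordinates are scaled play no role. -/
theorem tsum_majorant_le {ρ : ℝ} (hρ : ρ ^ 2 ≤ 1 / 2) (b : ℕ → ℝ) (x₀ x₁ x₂ : ℝ) :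
    ∑' p : ℕ × ℤ × ℤ, ENNReal.ofReal (majorant (ρ ^ p.1 * x₀)
        (b p.1 * x₁ - p.2.1 * (ρ ^ p.1 * x₀)) (b p.1 * x₂ - p.2.2 * (ρ ^ p.1 * x₀))) ≤
      2 * (∑' n, ENNReal.ofReal (intWeight n)) ^ 2 := by
  rw [tsum_prod_eq]
  calc _ ≤ ∑' j : ℕ, ENNReal.ofReal ((ρ ^ j * x₀) ^ 2 * decay (ρ ^ j * x₀) ^ 2) *
        (∑' n, ENNReal.ofReal (intWeight n)) ^ 2 :=
        ENNReal.tsum_le_tsum fun j => tsum_majorant_shear_le (ρ ^ j * x₀) (b j * x₁) (b j * x₂)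
    _ ≤ _ := by
        rw [ENNReal.tsum_mul_right]
        gcongr
        exact tsum_sq_mul_decay_sq_le hρ x₀

/-! ### Integrability from quadratic decay -/

theorem memLp_tensor {f₁ f₂ f₃ : ℝ → ℂ} (m₁ : Measurable f₁) (m₂ : Measurable f₂)
    (m₃ : Measurable f₃) (h₁ : MemLp f₁ 2) (h₂ : MemLp f₂ 2) (h₃ : MemLp f₃ 2) :
    MemLp (tensor f₁ f₂ f₃) 2 := by
  rw [memLp_two_iff_integrable_sq_norm (measurable_tensor m₁ m₂ m₃).aestronglyMeasurable]
  have h : ∀ {f : ℝ → ℂ}, MemLp f 2 → Integrable (fun x => ((‖f x‖ ^ 2 : ℝ) : ℂ)) := fun hf =>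
    (hf.integrable_norm_pow (by norm_num)).ofReal
  refine (integrable_tensor (h h₁) (h h₂) (h h₃)).norm.congr (Eventually.of_forall fun x => ?_)
  simp [tensor, mul_pow]

theorem integrable_of_norm_le_decay {f : ℝ → ℂ} (hf : Measurable f) {C : ℝ}
    (h : ∀ x, ‖f x‖ ≤ C * decay x) : Integrable f :=
  (integrable_decay.const_mul C).mono' hf.aestronglyMeasurable (Eventually.of_forall h)

theorem memLp_of_norm_le_decay {f : ℝ → ℂ} (hf : Measurable f) {C : ℝ}
    (h : ∀ x, ‖f x‖ ≤ C * decay x) : MemLp f 2 := by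
  rw [memLp_two_iff_integrable_sq_norm hf.aestronglyMeasurable]
  refine (integrable_decay.const_mul (C ^ 2)).mono' (by fun_prop)
    (Eventually.of_forall fun x => ?_)
  rw [Real.norm_of_nonneg (by positivity)]
  have hd := decay_pos x
  calc ‖f x‖ ^ 2 ≤ (C * decay x) ^ 2 := by gcongr; exact h x
    _ = C ^ 2 * (decay x * decay x) := by ring
    _ ≤ C ^ 2 * (1 * decay x) := by gcongr; exact decay_le_one x
    _ = _ := by ring

/-! ### The high pass filter -/

section HighPass

variable {K L : ℕ} {m₀ m₁ : ℝ → ℂ} (hq : ∀ ξ : ℝ, ‖m₀ ξ‖ ^ 2 = lowPassSq K L ξ)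
  (hm₁q : ∀ ξ : ℝ, ‖m₁ ξ‖ ^ 2 = ‖m₀ (ξ + 1 / 2)‖ ^ 2)

include hq hm₁q in
theorem norm_highPass_sq (ξ : ℝ) : ‖m₁ ξ‖ ^ 2 =
    Real.sin (Real.pi * ξ) ^ (2 * K) * filterPoly K L (Real.cos (Real.pi * ξ) ^ 2) := by
  rw [hm₁q, hq, lowPassSq_eq, show Real.pi * (ξ + 1 / 2) = Real.pi * ξ + Real.pi / 2 by ring,
    Real.cos_add_pi_div_two, Real.sin_add_pi_div_two, pow_mul, pow_mul, neg_sq]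

include hq hm₁q in
-- The squared sine is at most both 1 and (4πy)², hence at most a multiple of y²/(1 + y²). Three
-- such factors provide the y⁶ of `majorant`.
theorem exists_norm_highPass_sq_le (hK : 3 ≤ K) :
    ∃ C : ℝ, 0 < C ∧ ∀ y, ‖m₁ (4 * y)‖ ^ 2 ≤ C * (y ^ 2 * decay y) ^ 3 := by
  refine ⟨((4 * Real.pi) ^ 2 + 1) ^ 3 * 2 ^ (K + L - 1), by positivity, fun y => ?_⟩
  rw [norm_highPass_sq hq hm₁q]
  have hd := decay_pos y
  set s := Real.sin (Real.pi * (4 * y)) with hs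
  have h1 : s ^ 2 ≤ ((4 * Real.pi) ^ 2 + 1) * (y ^ 2 * decay y) := by
    have h2 : s ^ 2 ≤ (Real.pi * (4 * y)) ^ 2 := by
      rw [sq_le_sq]; exact Real.abs_sin_le_abs
    have h3 : s ^ 2 ≤ 1 := Real.sin_sq_le_one _
    unfold decay
    rw [← div_eq_mul_inv, ← mul_div_assoc, le_div_iff₀ (by positivity)]
    nlinarith [mul_le_mul_of_nonneg_right h3 (sq_nonneg y)]
  have h4 : s ^ (2 * K) ≤ (s ^ 2) ^ 3 := by
    rw [pow_mul]
    exact pow_le_pow_of_le_one (sq_nonneg _) (Real.sin_sq_le_one _) hK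
  have h5 : filterPoly K L (Real.cos (Real.pi * (4 * y)) ^ 2) ≤ 2 ^ (K + L - 1) :=
    filterPoly_le (by omega) L (by positivity) (Real.cos_sq_le_one _)
  calc _ ≤ (s ^ 2) ^ 3 * 2 ^ (K + L - 1) :=
        mul_le_mul h4 h5 (Finset.sum_nonneg fun n _ => by positivity) (by positivity)
    _ ≤ (((4 * Real.pi) ^ 2 + 1) * (y ^ 2 * decay y)) ^ 3 * 2 ^ (K + L - 1) := by gcongr
    _ = _ := by ring

include hq hm₁q in
-- The angle 4π|y| runs through [2π/5, 4π/5], away from the zeros of the sine; Jordan's inequality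
-- at 0 and at π gives 4/5 and 2/5 as lower bounds.
theorem le_norm_highPass_sq (hL : 1 ≤ L) {y : ℝ} (h1 : 1 / 10 ≤ |y|) (h2 : |y| ≤ 1 / 5) :
    (2 / 5) ^ (2 * K) ≤ ‖m₁ (4 * y)‖ ^ 2 := by
  rw [norm_highPass_sq hq hm₁q]
  refine le_trans ?_ (le_mul_of_one_le_right ?_ (one_le_filterPoly K hL (by positivity)))
  swap
  · rw [pow_mul]; positivity
  rw [pow_mul, pow_mul]
  gcongr ?_ ^ K
  rw [← sq_abs (Real.sin _)]
  gcongr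
  have hpi := Real.pi_pos
  have h3 : |Real.sin (Real.pi * (4 * y))| = |Real.sin (Real.pi * (4 * |y|))| := by
    rcases abs_choice y with h | h <;> rw [h]
    rw [show Real.pi * (4 * -y) = -(Real.pi * (4 * y)) by ring, Real.sin_neg, abs_neg]
  rw [h3]
  refine le_trans ?_ (le_abs_self _)
  rcases le_total (4 * |y|) (1 / 2) with h | h
  · have := Real.mul_le_sin (x := Real.pi * (4 * |y|)) (by positivity) (by nlinarith)
    refine le_trans ?_ this
    rw [div_mul_eq_mul_div, le_div_iff₀ hpi]
    nlinarith
  · have := Real.mul_le_sin (x := Real.pi - Real.pi * (4 * |y|)) (by nlinarith) (by nlinarith)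
    rw [Real.sin_pi_sub] at this
    refine le_trans ?_ this
    rw [div_mul_eq_mul_div, le_div_iff₀ hpi]
    nlinarith

end HighPass

/-! ### Bounds for the generators -/

/-- The properties of the Fourier transforms of the generators on which the frame property
rests. -/
structure GeneratorBounds (Φ : ℝ → ℂ) (Ψ : R3 → ℂ) (C A : ℝ) : Prop where
  pos_C : 0 < C
  pos_A : 0 < A
  measurable_Φ : Measurable Φ
  measurable_Ψ : Measurable Ψ
  integrable_Ψ : Integrable Ψ
  memLp_Ψ : MemLp Ψ 2
  norm_Φ_le : ∀ ξ, ‖Φ ξ‖ ≤ C * decay ξ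
  -- The decay is divided in two: the majorant is summed over scales and shears, the last bracket
  -- pays for the cells away from the origin.
  norm_Ψ_sq_le : ∀ η, ‖Ψ η‖ ^ 2 ≤
    C * majorant (η 0) (η 1) (η 2) * (decay (η 0) * decay (η 1) * decay (η 2))
  le_norm_Φ_sq : ∀ ξ, |ξ| ≤ 1 / 10 → A ≤ ‖Φ ξ‖ ^ 2
  le_norm_Ψ_sq : ∀ η : R3, 1 / 10 ≤ |η 0| → |η 0| ≤ 1 / 5 → |η 1| ≤ 1 / 10 → |η 2| ≤ 1 / 10 →
    A ≤ ‖Ψ η‖ ^ 2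

theorem shearletHat_eq_tensor (m₀ m₁ : ℝ → ℂ) : shearletHat m₀ m₁ =
    tensor (fun y => m₁ (4 * y) * scalingHat m₀ y) (fun y => scalingHat m₀ (2 * y))
      (fun y => scalingHat m₀ (2 * y)) := rfl

theorem exists_generatorBounds {K L : ℕ} {m₀ m₁ : ℝ → ℂ} (hm₀ : IsLowPassFilter m₀)
    (hm₁ : IsFilter m₁) (hq : ∀ ξ : ℝ, ‖m₀ ξ‖ ^ 2 = lowPassSq K L ξ)
    (hm₁q : ∀ ξ : ℝ, ‖m₁ ξ‖ ^ 2 = ‖m₀ (ξ + 1 / 2)‖ ^ 2) (hL : 1 ≤ L) (hLK : L + 3 ≤ K) :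
    ∃ C A, GeneratorBounds (scalingHat m₀) (shearletHat m₀ m₁) C A := by
  obtain ⟨C₀, hC₀, hΦ⟩ := exists_norm_scalingHat_le hm₀ hq hLK
  obtain ⟨C₁, hC₁, hH⟩ := exists_norm_highPass_sq_le hq hm₁q (show 3 ≤ K by omega)
  change ∀ ξ, _ ≤ C₀ * decay ξ at hΦ
  have hΦm := measurable_scalingHat hm₀
  have hm₁m := hm₁.measurable
  have hΦ2 : ∀ y, ‖scalingHat m₀ (2 * y)‖ ≤ C₀ * decay y := fun y =>
    (hΦ _).trans (by gcongr; exact decay_two_mul_le y)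
  have hm₁b : ∀ y, ‖m₁ (4 * y)‖ ≤ √C₁ := fun y => by
    refine Real.le_sqrt_of_sq_le ((hH y).trans ?_)
    have := decay_pos y
    exact mul_le_of_le_one_right hC₁.le (pow_le_one₀ (by positivity) (sq_mul_decay_le_one y))
  have hP : ∀ y, ‖m₁ (4 * y) * scalingHat m₀ y‖ ≤ (√C₁ * C₀) * decay y := fun y => by
    rw [norm_mul, mul_assoc]
    exact mul_le_mul (hm₁b y) (hΦ y) (norm_nonneg _) (Real.sqrt_nonneg _)
  have hPm : Measurable fun y => m₁ (4 * y) * scalingHat m₀ y := by fun_prop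
  have hΦ2m : Measurable fun y => scalingHat m₀ (2 * y) := by fun_prop
  set A₀ : ℝ := (2 / Real.pi) ^ (2 * K) with hA₀
  have hA₀pos : 0 < A₀ := by have := Real.pi_pos; positivity
  refine ⟨max C₀ (C₁ * (C₀ ^ 2) ^ 3), min A₀ ((2 / 5) ^ (2 * K) * A₀ * A₀ * A₀),
    ⟨lt_max_of_lt_left hC₀, by positivity, hΦm, ?_, ?_, ?_, ?_, ?_, ?_, ?_⟩⟩
  · rw [shearletHat_eq_tensor]
    exact measurable_tensor hPm hΦ2m hΦ2m
  · rw [shearletHat_eq_tensor]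
    exact integrable_tensor (integrable_of_norm_le_decay hPm hP)
      (integrable_of_norm_le_decay hΦ2m hΦ2) (integrable_of_norm_le_decay hΦ2m hΦ2)
  · rw [shearletHat_eq_tensor]
    exact memLp_tensor hPm hΦ2m hΦ2m (memLp_of_norm_le_decay hPm hP)
      (memLp_of_norm_le_decay hΦ2m hΦ2) (memLp_of_norm_le_decay hΦ2m hΦ2)
  · intro ξ
    refine (hΦ ξ).trans ?_
    have := decay_pos ξ
    gcongr
    exact le_max_left _ _
  · intro η
    have d0 := decay_pos (η 0)
    have d1 := decay_pos (η 1)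
    have d2 := decay_pos (η 2)
    have hmaj := majorant_nonneg (η 0) (η 1) (η 2)
    calc ‖shearletHat m₀ m₁ η‖ ^ 2 = ‖m₁ (4 * η 0)‖ ^ 2 * ‖scalingHat m₀ (η 0)‖ ^ 2 *
          ‖scalingHat m₀ (2 * η 1)‖ ^ 2 * ‖scalingHat m₀ (2 * η 2)‖ ^ 2 := by
          simp only [shearletHat, norm_mul, mul_pow]
      _ ≤ C₁ * (η 0 ^ 2 * decay (η 0)) ^ 3 * (C₀ * decay (η 0)) ^ 2 *
          (C₀ * decay (η 1)) ^ 2 * (C₀ * decay (η 2)) ^ 2 := by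
          gcongr
          · exact hH _
          · exact hΦ _
          · exact hΦ2 _
          · exact hΦ2 _
      _ = (C₁ * (C₀ ^ 2) ^ 3) * majorant (η 0) (η 1) (η 2) *
          (decay (η 0) * decay (η 1) * decay (η 2)) := by
          unfold majorant; ring
      _ ≤ _ := by
          gcongr
          exact le_max_right _ _
  · intro ξ hξ
    exact (min_le_left _ _).trans (le_norm_scalingHat_sq hm₀ hq hL (by linarith))
  · intro η h0 h0' h1 h2
    refine (min_le_right _ _).trans ?_
    have e0 := le_norm_highPass_sq hq hm₁q hL h0 h0'
    have e1 := le_norm_scalingHat_sq hm₀ hq hL (ξ := η 0) (by linarith)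
    have e2 := le_norm_scalingHat_sq hm₀ hq hL (ξ := 2 * η 1)
      (by rw [abs_mul, abs_two]; linarith)
    have e3 := le_norm_scalingHat_sq hm₀ hq hL (ξ := 2 * η 2)
      (by rw [abs_mul, abs_two]; linarith)
    simp only [shearletHat, norm_mul, mul_pow]
    gcongr

/-! ### Matrices acting on `ℝ³` -/

/-- The measurable equivalence of `ℝⁿ` given by an invertible matrix. -/
def matEquiv (N : Matrix (Fin 3) (Fin 3) ℝ) (hN : N.det ≠ 0) : (Fin 3 → ℝ) ≃ᵐ (Fin 3 → ℝ) where
  toFun := N.mulVec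
  invFun := N⁻¹.mulVec
  left_inv x := by
    simp [Matrix.mulVec_mulVec, Matrix.nonsing_inv_mul N (isUnit_iff_ne_zero.2 hN)]
  right_inv x := by
    simp [Matrix.mulVec_mulVec, Matrix.mul_nonsing_inv N (isUnit_iff_ne_zero.2 hN)]
  measurable_toFun := (Continuous.matrix_mulVec continuous_const continuous_id).measurable
  measurable_invFun := (Continuous.matrix_mulVec continuous_const continuous_id).measurable

theorem map_matEquiv (N : Matrix (Fin 3) (Fin 3) ℝ) (hN : N.det ≠ 0) :
    Measure.map (matEquiv N hN) volume
      = ENNReal.ofReal |N.det|⁻¹ • (volume : Measure (Fin 3 → ℝ)) := by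
  have := Real.map_matrix_volume_pi_eq_smul_volume_pi hN
  rw [abs_inv] at this
  exact this

/-- The coordinates of a vector of `ℝ³`, transformed by an invertible matrix. -/
def coordEquiv (N : Matrix (Fin 3) (Fin 3) ℝ) (hN : N.det ≠ 0) : R3 ≃ᵐ (Fin 3 → ℝ) :=
  (MeasurableEquiv.toLp 2 (Fin 3 → ℝ)).symm.trans (matEquiv N hN)

theorem map_coordEquiv (N : Matrix (Fin 3) (Fin 3) ℝ) (hN : N.det ≠ 0) :
    Measure.map (coordEquiv N hN) volume
      = ENNReal.ofReal |N.det|⁻¹ • (volume : Measure (Fin 3 → ℝ)) := by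
  rw [← map_matEquiv N hN, ← (PiLp.volume_preserving_ofLp (Fin 3)).map_eq]
  rw [Measure.map_map (matEquiv N hN).measurable (PiLp.volume_preserving_ofLp (Fin 3)).measurable]
  rfl

/-- The self-map of Euclidean three-space given by a matrix. -/
def matMap (N : Matrix (Fin 3) (Fin 3) ℝ) (x : R3) : R3 := WithLp.toLp 2 (N.mulVec x.ofLp)

/-- The self-equivalence of Euclidean three-space given by an invertible matrix. -/
def matMapEquiv (N : Matrix (Fin 3) (Fin 3) ℝ) (hN : N.det ≠ 0) : R3 ≃ᵐ R3 :=
  (coordEquiv N hN).trans (MeasurableEquiv.toLp 2 (Fin 3 → ℝ))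

theorem coe_matMapEquiv (N : Matrix (Fin 3) (Fin 3) ℝ) (hN : N.det ≠ 0) :
    ⇑(matMapEquiv N hN) = matMap N := rfl

theorem map_matMapEquiv (N : Matrix (Fin 3) (Fin 3) ℝ) (hN : N.det ≠ 0) :
    Measure.map (matMapEquiv N hN) volume = ENNReal.ofReal |N.det|⁻¹ • (volume : Measure R3) := by
  have h : Measure.map (MeasurableEquiv.toLp 2 (Fin 3 → ℝ)) (volume : Measure (Fin 3 → ℝ))
      = (volume : Measure R3) := (PiLp.volume_preserving_toLp (Fin 3)).map_eq
  have h2 : (matMapEquiv N hN : R3 → R3) =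
      (MeasurableEquiv.toLp 2 (Fin 3 → ℝ)) ∘ (coordEquiv N hN) := rfl
  rw [h2, ← Measure.map_map (MeasurableEquiv.measurable _) (MeasurableEquiv.measurable _),
    map_coordEquiv, Measure.map_smul, h]

theorem quasiMeasurePreserving_matMap {N : Matrix (Fin 3) (Fin 3) ℝ} (hN : N.det ≠ 0) :
    Measure.QuasiMeasurePreserving (matMap N) volume volume := by
  refine ⟨(matMapEquiv N hN).measurable, ?_⟩
  rw [← coe_matMapEquiv N hN, map_matMapEquiv]
  exact Measure.smul_absolutelyContinuous

theorem measurable_matMap (N : Matrix (Fin 3) (Fin 3) ℝ) : Measurable (matMap N) := by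
  have h1 : Continuous N.mulVec := Continuous.matrix_mulVec continuous_const continuous_id
  exact (MeasurableEquiv.toLp 2 (Fin 3 → ℝ)).measurable.comp
    (h1.measurable.comp (MeasurableEquiv.toLp 2 (Fin 3 → ℝ)).symm.measurable)

theorem inner_matMap {N B : Matrix (Fin 3) (Fin 3) ℝ} (h : B.transpose * N = 1) (ξ x : R3) :
    ⟪matMap N ξ, matMap B x⟫ = ⟪ξ, x⟫ := by
  simp only [EuclideanSpace.inner_eq_star_dotProduct, matMap, star_trivial]
  rw [← Matrix.vecMul_transpose, ← Matrix.dotProduct_mulVec, Matrix.mulVec_mulVec, h,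
    Matrix.one_mulVec]

theorem enorm_sq_eq (z : ℂ) : ‖z‖ₑ ^ 2 = ENNReal.ofReal (‖z‖ ^ 2) := by
  rw [ENNReal.ofReal_pow (norm_nonneg z), ofReal_norm]

theorem lintegral_enorm_sq_ne_top {X : Type*} [MeasurableSpace X] {μ : Measure X} {F : X → ℂ}
    (hF : MemLp F 2 μ) : ∫⁻ x, ‖F x‖ₑ ^ 2 ∂μ ≠ ∞ := by
  have := (eLpNorm_lt_top_iff_lintegral_rpow_enorm_lt_top (by norm_num) (by norm_num)).1 hF.2
  simpa using this.ne

/-! ### One layer of the system -/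

section Layer

theorem det_sample₁ (c₁ c₂ : ℝ) : (sample₁ c₁ c₂).det = c₁ * c₂ ^ 2 := by
  simp [sample₁, Matrix.det_diagonal, Fin.prod_univ_three]
  ring

theorem det_sample₁_mul_ne_zero {N : Matrix (Fin 3) (Fin 3) ℝ} (hN : N.det ≠ 0) {c₁ c₂ : ℝ}
    (hc₁ : 0 < c₁) (hc₂ : 0 < c₂) : (sample₁ c₁ c₂ * N).det ≠ 0 := by
  rw [Matrix.det_mul, det_sample₁]
  positivity

/-- The Fourier coefficients of one layer of the system. -/
def layerCoeff (c₁ c₂ κ : ℝ) (N : Matrix (Fin 3) (Fin 3) ℝ) (Ψ F : R3 → ℂ) (m : Fin 3 → ℤ) : ℂ :=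
  ∫ ξ, latticeChar m ((sample₁ c₁ c₂ * N).mulVec ξ.ofLp) * ((κ : ℂ) * conj (Ψ (matMap N ξ)) * F ξ)

variable {N : Matrix (Fin 3) (Fin 3) ℝ} (hN : N.det ≠ 0) {c₁ c₂ κ : ℝ}
  (hκ : κ ^ 2 = |N.det|) {Ψ F : R3 → ℂ} {Q : R3 → ℝ} {q : ℝ}

/-- The frequencies that the sampling map sends to the unit cube centred at the origin. -/
def centralCell (c₁ c₂ : ℝ) (N : Matrix (Fin 3) (Fin 3) ℝ) : Set R3 :=
  {ξ | (sample₁ c₁ c₂ * N).mulVec ξ.ofLp ∈ latticeCube (0 : Fin 3 → ℤ)}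

theorem abs_sub_le_of_mem_latticeCube {n : Fin 3 → ℤ} {u : Fin 3 → ℝ} (h : u ∈ latticeCube n)
    (i : Fin 3) : |u i - n i| ≤ 1 / 2 := by
  have := h i
  simp only [Set.mem_Ioc] at this
  rw [abs_le]
  constructor <;> linarith

theorem sample₁_mul_mulVec (c₁ c₂ : ℝ) (N : Matrix (Fin 3) (Fin 3) ℝ) (ξ : R3) :
    (sample₁ c₁ c₂ * N).mulVec ξ.ofLp =
      ![c₁ * matMap N ξ 0, c₂ * matMap N ξ 1, c₂ * matMap N ξ 2] := by
  rw [← Matrix.mulVec_mulVec]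
  ext i
  fin_cases i <;> simp [sample₁, Matrix.mulVec_diagonal, matMap]

include hN hκ in
-- The sampling estimates for g = κ · conj(Ψ ∘ N) · F. Multiplying by the covolume c₁c₂² removes all
-- dependence of the constants on N, and the remainder retains Q ∘ N so that the layers can be
-- summed.
theorem layer_bounds (hc₂ : 0 < c₂) (h21 : c₂ ≤ c₁) (hc₁ : c₁ ≤ 1)
    (hΨm : Measurable Ψ) (hΨ2 : MemLp Ψ 2) (hFm : Measurable F) (hF : MemLp F 2)
    (hQ0 : ∀ η, 0 ≤ Q η) (hQq : ∀ η, Q η ≤ q)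
    (hΨQ : ∀ η, ‖Ψ η‖ ^ 2 ≤ Q η * (decay (η 0) * decay (η 1) * decay (η 2))) :
    ENNReal.ofReal (c₁ * c₂ ^ 2) * ∑' m, ‖layerCoeff c₁ c₂ κ N Ψ F m‖ₑ ^ 2 ≤
        2 * (1 + ∑' n, ENNReal.ofReal (cubeWeight n)) *
          ∫⁻ ξ, ENNReal.ofReal (Q (matMap N ξ)) * ‖F ξ‖ₑ ^ 2 ∧
    ∫⁻ ξ in centralCell c₁ c₂ N, ‖Ψ (matMap N ξ)‖ₑ ^ 2 * ‖F ξ‖ₑ ^ 2 ≤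
      2 * (ENNReal.ofReal (c₁ * c₂ ^ 2) * ∑' m, ‖layerCoeff c₁ c₂ κ N Ψ F m‖ₑ ^ 2 +
        ENNReal.ofReal (c₁ ^ 2) * (∑' n, ENNReal.ofReal (cubeWeight n)) *
          ∫⁻ ξ, ENNReal.ofReal (Q (matMap N ξ)) * ‖F ξ‖ₑ ^ 2) := by
  have hc₁0 : 0 < c₁ := hc₂.trans_le h21
  set P := sample₁ c₁ c₂ * N with hP
  have hPdet : P.det ≠ 0 := det_sample₁_mul_ne_zero hN hc₁0 hc₂
  set T := coordEquiv P hPdet with hT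
  have hTmap := map_coordEquiv P hPdet
  have hTval : ∀ ξ, T ξ = P.mulVec ξ.ofLp := fun ξ => rfl
  set v : ℝ := c₁ * c₂ ^ 2 with hv
  have hv0 : 0 < v := by positivity
  set s : ℝ := |N.det| with hs
  have hs0 : 0 < s := abs_pos.2 hN
  have hPabs : |P.det| = v * s := by
    rw [hP, Matrix.det_mul, det_sample₁, abs_mul, abs_of_pos hv0]
  have hτ : 0 < |P.det|⁻¹ := by rw [hPabs]; positivity
  set g : R3 → ℂ := fun ξ => (κ : ℂ) * conj (Ψ (matMap N ξ)) * F ξ with hg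
  have hNm := measurable_matMap N
  have hgm : Measurable g := by
    have h1 : Measurable fun ξ => conj (Ψ (matMap N ξ)) :=
      Complex.continuous_conj.measurable.comp (hΨm.comp hNm)
    exact (h1.const_mul _).mul hFm
  have hgn : ∀ ξ, ‖g ξ‖ₑ ^ 2 = ENNReal.ofReal s * (‖Ψ (matMap N ξ)‖ₑ ^ 2 * ‖F ξ‖ₑ ^ 2) := by
    intro ξ
    have h1 : ‖(κ : ℂ)‖ₑ ^ 2 = ENNReal.ofReal s := by
      rw [enorm_sq_eq, Complex.norm_real, Real.norm_eq_abs, sq_abs, hκ]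
    have h2 : ‖conj (Ψ (matMap N ξ))‖ₑ = ‖Ψ (matMap N ξ)‖ₑ := by
      rw [← ofReal_norm, ← ofReal_norm, RCLike.norm_conj]
    simp only [hg, enorm_mul, mul_pow]
    rw [h1, h2, mul_assoc]
  have hprod : ∀ η : R3, decay (η 0) * decay (η 1) * decay (η 2) ≤ 1 := fun η =>
    mul_le_one₀ (mul_le_one₀ (decay_le_one _) (decay_pos _).le (decay_le_one _)) (decay_pos _).le
      (decay_le_one _)
  have hΨle : ∀ η, ‖Ψ η‖ₑ ^ 2 ≤ ENNReal.ofReal (Q η) := fun η => by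
    rw [enorm_sq_eq]
    exact ENNReal.ofReal_le_ofReal ((hΨQ η).trans (mul_le_of_le_one_right (hQ0 η) (hprod η)))
  set I : ℝ≥0∞ := ∫⁻ ξ, ENNReal.ofReal (Q (matMap N ξ)) * ‖F ξ‖ₑ ^ 2 with hI
  have hgI : ∫⁻ ξ, ‖g ξ‖ₑ ^ 2 ≤ ENNReal.ofReal s * I := by
    rw [hI, ← lintegral_const_mul' _ _ ENNReal.ofReal_ne_top]
    refine lintegral_mono fun ξ => ?_
    rw [hgn]
    gcongr
    exact hΨle _
  have hItop : I ≠ ∞ := by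
    have : I ≤ ENNReal.ofReal q * ∫⁻ ξ, ‖F ξ‖ₑ ^ 2 := by
      rw [hI, ← lintegral_const_mul' _ _ ENNReal.ofReal_ne_top]
      refine lintegral_mono fun ξ => ?_
      gcongr
      exact hQq _
    exact ne_top_of_le_ne_top
      (ENNReal.mul_ne_top ENNReal.ofReal_ne_top (lintegral_enorm_sq_ne_top hF)) this
  have hgfin : ∫⁻ ξ, ‖g ξ‖ₑ ^ 2 ≠ ∞ :=
    ne_top_of_le_ne_top (ENNReal.mul_ne_top ENNReal.ofReal_ne_top hItop) hgI
  have hgint : Integrable g := by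
    have h1 : MemLp (fun ξ => Ψ (matMap N ξ)) 2 := by
      have : MemLp Ψ 2 (Measure.map (matMapEquiv N hN) volume) := by
        rw [map_matMapEquiv]; exact hΨ2.smul_measure ENNReal.ofReal_ne_top
      exact this.comp_of_map (matMapEquiv N hN).measurable.aemeasurable
    have h2 : MemLp (fun ξ => (κ : ℂ) * conj (Ψ (matMap N ξ))) 2 := by
      refine MemLp.const_mul ?_ _
      exact h1.mono (Complex.continuous_conj.measurable.comp
        (hΨm.comp hNm)).aestronglyMeasurable (by simp)
    exact h2.integrable_mul hF
  set D : R3 → ℝ≥0∞ := fun ξ => ENNReal.ofReal s * (ENNReal.ofReal (Q (matMap N ξ)) * ‖F ξ‖ₑ ^ 2)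
    with hD
  have hDI : ∫⁻ ξ, D ξ = ENNReal.ofReal s * I := by
    rw [hI, ← lintegral_const_mul' _ _ ENNReal.ofReal_ne_top]
  -- The product of decays gives c₁² and the cell weight; Q is left untouched inside D.
  have hdom : ∀ n ≠ 0, ∀ ξ, T ξ ∈ latticeCube n → ‖g ξ‖ₑ ^ 2 ≤
      ENNReal.ofReal (c₁ ^ 2) * ENNReal.ofReal (cubeWeight n) * D ξ := by
    intro n hn ξ hξ
    rw [hTval, sample₁_mul_mulVec] at hξ
    have h0 := abs_sub_le_of_mem_latticeCube hξ 0
    have h1 := abs_sub_le_of_mem_latticeCube hξ 1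
    have h2 := abs_sub_le_of_mem_latticeCube hξ 2
    simp only [Matrix.cons_val] at h0 h1 h2
    have h3 := decay_prod_le_cubeWeight hn hc₂ h21 hc₁ h0 h1 h2
    have h4 : ‖Ψ (matMap N ξ)‖ₑ ^ 2 ≤ ENNReal.ofReal (c₁ ^ 2) * ENNReal.ofReal (cubeWeight n) *
        ENNReal.ofReal (Q (matMap N ξ)) := by
      rw [enorm_sq_eq, ← ENNReal.ofReal_mul (by positivity),
        ← ENNReal.ofReal_mul (mul_nonneg (by positivity) (cubeWeight_pos n).le)]
      apply ENNReal.ofReal_le_ofReal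
      refine (hΨQ _).trans ?_
      rw [mul_comm]
      exact mul_le_mul_of_nonneg_right h3 (hQ0 _)
    rw [hgn, hD]
    calc _ ≤ ENNReal.ofReal s * (ENNReal.ofReal (c₁ ^ 2) * ENNReal.ofReal (cubeWeight n) *
        ENNReal.ofReal (Q (matMap N ξ)) * ‖F ξ‖ₑ ^ 2) := by gcongr
      _ = _ := by ring
  have hw0 : ∀ n, ENNReal.ofReal (cubeWeight n) ≠ 0 := fun n => by simpa using cubeWeight_pos n
  have hup := tsum_integral_le T hτ hTmap hgm hgint hgfin hw0 (fun _ => ENNReal.ofReal_ne_top)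
    ENNReal.ofReal_ne_top hdom
  have hlo := lintegral_le_tsum_integral T hτ hTmap hgm hgint hgfin hw0
    (fun _ => ENNReal.ofReal_ne_top) ENNReal.ofReal_ne_top hdom
  have hcoef : ∀ m, ∫ ξ, latticeChar m (T ξ) * g ξ = layerCoeff c₁ c₂ κ N Ψ F m := fun m => rfl
  simp only [hcoef] at hup hlo
  have hcell : T ⁻¹' latticeCube 0 = centralCell c₁ c₂ N := rfl
  rw [hcell] at hlo
  simp only [hgn] at hlo
  rw [lintegral_const_mul' _ _ ENNReal.ofReal_ne_top] at hlo
  rw [hDI] at hup hlo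
  set S : ℝ≥0∞ := ∑' n, ENNReal.ofReal (cubeWeight n) with hS
  set W := ∑' m, ‖layerCoeff c₁ c₂ κ N Ψ F m‖ₑ ^ 2 with hW
  -- The covolume of the sampling lattice, the Jacobian of the sampling map and κ² cancel.
  have hcancel : ENNReal.ofReal v * ENNReal.ofReal |P.det|⁻¹ * ENNReal.ofReal s = 1 := by
    rw [← ENNReal.ofReal_mul hv0.le, ← ENNReal.ofReal_mul (by positivity), hPabs,
      show v * (v * s)⁻¹ * s = 1 by field_simp, ENNReal.ofReal_one]
  constructor
  · calc ENNReal.ofReal v * W ≤ ENNReal.ofReal v * (ENNReal.ofReal |P.det|⁻¹ *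
          (2 * (ENNReal.ofReal s * I + 1 * S * (ENNReal.ofReal s * I)))) := by
          gcongr
          refine hup.trans ?_
          gcongr
          rw [← ENNReal.ofReal_one]
          exact ENNReal.ofReal_le_ofReal (pow_le_one₀ hc₁0.le hc₁)
      _ = (ENNReal.ofReal v * ENNReal.ofReal |P.det|⁻¹ * ENNReal.ofReal s) *
          (2 * (1 + S) * I) := by ring
      _ = _ := by rw [hcancel, one_mul]
  · set J := ∫⁻ ξ in centralCell c₁ c₂ N, ‖Ψ (matMap N ξ)‖ₑ ^ 2 * ‖F ξ‖ₑ ^ 2 with hJ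
    calc J = (ENNReal.ofReal v * ENNReal.ofReal |P.det|⁻¹ * ENNReal.ofReal s) * J := by
          rw [hcancel, one_mul]
      _ = ENNReal.ofReal v * (ENNReal.ofReal |P.det|⁻¹ * (ENNReal.ofReal s * J)) := by ring
      _ ≤ ENNReal.ofReal v * (2 * (W + ENNReal.ofReal |P.det|⁻¹ *
          (ENNReal.ofReal (c₁ ^ 2) * S * (ENNReal.ofReal s * I)))) := by gcongr
      _ = 2 * (ENNReal.ofReal v * W + (ENNReal.ofReal v * ENNReal.ofReal |P.det|⁻¹ *
          ENNReal.ofReal s) * (ENNReal.ofReal (c₁ ^ 2) * S * I)) := by ring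
      _ = _ := by rw [hcancel, one_mul]

end Layer

/-! ### Scales and shears covering the pyramid -/

/-- The scale and shear parameters of the system. -/
abbrev ShearParam (α : ℝ) : Type :=
  {p : ℕ × ℤ × ℤ //
    |p.2.1| ≤ ⌈(2 : ℝ) ^ (p.1 * (α - 1) / 2)⌉ ∧ |p.2.2| ≤ ⌈(2 : ℝ) ^ (p.1 * (α - 1) / 2)⌉}

/-- The inverse transpose of the matrix `S_k A_{2^j}`. -/
def dualMat (α : ℝ) (p : ℕ × ℤ × ℤ) : Matrix (Fin 3) (Fin 3) ℝ :=
  !![((2 : ℝ) ^ (p.1 * α / 2))⁻¹, 0, 0;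
    -(p.2.1 * ((2 : ℝ) ^ (p.1 * α / 2))⁻¹), ((2 : ℝ) ^ ((p.1 : ℝ) / 2))⁻¹, 0;
    -(p.2.2 * ((2 : ℝ) ^ (p.1 * α / 2))⁻¹), 0, ((2 : ℝ) ^ ((p.1 : ℝ) / 2))⁻¹]

/-- The reciprocal of the normalizing factor of the system. -/
def dualNorm (α : ℝ) (p : ℕ × ℤ × ℤ) : ℝ := ((2 : ℝ) ^ (p.1 * (α + 2) / 4))⁻¹

/-- The factor 2^(j(α+2)/4) is the square root of det(S_k A_{2^j}), so it is the L² normalization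
and yields κ² = |det N|. -/
theorem det_dualMat (α : ℝ) (p : ℕ × ℤ × ℤ) : (dualMat α p).det = dualNorm α p ^ 2 := by
  have h : ((2 : ℝ) ^ (p.1 * (α + 2) / 4)) ^ 2 =
      (2 : ℝ) ^ (p.1 * α / 2) * ((2 : ℝ) ^ ((p.1 : ℝ) / 2)) ^ 2 := by
    rw [← Real.rpow_mul_natCast (by norm_num), ← Real.rpow_mul_natCast (by norm_num),
      ← Real.rpow_add (by norm_num)]
    congr 1
    push_cast
    ring
  simp only [dualMat, dualNorm, Matrix.det_fin_three, Matrix.of_apply, Matrix.cons_val]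
  rw [inv_pow, h, mul_inv]
  ring

theorem dualNorm_pos (α : ℝ) (p : ℕ × ℤ × ℤ) : 0 < dualNorm α p := by
  unfold dualNorm
  positivity

theorem matMap_dualMat (α : ℝ) (p : ℕ × ℤ × ℤ) (ξ : R3) :
    matMap (dualMat α p) ξ 0 = ((2 : ℝ) ^ (-(α / 2))) ^ p.1 * ξ 0 ∧
    matMap (dualMat α p) ξ 1 = ((2 : ℝ) ^ ((p.1 : ℝ) / 2))⁻¹ * ξ 1 -
      p.2.1 * (((2 : ℝ) ^ (-(α / 2))) ^ p.1 * ξ 0) ∧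
    matMap (dualMat α p) ξ 2 = ((2 : ℝ) ^ ((p.1 : ℝ) / 2))⁻¹ * ξ 2 -
      p.2.2 * (((2 : ℝ) ^ (-(α / 2))) ^ p.1 * ξ 0) := by
  have h : ((2 : ℝ) ^ (-(α / 2))) ^ p.1 = ((2 : ℝ) ^ (p.1 * α / 2))⁻¹ := by
    rw [← Real.rpow_mul_natCast (by norm_num), ← Real.rpow_neg (by norm_num)]
    congr 1
    ring
  rw [h]
  refine ⟨?_, ?_, ?_⟩ <;>
  · simp [matMap, dualMat, dotProduct, Fin.sum_univ_three]
    try ring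

/-- The dilated pyramid `|ξ₁| ≥ 1/10`, `|ξ₂|, |ξ₃| ≤ |ξ₁|`. -/
def cone : Set R3 := {ξ | 1 / 10 ≤ |ξ 0| ∧ |ξ 1| ≤ |ξ 0| ∧ |ξ 2| ≤ |ξ 0|}

/-- The ceiling in the shear range leaves room for rounding to the nearest integer. -/
theorem abs_round_le_ceil {t e : ℝ} (h : |t| ≤ e) : |round t| ≤ ⌈e⌉ := by
  have h1 := abs_sub_round t
  have h2 : |(round t : ℝ)| < ⌈e⌉ + 1 := by
    calc |(round t : ℝ)| = |t - (t - round t)| := by congr 1; ring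
      _ ≤ |t| + |t - round t| := abs_sub _ _
      _ < ⌈e⌉ + 1 := by linarith [Int.le_ceil e]
  have h3 : |round t| < ⌈e⌉ + 1 := by exact_mod_cast h2
  omega

/-- Every frequency in the dilated pyramid is moved by some scaling and shear into a fixed box. -/
theorem exists_shearParam {α : ℝ} (hα : 1 < α) (hα' : α ≤ 2) {ξ : R3} (hξ : ξ ∈ cone) :
    ∃ p : ShearParam α, 1 / 10 ≤ |matMap (dualMat α p) ξ 0| ∧ |matMap (dualMat α p) ξ 0| ≤ 1 / 5 ∧
      |matMap (dualMat α p) ξ 1| ≤ 1 / 10 ∧ |matMap (dualMat α p) ξ 2| ≤ 1 / 10 := by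
  obtain ⟨h0, h1, h2⟩ := hξ
  have hr1 : (1 : ℝ) < 2 ^ (α / 2) := Real.one_lt_rpow (by norm_num) (by linarith)
  have hr2 : (2 : ℝ) ^ (α / 2) ≤ 2 := by
    calc (2 : ℝ) ^ (α / 2) ≤ 2 ^ (1 : ℝ) := Real.rpow_le_rpow_of_exponent_le (by norm_num) (by linarith)
      _ = 2 := Real.rpow_one 2
  -- The scale j is the largest with 2^(jα/2) ≤ 10|ξ₁|. Consecutive scales differ by a factor at
  -- most 2, so the scaled first coordinate y satisfies 1/10 ≤ |y| ≤ 1/5.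
  obtain ⟨j, hj1, hj2⟩ := exists_nat_pow_near (show 1 ≤ 10 * |ξ 0| by linarith) hr1
  set r : ℝ := 2 ^ (α / 2) with hr
  have hrj : 0 < r ^ j := by positivity
  have hρ : ((2 : ℝ) ^ (-(α / 2))) ^ j = (r ^ j)⁻¹ := by
    rw [Real.rpow_neg (by norm_num), inv_pow]
  set y : ℝ := (r ^ j)⁻¹ * ξ 0 with hy
  have hyabs : |y| = |ξ 0| / r ^ j := by
    rw [hy, abs_mul, abs_of_pos (inv_pos.2 hrj)]; ring
  have hy1 : 1 / 10 ≤ |y| := by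
    rw [hyabs, le_div_iff₀ hrj]; linarith
  have hy2 : |y| ≤ 1 / 5 := by
    rw [hyabs, div_le_iff₀ hrj]
    rw [pow_succ] at hj2
    nlinarith
  have hy0 : y ≠ 0 := by intro h; rw [h, abs_zero] at hy1; linarith
  have hξ0 : 0 < |ξ 0| := by linarith
  set b : ℝ := ((2 : ℝ) ^ ((j : ℝ) / 2))⁻¹ with hb
  have hb0 : 0 < b := by positivity
  -- Slopes at most 1 are stretched by the anisotropy 2^(j(α-1)/2), which is the admissible size of
  -- the shears.
  have hratio : b * r ^ j = 2 ^ (j * (α - 1) / 2) := by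
    rw [hb, hr, ← Real.rpow_neg (by norm_num), ← Real.rpow_mul_natCast (by norm_num),
      ← Real.rpow_add (by norm_num)]
    congr 1
    ring
  have key : ∀ x : ℝ, |x| ≤ |ξ 0| → |b * x / y| ≤ 2 ^ (j * (α - 1) / 2) := by
    intro x hx
    rw [abs_div, abs_mul, hyabs, abs_of_pos hb0, ← hratio, div_div_eq_mul_div,
      div_le_iff₀ hξ0]
    have : 0 < b * r ^ j := by positivity
    nlinarith
  -- Shearing by the nearest integer leaves an error of at most |y|/2 ≤ 1/10.
  have key2 : ∀ x : ℝ, |b * x - round (b * x / y) * y| ≤ 1 / 10 := by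
    intro x
    have h3 := abs_sub_round (b * x / y)
    have h4 : b * x - round (b * x / y) * y = (b * x / y - round (b * x / y)) * y := by
      field_simp
    rw [h4, abs_mul]
    nlinarith [abs_nonneg y, abs_nonneg (b * x / y - round (b * x / y))]
  refine ⟨⟨(j, round (b * ξ 1 / y), round (b * ξ 2 / y)), abs_round_le_ceil (key _ h1),
    abs_round_le_ceil (key _ h2)⟩, ?_⟩
  obtain ⟨e0, e1, e2⟩ := matMap_dualMat α (j, round (b * ξ 1 / y), round (b * ξ 2 / y)) ξ
  simp only [hρ] at e0 e1 e2
  simp only [e0, e1, e2]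
  exact ⟨hy1, hy2, key2 _, key2 _⟩

theorem mem_centralCell {c₁ c₂ : ℝ} (hc₂ : 0 < c₂) (h21 : c₂ ≤ c₁) (hc₁ : c₁ ≤ 1)
    {N : Matrix (Fin 3) (Fin 3) ℝ} {ξ : R3} (h : ∀ i, |matMap N ξ i| ≤ 1 / 5) :
    ξ ∈ centralCell c₁ c₂ N := by
  have key : ∀ (c : ℝ) (i : Fin 3), 0 < c → c ≤ 1 →
      c * matMap N ξ i ∈ Set.Ioc ((0 : ℝ) - 1 / 2) ((0 : ℝ) - 1 / 2 + 1) := by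
    intro c i hc hc1
    have h1 : |c * matMap N ξ i| ≤ 1 / 5 := by
      rw [abs_mul, abs_of_pos hc]
      calc c * |matMap N ξ i| ≤ 1 * (1 / 5) := by gcongr; exact h i
        _ = _ := one_mul _
    rw [abs_le] at h1
    constructor <;> linarith
  have hc₁0 : 0 < c₁ := hc₂.trans_le h21
  have hc₂1 : c₂ ≤ 1 := h21.trans hc₁
  simp only [centralCell, Set.mem_ofPred_eq, sample₁_mul_mulVec]
  intro i
  fin_cases i
  · simpa using key c₁ 0 hc₁0 hc₁
  · simpa using key c₂ 1 hc₂ hc₂1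
  · simpa using key c₂ 2 hc₂ hc₂1

theorem measurable_enorm_sq {X : Type*} [MeasurableSpace X] {F : X → ℂ} (hF : Measurable F) :
    Measurable fun x => ‖F x‖ₑ ^ 2 := hF.enorm.pow_const 2

theorem measurableSet_centralCell (c₁ c₂ : ℝ) (N : Matrix (Fin 3) (Fin 3) ℝ) :
    MeasurableSet (centralCell c₁ c₂ N) :=
  (show Measurable fun ξ : R3 => (sample₁ c₁ c₂ * N).mulVec ξ.ofLp from
    (MeasurableEquiv.toLp 2 (Fin 3 → ℝ)).symm.measurable.comp
      (measurable_matMap (sample₁ c₁ c₂ * N))) (measurableSet_latticeCube 0)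

theorem majorant_le_one (η₀ η₁ η₂ : ℝ) : majorant η₀ η₁ η₂ ≤ 1 := by
  have h0 := decay_pos η₀
  have h1 : (η₀ ^ 2 * decay η₀) ^ 3 ≤ 1 := pow_le_one₀ (by positivity) (sq_mul_decay_le_one η₀)
  have h2 : majorant η₀ η₁ η₂ =
      (η₀ ^ 2 * decay η₀) ^ 3 * decay η₀ * decay η₁ * decay η₂ := by
    unfold majorant; ring
  rw [h2]
  exact mul_le_one₀ (mul_le_one₀ (mul_le_one₀ h1 h0.le (decay_le_one _)) (decay_pos _).le
    (decay_le_one _)) (decay_pos _).le (decay_le_one _)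

theorem matMap_mul (N P : Matrix (Fin 3) (Fin 3) ℝ) (ξ : R3) :
    matMap (N * P) ξ = matMap N (matMap P ξ) := by
  simp [matMap, Matrix.mulVec_mulVec]

theorem continuous_majorant :
    Continuous fun η : R3 => majorant (η 0) (η 1) (η 2) := by
  have := continuous_decay
  unfold majorant
  fun_prop

/-! ### Summing the layers of one shearlet system -/

section ShearBounds

variable {Φ : ℝ → ℂ} {Ψ : R3 → ℂ} {C A : ℝ} (hG : GeneratorBounds Φ Ψ C A) {α : ℝ} (hα : 1 < α)
  (hα' : α ≤ 2) {P : Matrix (Fin 3) (Fin 3) ℝ} (hP : |P.det| = 1) {c₁ c₂ : ℝ} (hc₂ : 0 < c₂)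
  (h21 : c₂ ≤ c₁) (hc₁ : c₁ ≤ 1) {F : R3 → ℂ} (hFm : Measurable F) (hF : MemLp F 2)

/-- The bound for the remainder terms. -/
def remainderConst (C : ℝ) : ℝ≥0∞ :=
  -- The added ones let the same constant dominate the upper bounds and the remainders, for the
  -- shearlet layers as for the single scaling layer.
  (1 + ∑' n, ENNReal.ofReal (cubeWeight n)) *
    (ENNReal.ofReal C * (1 + 2 * (∑' n, ENNReal.ofReal (intWeight n)) ^ 2))

theorem remainderConst_ne_top (C : ℝ) : remainderConst C ≠ ∞ := by
  have h1 := tsum_cubeWeight_ne_top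
  have h2 := tsum_intWeight_ne_top
  unfold remainderConst
  finiteness

/-- The square sum of the coefficients of the shearlet system. -/
def shearSum (α c₁ c₂ : ℝ) (P : Matrix (Fin 3) (Fin 3) ℝ) (Ψ F : R3 → ℂ) : ℝ≥0∞ :=
  ∑' p : ShearParam α, ∑' m, ‖layerCoeff c₁ c₂ (dualNorm α p) (dualMat α p * P) Ψ F m‖ₑ ^ 2

include hα in
theorem tsum_lintegral_majorant_le (C : ℝ) (hFm : Measurable F) :
    ∑' p : ShearParam α, ∫⁻ ξ, ENNReal.ofReal (C * majorant (matMap (dualMat α p * P) ξ 0)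
        (matMap (dualMat α p * P) ξ 1) (matMap (dualMat α p * P) ξ 2)) * ‖F ξ‖ₑ ^ 2 ≤
      ENNReal.ofReal C * (2 * (∑' n, ENNReal.ofReal (intWeight n)) ^ 2) * ∫⁻ ξ, ‖F ξ‖ₑ ^ 2 := by
  have hρ : ((2 : ℝ) ^ (-(α / 2))) ^ 2 ≤ 1 / 2 := by
    rw [← Real.rpow_mul_natCast (by norm_num)]
    calc (2 : ℝ) ^ (-(α / 2) * (2 : ℕ)) ≤ 2 ^ (-1 : ℝ) :=
          Real.rpow_le_rpow_of_exponent_le (by norm_num) (by push_cast; linarith)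
      _ = 1 / 2 := by rw [Real.rpow_neg_one]; norm_num
  rw [← lintegral_tsum]
  swap
  · intro p
    have h1 : Measurable fun ξ => ENNReal.ofReal (C * majorant (matMap (dualMat α p * P) ξ 0)
        (matMap (dualMat α p * P) ξ 1) (matMap (dualMat α p * P) ξ 2)) :=
      ((continuous_majorant.measurable.comp (measurable_matMap (dualMat α p * P))).const_mul
        C).ennreal_ofReal
    exact (h1.mul (measurable_enorm_sq hFm)).aemeasurable
  rw [← lintegral_const_mul _ (measurable_enorm_sq hFm)]
  refine lintegral_mono fun ξ => ?_
  rw [ENNReal.tsum_mul_right]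
  gcongr
  simp_rw [ENNReal.ofReal_mul' (majorant_nonneg _ _ _), ENNReal.tsum_mul_left, matMap_mul]
  gcongr
  have h2 := tsum_majorant_le hρ (fun j => ((2 : ℝ) ^ ((j : ℝ) / 2))⁻¹) (matMap P ξ 0)
    (matMap P ξ 1) (matMap P ξ 2)
  refine le_trans ?_ h2
  -- For an upper bound the restriction on the shears can be dropped and the sum taken over all of
  -- ℤ².
  refine le_trans (le_of_eq ?_) (ENNReal.tsum_comp_le_tsum_of_injective
    (Subtype.val_injective (p := fun p : ℕ × ℤ × ℤ => |p.2.1| ≤ ⌈(2 : ℝ) ^ (p.1 * (α - 1) / 2)⌉ ∧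
      |p.2.2| ≤ ⌈(2 : ℝ) ^ (p.1 * (α - 1) / 2)⌉)) _)
  refine tsum_congr fun p => ?_
  obtain ⟨e0, e1, e2⟩ := matMap_dualMat α p (matMap P ξ)
  rw [e0, e1, e2]

include hP in
theorem layer_hyps (p : ℕ × ℤ × ℤ) : (dualMat α p * P).det ≠ 0 ∧
    dualNorm α p ^ 2 = |(dualMat α p * P).det| := by
  have h := dualNorm_pos α p
  have h1 : |(dualMat α p * P).det| = dualNorm α p ^ 2 := by
    rw [Matrix.det_mul, abs_mul, hP, mul_one, det_dualMat, abs_of_pos (by positivity)]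
  refine ⟨?_, h1.symm⟩
  rw [← abs_pos, h1]
  positivity

include hG hα hP hc₂ h21 hc₁ hFm hF in
theorem shearSum_le :
    ENNReal.ofReal (c₁ * c₂ ^ 2) * shearSum α c₁ c₂ P Ψ F ≤
      2 * remainderConst C * ∫⁻ ξ, ‖F ξ‖ₑ ^ 2 := by
  have hb := fun p : ShearParam α => (layer_bounds (layer_hyps (α := α) hP p.1).1
    (layer_hyps (α := α) hP p.1).2 hc₂ h21 hc₁
    hG.measurable_Ψ hG.memLp_Ψ hFm hF
    (fun η => mul_nonneg hG.pos_C.le (majorant_nonneg (η 0) (η 1) (η 2)))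
    (fun η => mul_le_of_le_one_right hG.pos_C.le (majorant_le_one _ _ _)) hG.norm_Ψ_sq_le).1
  rw [shearSum, ← ENNReal.tsum_mul_left]
  refine (ENNReal.tsum_le_tsum hb).trans ?_
  rw [ENNReal.tsum_mul_left]
  calc _ ≤ 2 * (1 + ∑' n, ENNReal.ofReal (cubeWeight n)) * (ENNReal.ofReal C *
        (2 * (∑' n, ENNReal.ofReal (intWeight n)) ^ 2) * ∫⁻ ξ, ‖F ξ‖ₑ ^ 2) := by
        gcongr
        exact tsum_lintegral_majorant_le hα C hFm
    _ ≤ 2 * (1 + ∑' n, ENNReal.ofReal (cubeWeight n)) * (ENNReal.ofReal C *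
        (1 + 2 * (∑' n, ENNReal.ofReal (intWeight n)) ^ 2) * ∫⁻ ξ, ‖F ξ‖ₑ ^ 2) := by
        gcongr
        exact le_add_self
    _ = _ := by unfold remainderConst; ring

include hG hα hα' hP hc₂ h21 hc₁ hFm hF in
-- Each frequency in the permuted cone lies in the central cell of some layer at a point where |Ψ|²
-- ≥ A, so the central energies of all layers together dominate the energy of F there.
theorem lintegral_cone_le_shearSum :
    ENNReal.ofReal A * ∫⁻ ξ in matMap P ⁻¹' cone, ‖F ξ‖ₑ ^ 2 ≤
      2 * (ENNReal.ofReal (c₁ * c₂ ^ 2) * shearSum α c₁ c₂ P Ψ F +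
        ENNReal.ofReal (c₁ ^ 2) * remainderConst C * ∫⁻ ξ, ‖F ξ‖ₑ ^ 2) := by
  have hb := fun p : ShearParam α => (layer_bounds (layer_hyps (α := α) hP p.1).1
    (layer_hyps (α := α) hP p.1).2 hc₂ h21 hc₁
    hG.measurable_Ψ hG.memLp_Ψ hFm hF
    (fun η => mul_nonneg hG.pos_C.le (majorant_nonneg (η 0) (η 1) (η 2)))
    (fun η => mul_le_of_le_one_right hG.pos_C.le (majorant_le_one _ _ _)) hG.norm_Ψ_sq_le).2
  have hcell := fun p : ShearParam α => measurableSet_centralCell c₁ c₂ (dualMat α p * P)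
  have hmeas : ∀ p : ShearParam α, Measurable fun ξ =>
      ‖Ψ (matMap (dualMat α p * P) ξ)‖ₑ ^ 2 * ‖F ξ‖ₑ ^ 2 := fun p =>
    (measurable_enorm_sq (hG.measurable_Ψ.comp (measurable_matMap _))).mul (measurable_enorm_sq hFm)
  have hlow : ENNReal.ofReal A * ∫⁻ ξ in matMap P ⁻¹' cone, ‖F ξ‖ₑ ^ 2 ≤
      ∑' p : ShearParam α, ∫⁻ ξ in centralCell c₁ c₂ (dualMat α p * P),
        ‖Ψ (matMap (dualMat α p * P) ξ)‖ₑ ^ 2 * ‖F ξ‖ₑ ^ 2 := by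
    simp_rw [← lintegral_indicator (hcell _)]
    rw [← lintegral_tsum (fun p => ((hmeas p).indicator (hcell p)).aemeasurable),
      ← lintegral_const_mul' _ _ ENNReal.ofReal_ne_top]
    refine le_trans ?_ (setLIntegral_le_lintegral (matMap P ⁻¹' cone) _)
    refine setLIntegral_mono' ?_ fun ξ hξ => ?_
    · refine measurable_matMap P ?_
      have h0 : Measurable fun ξ : R3 => |ξ 0| := by fun_prop
      have h1 : Measurable fun ξ : R3 => |ξ 1| := by fun_prop
      have h2 : Measurable fun ξ : R3 => |ξ 2| := by fun_prop
      exact (measurableSet_le measurable_const h0).inter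
        ((measurableSet_le h1 h0).inter (measurableSet_le h2 h0))
    · obtain ⟨p, e0, e0', e1, e2⟩ := exists_shearParam hα hα' hξ
      refine le_trans ?_ (ENNReal.le_tsum p)
      rw [← matMap_mul] at e0 e0' e1 e2
      rw [Set.indicator_of_mem]
      · gcongr
        rw [enorm_sq_eq]
        exact ENNReal.ofReal_le_ofReal (hG.le_norm_Ψ_sq _ e0 e0' e1 e2)
      · refine mem_centralCell hc₂ h21 hc₁ fun i => ?_
        fin_cases i
        · exact e0'
        · exact e1.trans (by norm_num)
        · exact e2.trans (by norm_num)
  refine hlow.trans ((ENNReal.tsum_le_tsum hb).trans ?_)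
  rw [ENNReal.tsum_mul_left, ENNReal.tsum_add, ENNReal.tsum_mul_left, ENNReal.tsum_mul_left]
  rw [shearSum]
  gcongr 2 * (_ + ?_)
  calc _ ≤ ENNReal.ofReal (c₁ ^ 2) * (∑' n, ENNReal.ofReal (cubeWeight n)) * (ENNReal.ofReal C *
        (2 * (∑' n, ENNReal.ofReal (intWeight n)) ^ 2) * ∫⁻ ξ, ‖F ξ‖ₑ ^ 2) := by
        gcongr
        exact tsum_lintegral_majorant_le hα C hFm
    _ ≤ ENNReal.ofReal (c₁ ^ 2) * (1 + ∑' n, ENNReal.ofReal (cubeWeight n)) * (ENNReal.ofReal C *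
        (1 + 2 * (∑' n, ENNReal.ofReal (intWeight n)) ^ 2) * ∫⁻ ξ, ‖F ξ‖ₑ ^ 2) := by
        gcongr <;> exact le_add_self
    _ = _ := by unfold remainderConst; ring

end ShearBounds

/-! ### The scaling translates -/

section ScalingBounds

variable {Φ : ℝ → ℂ} {Ψ : R3 → ℂ} {C A : ℝ} (hG : GeneratorBounds Φ Ψ C A)
  {c₁ : ℝ} (hc₁0 : 0 < c₁) (hc₁ : c₁ ≤ 1) {F : R3 → ℂ} (hFm : Measurable F) (hF : MemLp F 2)

/-- The square sum of the coefficients of the scaling translates. -/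
def scalingSum (c₁ : ℝ) (Φ : ℝ → ℂ) (F : R3 → ℂ) : ℝ≥0∞ :=
  ∑' m, ‖layerCoeff c₁ c₁ 1 1 (tensor Φ Φ Φ) F m‖ₑ ^ 2

/-- The low frequency box. -/
def lowBox : Set R3 := {ξ | |ξ 0| ≤ 1 / 10 ∧ |ξ 1| ≤ 1 / 10 ∧ |ξ 2| ≤ 1 / 10}

include hG in
theorem GeneratorBounds.memLp_tensor : MemLp (tensor Φ Φ Φ) 2 :=
  have h := memLp_of_norm_le_decay hG.measurable_Φ hG.norm_Φ_le
  Shearlet.memLp_tensor hG.measurable_Φ hG.measurable_Φ hG.measurable_Φ h h h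

theorem matMap_one (ξ : R3) : matMap 1 ξ = ξ := by simp [matMap]

include hG hc₁0 hc₁ hFm hF in
-- The translates of the scaling function form one layer, with N = 1 and κ = 1. There is no sum over
-- layers, so Q can be the constant C⁶.
theorem scalingSum_bounds :
    ENNReal.ofReal (c₁ * c₁ ^ 2) * scalingSum c₁ Φ F ≤
      2 * remainderConst (C ^ 6) * ∫⁻ ξ, ‖F ξ‖ₑ ^ 2 ∧
    ENNReal.ofReal (A ^ 3) * ∫⁻ ξ in lowBox, ‖F ξ‖ₑ ^ 2 ≤
      2 * (ENNReal.ofReal (c₁ * c₁ ^ 2) * scalingSum c₁ Φ F +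
        ENNReal.ofReal (c₁ ^ 2) * remainderConst (C ^ 6) * ∫⁻ ξ, ‖F ξ‖ₑ ^ 2) := by
  have hC := hG.pos_C
  have hle : ∀ η : R3, ‖tensor Φ Φ Φ η‖ ^ 2 ≤
      C ^ 6 * (decay (η 0) * decay (η 1) * decay (η 2)) := by
    intro η
    have d0 := decay_pos (η 0)
    have d1 := decay_pos (η 1)
    have d2 := decay_pos (η 2)
    have hp : decay (η 0) * decay (η 1) * decay (η 2) ≤ 1 :=
      mul_le_one₀ (mul_le_one₀ (decay_le_one _) d1.le (decay_le_one _)) d2.le (decay_le_one _)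
    calc ‖tensor Φ Φ Φ η‖ ^ 2 = (‖Φ (η 0)‖ * ‖Φ (η 1)‖ * ‖Φ (η 2)‖) ^ 2 := by
          simp only [tensor, norm_mul]
      _ ≤ ((C * decay (η 0)) * (C * decay (η 1)) * (C * decay (η 2))) ^ 2 := by
          gcongr <;> exact hG.norm_Φ_le _
      _ = C ^ 6 * ((decay (η 0) * decay (η 1) * decay (η 2)) *
          (decay (η 0) * decay (η 1) * decay (η 2))) := by ring
      _ ≤ C ^ 6 * ((decay (η 0) * decay (η 1) * decay (η 2)) * 1) := by gcongr
      _ = _ := by rw [mul_one]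
  obtain ⟨hu, hl⟩ := layer_bounds (N := 1) (by simp) (κ := 1) (by simp) hc₁0 le_rfl hc₁
    (measurable_tensor hG.measurable_Φ hG.measurable_Φ hG.measurable_Φ) hG.memLp_tensor hFm hF
    (fun _ => (by positivity : (0 : ℝ) ≤ C ^ 6)) (fun _ => le_rfl) hle
  simp only [matMap_one] at hu hl
  rw [lintegral_const_mul' _ _ ENNReal.ofReal_ne_top] at hu hl
  have hone : ∀ x : ℝ≥0∞, ENNReal.ofReal (C ^ 6) * x ≤ ENNReal.ofReal (C ^ 6) *
      (1 + 2 * (∑' n, ENNReal.ofReal (intWeight n)) ^ 2) * x := fun x => by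
    rw [mul_assoc]
    gcongr
    exact le_mul_of_one_le_left zero_le le_self_add
  constructor
  · refine hu.trans ?_
    calc _ ≤ 2 * (1 + ∑' n, ENNReal.ofReal (cubeWeight n)) * (ENNReal.ofReal (C ^ 6) *
        (1 + 2 * (∑' n, ENNReal.ofReal (intWeight n)) ^ 2) * ∫⁻ ξ, ‖F ξ‖ₑ ^ 2) := by
          gcongr 2 * (1 + _) * ?_
          exact hone _
      _ = _ := by unfold remainderConst; ring
  · have hlow : ENNReal.ofReal (A ^ 3) * ∫⁻ ξ in lowBox, ‖F ξ‖ₑ ^ 2 ≤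
        ∫⁻ ξ in centralCell c₁ c₁ 1, ‖tensor Φ Φ Φ ξ‖ₑ ^ 2 * ‖F ξ‖ₑ ^ 2 := by
      rw [← lintegral_const_mul' _ _ ENNReal.ofReal_ne_top]
      have hsub : lowBox ⊆ centralCell c₁ c₁ 1 := by
        intro ξ hξ
        refine mem_centralCell hc₁0 le_rfl hc₁ fun i => ?_
        rw [matMap_one]
        obtain ⟨h0, h1, h2⟩ := hξ
        fin_cases i
        · exact h0.trans (by norm_num)
        · exact h1.trans (by norm_num)
        · exact h2.trans (by norm_num)
      refine le_trans ?_ (lintegral_mono_set hsub)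
      refine setLIntegral_mono' ?_ fun ξ hξ => ?_
      · have h : ∀ i, MeasurableSet {ξ : R3 | |ξ i| ≤ 1 / 10} := fun i =>
          measurableSet_le (by fun_prop) measurable_const
        exact (h 0).inter ((h 1).inter (h 2))
      · gcongr
        rw [enorm_sq_eq]
        apply ENNReal.ofReal_le_ofReal
        obtain ⟨h0, h1, h2⟩ := hξ
        have hA := hG.pos_A
        simp only [tensor, norm_mul, mul_pow]
        calc A ^ 3 = A * A * A := by ring
          _ ≤ _ := by
            gcongr
            · exact hG.le_norm_Φ_sq _ h0
            · exact hG.le_norm_Φ_sq _ h1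
            · exact hG.le_norm_Φ_sq _ h2
    refine hlow.trans (hl.trans ?_)
    rw [scalingSum]
    gcongr 2 * (_ + ?_)
    calc _ ≤ ENNReal.ofReal (c₁ ^ 2) * (1 + ∑' n, ENNReal.ofReal (cubeWeight n)) *
        (ENNReal.ofReal (C ^ 6) *
        (1 + 2 * (∑' n, ENNReal.ofReal (intWeight n)) ^ 2) * ∫⁻ ξ, ‖F ξ‖ₑ ^ 2) := by
          gcongr ENNReal.ofReal (c₁ ^ 2) * ?_ * ?_
          · exact le_add_self
          · exact hone _
      _ = _ := by unfold remainderConst; ring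

end ScalingBounds

/-! ### Coefficients of the systems -/

theorem HasL2Fourier.const_mul {f F : R3 → ℂ} (h : HasL2Fourier f F) (c : ℂ) :
    HasL2Fourier (fun x => c * f x) (fun x => c * F x) := by
  obtain ⟨hf, hF⟩ := h
  refine ⟨hf.const_mul c, ?_⟩
  have h1 : (hf.const_mul c).toLp (fun x => c * f x) = c • hf.toLp f := rfl
  rw [h1, FourierTransform.fourier_smul]
  filter_upwards [Lp.coeFn_smul c (𝓕 (hf.toLp f) : L2R3), hF] with x hx hx'
  rw [hx, Pi.smul_apply, hx', smul_eq_mul]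

/-- The Fourier side description of a single normalized, transformed and translated generator. -/
theorem inner_toLp_eq_layerCoeff {f Ψ : R3 → ℂ} (h : HasL2Fourier f Ψ) (h1 : Integrable Ψ)
    (h2 : MemLp Ψ 2) {N B : Matrix (Fin 3) (Fin 3) ℝ} (hBN : B.transpose * N = 1) {κ : ℝ}
    (hκ0 : 0 < κ) (hκ : κ ^ 2 = |N.det|) (c₁ c₂ : ℝ) (m : Fin 3 → ℤ) {g : R3 → ℂ}
    (hg : ∀ x, g x = ((κ⁻¹ : ℝ) : ℂ) * f (WithLp.toLp 2 (B.mulVec x.ofLp -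
      (sample₁ c₁ c₂).mulVec (fun i => (m i : ℝ))))) :
    ∃ hm : MemLp g 2, ∀ u : L2R3,
      inner ℂ (hm.toLp g) u = layerCoeff c₁ c₂ κ N Ψ (𝓕 u : L2R3) m := by
  have hdet : B.det * N.det = 1 := by
    have := congrArg Matrix.det hBN
    rwa [Matrix.det_mul, Matrix.det_transpose, Matrix.det_one] at this
  have hB0 : B.det ≠ 0 := left_ne_zero_of_mul_eq_one hdet
  have hN0 : N.det ≠ 0 := right_ne_zero_of_mul_eq_one hdet
  have hNpos : 0 < |N.det| := abs_pos.2 hN0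
  set t : R3 := WithLp.toLp 2 ((sample₁ c₁ c₂).mulVec (fun i => (m i : ℝ))) with ht
  have hF := ((h.comp_affine h1 h2 (quasiMeasurePreserving_matMap hB0) (matMapEquiv N hN0)
    (inv_pos.2 hNpos) (map_matMapEquiv N hN0) (fun ξ x => inner_matMap hBN ξ x) t).const_mul
    ((κ⁻¹ : ℝ) : ℂ))
  have hgeq : g = fun x => ((κ⁻¹ : ℝ) : ℂ) * f (matMap B x - t) := funext hg
  rw [← hgeq] at hF
  refine ⟨hF.1, fun u => ?_⟩
  rw [hF.inner_toLp, layerCoeff]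
  congr 1
  ext ξ
  have hphase : ⟪matMap N ξ, t⟫ = ∑ i, (m i : ℝ) * (sample₁ c₁ c₂ * N).mulVec ξ.ofLp i := by
    rw [sample₁_mul_mulVec, PiLp.inner_apply]
    simp [ht, sample₁, Matrix.mulVec_diagonal, Fin.sum_univ_three]
    ring
  have hchar : conj (Real.fourierChar (-⟪matMap N ξ, t⟫) : ℂ) =
      latticeChar m ((sample₁ c₁ c₂ * N).mulVec ξ.ofLp) := by
    rw [latticeChar, ← hphase, AddChar.map_neg_eq_inv, Circle.coe_inv_eq_conj, Complex.conj_conj]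
  -- The normalization contributes κ⁻¹ and the change of variables |det N|; together they give the κ
  -- of `layerCoeff`.
  have hκs : κ⁻¹ * |N.det| = κ := by rw [← hκ]; field_simp
  simp only [coe_matMapEquiv, map_mul, Complex.conj_ofReal, hchar, inv_inv]
  have hκc : ((κ⁻¹ : ℝ) : ℂ) * ((|N.det| : ℝ) : ℂ) = κ := by rw [← Complex.ofReal_mul, hκs]
  rw [← hκc]
  ring

theorem shear₁_mul_scale₁ (α : ℝ) (j : ℕ) (k : ℤ × ℤ) : shear₁ k * scale₁ α j =
    !![(2 : ℝ) ^ (j * α / 2), k.1 * (2 : ℝ) ^ ((j : ℝ) / 2), k.2 * (2 : ℝ) ^ ((j : ℝ) / 2);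
      0, (2 : ℝ) ^ ((j : ℝ) / 2), 0; 0, 0, (2 : ℝ) ^ ((j : ℝ) / 2)] := by
  ext i l
  rw [scale₁, Matrix.mul_diagonal]
  fin_cases i <;> fin_cases l <;> simp [shear₁]

theorem dualMat_spec (α : ℝ) (p : ℕ × ℤ × ℤ) :
    (shear₁ p.2 * scale₁ α p.1).transpose * dualMat α p = 1 := by
  have h1 : (2 : ℝ) ^ (p.1 * α / 2) ≠ 0 := by positivity
  have h2 : (2 : ℝ) ^ ((p.1 : ℝ) / 2) ≠ 0 := by positivity
  rw [shear₁_mul_scale₁, dualMat]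
  generalize (2 : ℝ) ^ (p.1 * α / 2) = a at *
  generalize (2 : ℝ) ^ ((p.1 : ℝ) / 2) = b at *
  ext i j
  fin_cases i <;> fin_cases j <;>
    simp [Matrix.mul_apply, Fin.sum_univ_three, h1, h2] <;> ring

/-- The Fourier coefficients of a system obtained from the first shearlet system by an orthogonal
change of coordinates and a permutation of the indices. -/
theorem exists_memLp_tsum_eq_shearSum {ψ Ψ : R3 → ℂ} (h : HasL2Fourier ψ Ψ) (h1 : Integrable Ψ)
    (h2 : MemLp Ψ 2) {P : Matrix (Fin 3) (Fin 3) ℝ} (hP : P.transpose * P = 1) {α c₁ c₂ : ℝ}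
    (e : ShearParam α × (Fin 3 → ℤ) ≃ ShearIndex α) {g : ShearIndex α → R3 → ℂ}
    (hg : ∀ p m x, g (e (p, m)) x = ((2 ^ (p.1.1 * (α + 2) / 4) : ℝ) : ℂ) *
      ψ (WithLp.toLp 2 ((shear₁ p.1.2 * scale₁ α p.1.1 * P).mulVec x.ofLp -
        (sample₁ c₁ c₂).mulVec (fun i => (m i : ℝ))))) :
    ∃ hm : ∀ q, MemLp (g q) 2, ∀ u : L2R3,
      ∑' q, ‖inner ℂ ((hm q).toLp (g q)) u‖ₑ ^ 2 = shearSum α c₁ c₂ P Ψ (𝓕 u : L2R3) := by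
  have hdet : |P.det| = 1 := by
    have := congrArg Matrix.det hP
    rw [Matrix.det_mul, Matrix.det_transpose, Matrix.det_one] at this
    rw [← pow_eq_one_iff_of_nonneg (abs_nonneg _) two_ne_zero, sq_abs, sq, this]
  have key : ∀ (p : ShearParam α) (m : Fin 3 → ℤ), ∃ hm : MemLp (g (e (p, m))) 2, ∀ u : L2R3,
      inner ℂ (hm.toLp _) u =
        layerCoeff c₁ c₂ (dualNorm α p) (dualMat α p * P) Ψ (𝓕 u : L2R3) m := by
    intro p m
    refine inner_toLp_eq_layerCoeff h h1 h2 (B := shear₁ p.1.2 * scale₁ α p.1.1 * P) ?_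
      (dualNorm_pos α p) (layer_hyps hdet p.1).2 c₁ c₂ m fun x => ?_
    · rw [Matrix.transpose_mul, Matrix.mul_assoc, ← Matrix.mul_assoc _ (dualMat α p) P,
        dualMat_spec, Matrix.one_mul, hP]
    · rw [hg, dualNorm, inv_inv]
  have hm : ∀ q, MemLp (g q) 2 := fun q => by
    obtain ⟨⟨p, m⟩, rfl⟩ := e.surjective q
    exact (key p m).1
  refine ⟨hm, fun u => ?_⟩
  rw [shearSum, ← e.tsum_eq, tsum_prod_eq]
  refine tsum_congr fun p => tsum_congr fun m => ?_
  obtain ⟨_, hk⟩ := key p m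
  rw [← hk u]

theorem exists_memLp_tsum_eq_scalingSum {φ Φ : ℝ → ℂ} (h : HasL2Fourier φ Φ) (h1 : Integrable Φ)
    (h2 : MemLp Φ 2) (h3 : MemLp (tensor Φ Φ Φ) 2) (c₁ : ℝ) :
    ∃ hm : ∀ m, MemLp (scalingSystem c₁ (tensor3 φ) m) 2, ∀ u : L2R3,
      ∑' m, ‖inner ℂ ((hm m).toLp (scalingSystem c₁ (tensor3 φ) m)) u‖ₑ ^ 2 =
        scalingSum c₁ Φ (𝓕 u : L2R3) := by
  have key : ∀ m : Fin 3 → ℤ, ∃ hm : MemLp (scalingSystem c₁ (tensor3 φ) m) 2, ∀ u : L2R3,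
      inner ℂ (hm.toLp _) u = layerCoeff c₁ c₁ 1 1 (tensor Φ Φ Φ) (𝓕 u : L2R3) m := by
    intro m
    refine inner_toLp_eq_layerCoeff (h.tensor3 h1 h2 h3) (integrable_tensor h1 h1 h1) h3
      (B := 1) (by simp) one_pos (by simp) c₁ c₁ m fun x => ?_
    have hv : (fun i => x i - c₁ * (m i : ℝ)) =
        x.ofLp - (sample₁ c₁ c₁).mulVec (fun i => (m i : ℝ)) := by
      ext i
      fin_cases i <;> simp [sample₁, Matrix.mulVec_diagonal]
    simp [scalingSystem, hv]
  refine ⟨fun m => (key m).1, fun u => ?_⟩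
  rw [scalingSum]
  refine tsum_congr fun m => ?_
  rw [← (key m).2 u]

/-! ### Coordinate changes between the three systems -/

/-- The permutation matrix exchanging the first two coordinates. -/
def perm12 : Matrix (Fin 3) (Fin 3) ℝ := !![0, 1, 0; 1, 0, 0; 0, 0, 1]

/-- The permutation matrix exchanging the first and the last coordinate. -/
def perm13 : Matrix (Fin 3) (Fin 3) ℝ := !![0, 0, 1; 0, 1, 0; 1, 0, 0]

theorem perm12_transpose_mul : perm12.transpose * perm12 = 1 := by
  ext i j
  fin_cases i <;> fin_cases j <;> simp [perm12, Matrix.mul_apply, Fin.sum_univ_three]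

theorem perm13_transpose_mul : perm13.transpose * perm13 = 1 := by
  ext i j
  fin_cases i <;> fin_cases j <;> simp [perm13, Matrix.mul_apply, Fin.sum_univ_three]

theorem abs_det_perm12 : |perm12.det| = 1 := by simp [perm12, Matrix.det_fin_three]

theorem abs_det_perm13 : |perm13.det| = 1 := by simp [perm13, Matrix.det_fin_three]

/-- The indices of the first system as pairs of a scale and shear parameter and a translation. -/
def indexEquiv₁ (α : ℝ) : ShearParam α × (Fin 3 → ℤ) ≃ ShearIndex α where
  toFun q := Subtype.mk (q.1.1.1, q.1.1.2, q.2) q.1.2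
  invFun q := (⟨(q.1.1, q.1.2.1), q.2⟩, q.1.2.2)
  left_inv _ := rfl
  right_inv _ := rfl

/-- The indices of the second system, with the first two translation parameters exchanged. -/
def indexEquiv₂ (α : ℝ) : ShearParam α × (Fin 3 → ℤ) ≃ ShearIndex α where
  toFun q := Subtype.mk (q.1.1.1, q.1.1.2, ![q.2 1, q.2 0, q.2 2]) q.1.2
  invFun q := (⟨(q.1.1, q.1.2.1), q.2⟩, ![q.1.2.2 1, q.1.2.2 0, q.1.2.2 2])
  left_inv q := by
    refine Prod.ext rfl (funext fun i => ?_)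
    fin_cases i <;> rfl
  right_inv q := by
    refine Subtype.ext (Prod.ext rfl (Prod.ext rfl (funext fun i => ?_)))
    fin_cases i <;> rfl

/-- The indices of the third system, with the shear parameters and the outer translation parameters
exchanged. -/
def indexEquiv₃ (α : ℝ) : ShearParam α × (Fin 3 → ℤ) ≃ ShearIndex α where
  toFun q := Subtype.mk (q.1.1.1, (q.1.1.2.2, q.1.1.2.1), ![q.2 2, q.2 1, q.2 0]) q.1.2.symm
  invFun q := (⟨(q.1.1, (q.1.2.1.2, q.1.2.1.1)), q.2.symm⟩, ![q.1.2.2 2, q.1.2.2 1, q.1.2.2 0])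
  left_inv q := by
    refine Prod.ext rfl (funext fun i => ?_)
    fin_cases i <;> rfl
  right_inv q := by
    refine Subtype.ext (Prod.ext rfl (Prod.ext rfl (funext fun i => ?_)))
    fin_cases i <;> rfl

theorem shear₁System_indexEquiv₁ (α c₁ c₂ : ℝ) (ψ : R3 → ℂ) (p : ShearParam α) (m : Fin 3 → ℤ)
    (x : R3) : shear₁System α c₁ c₂ ψ (indexEquiv₁ α (p, m)) x =
      ((2 ^ (p.1.1 * (α + 2) / 4) : ℝ) : ℂ) *
        ψ (WithLp.toLp 2 ((shear₁ p.1.2 * scale₁ α p.1.1 * 1).mulVec x.ofLp -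
          (sample₁ c₁ c₂).mulVec (fun i => (m i : ℝ)))) := by
  rw [Matrix.mul_one]
  rfl

theorem shear₂_mul_scale₂ (α : ℝ) (j : ℕ) (k : ℤ × ℤ) : shear₂ k * scale₂ α j =
    !![(2 : ℝ) ^ ((j : ℝ) / 2), 0, 0;
      k.1 * (2 : ℝ) ^ ((j : ℝ) / 2), (2 : ℝ) ^ (j * α / 2), k.2 * (2 : ℝ) ^ ((j : ℝ) / 2);
      0, 0, (2 : ℝ) ^ ((j : ℝ) / 2)] := by
  ext i l
  rw [scale₂, Matrix.mul_diagonal]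
  fin_cases i <;> fin_cases l <;> simp [shear₂]

theorem shear₃_mul_scale₃ (α : ℝ) (j : ℕ) (k : ℤ × ℤ) : shear₃ k * scale₃ α j =
    !![(2 : ℝ) ^ ((j : ℝ) / 2), 0, 0; 0, (2 : ℝ) ^ ((j : ℝ) / 2), 0;
      k.1 * (2 : ℝ) ^ ((j : ℝ) / 2), k.2 * (2 : ℝ) ^ ((j : ℝ) / 2), (2 : ℝ) ^ (j * α / 2)] := by
  ext i l
  rw [scale₃, Matrix.mul_diagonal]
  fin_cases i <;> fin_cases l <;> simp [shear₃]

theorem shear₂System_indexEquiv₂ (α c₁ c₂ : ℝ) (ψ : R3 → ℂ) (p : ShearParam α) (m : Fin 3 → ℤ)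
    (x : R3) : shear₂System α c₁ c₂ (swap12 ψ) (indexEquiv₂ α (p, m)) x =
      ((2 ^ (p.1.1 * (α + 2) / 4) : ℝ) : ℂ) *
        ψ (WithLp.toLp 2 ((shear₁ p.1.2 * scale₁ α p.1.1 * perm12).mulVec x.ofLp -
          (sample₁ c₁ c₂).mulVec (fun i => (m i : ℝ)))) := by
  change ((2 ^ (p.1.1 * (α + 2) / 4) : ℝ) : ℂ) * swap12 ψ (WithLp.toLp 2
    ((shear₂ p.1.2 * scale₂ α p.1.1).mulVec x.ofLp -
      (sample₂ c₁ c₂).mulVec (fun i => ((![m 1, m 0, m 2] : Fin 3 → ℤ) i : ℝ)))) = _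
  rw [shear₁_mul_scale₁, shear₂_mul_scale₂, swap12]
  congr 2
  ext i
  fin_cases i <;>
    simp [sample₁, sample₂, perm12, Matrix.mulVec, dotProduct, Matrix.diagonal,
      Fin.sum_univ_three]

theorem shear₃System_indexEquiv₃ (α c₁ c₂ : ℝ) (ψ : R3 → ℂ) (p : ShearParam α) (m : Fin 3 → ℤ)
    (x : R3) : shear₃System α c₁ c₂ (swap13 ψ) (indexEquiv₃ α (p, m)) x =
      ((2 ^ (p.1.1 * (α + 2) / 4) : ℝ) : ℂ) *
        ψ (WithLp.toLp 2 ((shear₁ p.1.2 * scale₁ α p.1.1 * perm13).mulVec x.ofLp -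
          (sample₁ c₁ c₂).mulVec (fun i => (m i : ℝ)))) := by
  change ((2 ^ (p.1.1 * (α + 2) / 4) : ℝ) : ℂ) * swap13 ψ (WithLp.toLp 2
    ((shear₃ (p.1.2.2, p.1.2.1) * scale₃ α p.1.1).mulVec x.ofLp -
      (sample₃ c₁ c₂).mulVec (fun i => ((![m 2, m 1, m 0] : Fin 3 → ℤ) i : ℝ)))) = _
  rw [shear₁_mul_scale₁, shear₃_mul_scale₃, swap13]
  congr 2
  ext i
  fin_cases i <;>
    simp [sample₁, sample₃, perm13, Matrix.mulVec, dotProduct, Matrix.diagonal,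
      Fin.sum_univ_three]

/-! ### Frame bounds -/

theorem lintegral_fourier_enorm_sq (f : L2R3) :
    ∫⁻ ξ, ‖(𝓕 f : L2R3) ξ‖ₑ ^ 2 = ENNReal.ofReal (‖f‖ ^ 2) := by
  have h := eLpNorm_nnreal_pow_eq_lintegral (μ := (volume : Measure R3)) (p := 2)
    (f := ((𝓕 f : L2R3) : R3 → ℂ)) (by norm_num)
  simp only [NNReal.coe_ofNat, ENNReal.rpow_ofNat, ENNReal.coe_ofNat] at h
  rw [← h, ← Lp.enorm_def, ENNReal.ofReal_pow (norm_nonneg f), ← ofReal_norm, Lp.norm_fourier_eq]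

/-- Plancherel identifies the integral with ‖f‖². The upper bound is replaced by max A B, since the
frame bounds must be ordered. -/
theorem isL2FrameOn_of_bounds {ι : Type*} [Countable ι] {V : Set L2R3} {g : ι → R3 → ℂ}
    (hg : ∀ i, MemLp (g i) 2) {A B : ℝ} (hA : 0 < A)
    (hlow : ∀ f ∈ V, ENNReal.ofReal A * ∫⁻ ξ, ‖(𝓕 f : L2R3) ξ‖ₑ ^ 2 ≤
      ∑' i, ‖inner ℂ ((hg i).toLp (g i)) f‖ₑ ^ 2)
    (hup : ∀ f ∈ V, ∑' i, ‖inner ℂ ((hg i).toLp (g i)) f‖ₑ ^ 2 ≤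
      ENNReal.ofReal B * ∫⁻ ξ, ‖(𝓕 f : L2R3) ξ‖ₑ ^ 2) :
    IsL2FrameOn V g := by
  refine ⟨hg, inferInstance, A, max A B, hA, le_max_left _ _, fun f hf => ?_⟩
  have hl := hlow f hf
  have hu := (hup f hf).trans
    (mul_le_mul_left (ENNReal.ofReal_le_ofReal (le_max_right A B)) _)
  have hB : 0 ≤ max A B := hA.le.trans (le_max_left _ _)
  simp only [enorm_sq_eq] at hl hu
  simp only [← enorm_sq_eq ((𝓕 f : L2R3) _), lintegral_fourier_enorm_sq] at hl hu
  rw [← ENNReal.ofReal_mul hA.le] at hl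
  rw [← ENNReal.ofReal_mul hB] at hu
  have hs : Summable fun i => ‖inner ℂ ((hg i).toLp (g i)) f‖ ^ 2 := by
    have := ENNReal.summable_toReal (ne_top_of_le_ne_top ENNReal.ofReal_ne_top hu)
    refine this.congr fun i => ?_
    rw [ENNReal.toReal_ofReal (by positivity)]
  rw [← ENNReal.ofReal_tsum_of_nonneg (fun _ => by positivity) hs] at hl hu
  refine ⟨hs, ?_, ?_⟩
  · exact (ENNReal.ofReal_le_ofReal_iff (tsum_nonneg fun _ => by positivity)).1 hl
  · exact (ENNReal.ofReal_le_ofReal_iff (by positivity)).1 hu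

/-- Absorption of a small remainder term. -/
theorem lower_bound_of_remainder {A v ε : ℝ} (hA : 0 < A) (hv : 0 < v) (hε : ε ≤ A / 2)
    {I S : ℝ≥0∞} (hI : I ≠ ∞)
    (h : ENNReal.ofReal A * I ≤ 2 * (ENNReal.ofReal v * S) + ENNReal.ofReal ε * I) :
    ENNReal.ofReal (A / (4 * v)) * I ≤ S := by
  have h1 : ENNReal.ofReal (A / 2) * I + ENNReal.ofReal (A / 2) * I ≤
      2 * (ENNReal.ofReal v * S) + ENNReal.ofReal (A / 2) * I := by
    rw [← add_mul, ← ENNReal.ofReal_add (by positivity) (by positivity), add_halves]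
    refine h.trans ?_
    gcongr
  -- Finiteness of I allows the cancellation in the extended nonnegative reals.
  have h2 : ENNReal.ofReal (A / 2) * I ≤ 2 * (ENNReal.ofReal v * S) :=
    (ENNReal.add_le_add_iff_right (ENNReal.mul_ne_top ENNReal.ofReal_ne_top hI)).1 h1
  have h3 : ENNReal.ofReal (A / (4 * v)) = ENNReal.ofReal (2 * v)⁻¹ * ENNReal.ofReal (A / 2) := by
    rw [← ENNReal.ofReal_mul (by positivity)]
    congr 1
    field_simp
    norm_num
  rw [h3, mul_assoc]
  calc _ ≤ ENNReal.ofReal (2 * v)⁻¹ * (2 * (ENNReal.ofReal v * S)) := by gcongr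
    _ = (ENNReal.ofReal (2 * v)⁻¹ * ENNReal.ofReal (2 * v)) * S := by
        rw [ENNReal.ofReal_mul (by norm_num : (0 : ℝ) ≤ 2), ENNReal.ofReal_ofNat]; ring
    _ = S := by
        rw [← ENNReal.ofReal_mul (by positivity), inv_mul_cancel₀ (by positivity),
          ENNReal.ofReal_one, one_mul]

theorem upper_bound_of_weighted {v : ℝ} (hv : 0 < v) {R I S : ℝ≥0∞} (hR : R ≠ ∞)
    (h : ENNReal.ofReal v * S ≤ R * I) : S ≤ ENNReal.ofReal (v⁻¹ * R.toReal) * I := by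
  rw [ENNReal.ofReal_mul (by positivity), ENNReal.ofReal_toReal hR, mul_assoc]
  calc S = (ENNReal.ofReal v⁻¹ * ENNReal.ofReal v) * S := by
        rw [← ENNReal.ofReal_mul (by positivity), inv_mul_cancel₀ hv.ne', ENNReal.ofReal_one,
          one_mul]
    _ = ENNReal.ofReal v⁻¹ * (ENNReal.ofReal v * S) := by ring
    _ ≤ _ := by gcongr

/-- If some coordinate exceeds 1/10 in modulus, ξ lies in the cone about the axis of its largest
coordinate; the thresholds of `cone` and `lowBox` agree. -/
theorem iUnion_cones_eq_univ : lowBox ∪ matMap 1 ⁻¹' cone ∪ matMap perm12 ⁻¹' cone ∪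
    matMap perm13 ⁻¹' cone = Set.univ := by
  refine Set.eq_univ_of_forall fun ξ => ?_
  have e12 : matMap perm12 ξ = !₂[ξ 1, ξ 0, ξ 2] := by
    ext i
    fin_cases i <;> simp [matMap, perm12, dotProduct, Fin.sum_univ_three]
  have e13 : matMap perm13 ξ = !₂[ξ 2, ξ 1, ξ 0] := by
    ext i
    fin_cases i <;> simp [matMap, perm13, dotProduct, Fin.sum_univ_three]
  simp only [Set.mem_union, Set.mem_preimage, matMap_one, e12, e13]
  by_contra hcon
  simp only [not_or, lowBox, cone, Set.mem_ofPred_eq, Matrix.cons_val] at hcon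
  grind

theorem lintegral_le_add_four {X : Type*} [MeasurableSpace X] {μ : Measure X} {s₁ s₂ s₃ s₄ : Set X}
    (h : s₁ ∪ s₂ ∪ s₃ ∪ s₄ = Set.univ) (f : X → ℝ≥0∞) :
    ∫⁻ x, f x ∂μ ≤ ∫⁻ x in s₁, f x ∂μ + ∫⁻ x in s₂, f x ∂μ + ∫⁻ x in s₃, f x ∂μ +
      ∫⁻ x in s₄, f x ∂μ := by
  rw [← setLIntegral_univ, ← h]
  refine (lintegral_union_le _ _ _).trans ?_
  gcongr
  refine (lintegral_union_le _ _ _).trans ?_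
  gcongr
  exact lintegral_union_le _ _ _

theorem measurableSet_cone : MeasurableSet cone := by
  have h : ∀ i, Measurable fun ξ : R3 => |ξ i| := fun i => by fun_prop
  exact (measurableSet_le measurable_const (h 0)).inter
    ((measurableSet_le (h 1) (h 0)).inter (measurableSet_le (h 2) (h 0)))

theorem pyramid_subset_cone : pyramid ⊆ cone := by
  intro ξ hξ
  have key : 1 ≤ |ξ 0| → |ξ 1 / ξ 0| ≤ 1 → |ξ 2 / ξ 0| ≤ 1 → ξ ∈ cone := by
    intro h0 h1 h2
    have hpos : 0 < |ξ 0| := by linarith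
    rw [abs_div, div_le_one hpos] at h1 h2
    exact ⟨by linarith, h1, h2⟩
  rcases hξ with ⟨h0, h1, h2⟩ | ⟨h0, h1, h2⟩
  · exact key (h0.trans (le_abs_self _)) h1 h2
  · exact key (by rw [abs_of_neg (by linarith)]; linarith) h1 h2

instance (α : ℝ) : Countable (ShearIndex α) := by unfold ShearIndex; infer_instance

section Frames

variable {φ Φ : ℝ → ℂ} {ψ Ψ : R3 → ℂ} {C A : ℝ} (hG : GeneratorBounds Φ Ψ C A)
  (hφ : HasL2Fourier φ Φ) (hψ : HasL2Fourier ψ Ψ) {α : ℝ} (hα : 1 < α) (hα' : α ≤ 2)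

theorem measurable_fourier (f : L2R3) : Measurable ((𝓕 f : L2R3) : R3 → ℂ) :=
  (Lp.stronglyMeasurable _).measurable

theorem lintegral_fourier_ne_top (f : L2R3) : ∫⁻ ξ, ‖(𝓕 f : L2R3) ξ‖ₑ ^ 2 ≠ ∞ :=
  lintegral_enorm_sq_ne_top (Lp.memLp _)

include hG hψ hα hα' in
theorem isL2FrameOn_shear₁System : ∃ ĉ₁ : ℝ, 0 < ĉ₁ ∧ ∀ c₁ c₂ : ℝ, 0 < c₂ → c₂ ≤ c₁ → c₁ ≤ ĉ₁ →
    IsL2FrameOn L2Pyramid (shear₁System α c₁ c₂ ψ) := by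
  have hA := hG.pos_A
  set R : ℝ := (remainderConst C).toReal with hR
  have hR0 : 0 ≤ R := ENNReal.toReal_nonneg
  have hRc : remainderConst C = ENNReal.ofReal R :=
    (ENNReal.ofReal_toReal (remainderConst_ne_top C)).symm
  -- With c₁ ≤ 1 and 4c₁(R + 1) ≤ A the aliasing coefficient 2c₁²R is at most A/2.
  refine ⟨min 1 (A / (4 * (R + 1))), by positivity, fun c₁ c₂ hc₂ h21 hc => ?_⟩
  have hc₁ : c₁ ≤ 1 := hc.trans (min_le_left _ _)
  have hc₁0 : 0 < c₁ := hc₂.trans_le h21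
  have hv : 0 < c₁ * c₂ ^ 2 := by positivity
  have hsmall : 2 * (c₁ ^ 2 * R) ≤ A / 2 := by
    have h1 : c₁ * (4 * (R + 1)) ≤ A := by
      rw [← le_div_iff₀ (by positivity)]; exact hc.trans (min_le_right _ _)
    nlinarith [mul_nonneg hc₁0.le hR0, mul_nonneg (mul_nonneg hc₁0.le hR0) (sub_nonneg.2 hc₁)]
  have hone : |(1 : Matrix (Fin 3) (Fin 3) ℝ).det| = 1 := by simp
  obtain ⟨hm, hsum⟩ := exists_memLp_tsum_eq_shearSum hψ hG.integrable_Ψ hG.memLp_Ψ (P := 1)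
    (by simp) (indexEquiv₁ α) (shear₁System_indexEquiv₁ α c₁ c₂ ψ)
  refine isL2FrameOn_of_bounds hm (A := A / (4 * (c₁ * c₂ ^ 2)))
    (B := (c₁ * c₂ ^ 2)⁻¹ * (2 * remainderConst C).toReal) (by positivity)
    (fun f hf => ?_) (fun f _ => ?_)
  · rw [hsum]
    refine lower_bound_of_remainder hA hv hsmall (lintegral_fourier_ne_top f) ?_
    have h1 := lintegral_cone_le_shearSum hG hα hα' hone hc₂ h21 hc₁ (measurable_fourier f)
      (Lp.memLp (𝓕 f : L2R3))
    -- The transform of f vanishes a.e. off the pyramid, which is contained in `cone`, so no energy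
    -- is lost.
    have h2 : ∫⁻ ξ in matMap 1 ⁻¹' cone, ‖(𝓕 f : L2R3) ξ‖ₑ ^ 2
        = ∫⁻ ξ, ‖(𝓕 f : L2R3) ξ‖ₑ ^ 2 := by
      have hid : matMap 1 ⁻¹' cone = cone := by ext ξ; simp [matMap_one]
      rw [hid, ← lintegral_add_compl (μ := volume) _ measurableSet_cone,
        (lintegral_eq_zero_iff' ?_).2 ((ae_restrict_iff' measurableSet_cone.compl).2 ?_), add_zero]
      · exact ((measurable_fourier f).enorm.pow_const 2).aemeasurable
      filter_upwards [hf] with ξ hξ hc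
      rw [hξ fun hp => hc (pyramid_subset_cone hp)]
      simp
    rw [h2, hRc] at h1
    refine h1.trans (le_of_eq ?_)
    rw [ENNReal.ofReal_mul (by norm_num : (0 : ℝ) ≤ 2),
      ENNReal.ofReal_mul (p := c₁ ^ 2) (by positivity), ENNReal.ofReal_ofNat]
    ring
  · rw [hsum]
    exact upper_bound_of_weighted hv
      (ENNReal.mul_ne_top ENNReal.ofNat_ne_top (remainderConst_ne_top C))
      (shearSum_le hG hα hone hc₂ h21 hc₁ (measurable_fourier f) (Lp.memLp (𝓕 f : L2R3)))

include hG hφ hψ hα hα' in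
theorem isL2Frame_pyramidSystem : ∃ ĉ₁ : ℝ, 0 < ĉ₁ ∧ ∀ c₁ c₂ : ℝ, 0 < c₂ → c₂ ≤ c₁ → c₁ ≤ ĉ₁ →
    IsL2Frame (pyramidSystem α c₁ c₂ (tensor3 φ) ψ (swap12 ψ) (swap13 ψ)) := by
  have hA := hG.pos_A
  set Q : ℝ≥0∞ := remainderConst (C ^ 6) + 3 * remainderConst C with hQ
  have hQt : Q ≠ ∞ := ENNReal.add_ne_top.2 ⟨remainderConst_ne_top _,
    ENNReal.mul_ne_top ENNReal.ofNat_ne_top (remainderConst_ne_top C)⟩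
  set R : ℝ := Q.toReal with hR
  have hR0 : 0 ≤ R := ENNReal.toReal_nonneg
  have hRc : Q = ENNReal.ofReal R := (ENNReal.ofReal_toReal hQt).symm
  -- The scaling layer is a product of three univariate lower bounds, hence the cube.
  set A' : ℝ := min A (A ^ 3) with hA'
  have hA'0 : 0 < A' := lt_min hA (by positivity)
  refine ⟨min 1 (A' / (4 * (R + 1))), by positivity, fun c₁ c₂ hc₂ h21 hc => ?_⟩
  have hc₁ : c₁ ≤ 1 := hc.trans (min_le_left _ _)
  have hc₁0 : 0 < c₁ := hc₂.trans_le h21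
  have hv : 0 < c₁ * c₂ ^ 2 := by positivity
  have hv₀ : 0 < c₁ * c₁ ^ 2 := by positivity
  -- The scaling layer carries the weight c₁³ and the shearlet layers c₁c₂². A common weight is c₁³
  -- for the lower frame bound and c₁c₂² for the upper one.
  have hvv : ENNReal.ofReal (c₁ * c₂ ^ 2) ≤ ENNReal.ofReal (c₁ * c₁ ^ 2) := by gcongr
  have hsmall : 2 * (c₁ ^ 2 * R) ≤ A' / 2 := by
    have h1 : c₁ * (4 * (R + 1)) ≤ A' := by
      rw [← le_div_iff₀ (by positivity)]; exact hc.trans (min_le_right _ _)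
    nlinarith [mul_nonneg hc₁0.le hR0, mul_nonneg (mul_nonneg hc₁0.le hR0) (sub_nonneg.2 hc₁)]
  obtain ⟨hm₀, hsum₀⟩ := exists_memLp_tsum_eq_scalingSum hφ
    (integrable_of_norm_le_decay hG.measurable_Φ hG.norm_Φ_le)
    (memLp_of_norm_le_decay hG.measurable_Φ hG.norm_Φ_le) hG.memLp_tensor c₁
  obtain ⟨hm₁, hsum₁⟩ := exists_memLp_tsum_eq_shearSum hψ hG.integrable_Ψ hG.memLp_Ψ (P := 1)
    (by simp) (indexEquiv₁ α) (shear₁System_indexEquiv₁ α c₁ c₂ ψ)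
  obtain ⟨hm₂, hsum₂⟩ := exists_memLp_tsum_eq_shearSum hψ hG.integrable_Ψ hG.memLp_Ψ
    perm12_transpose_mul (indexEquiv₂ α) (shear₂System_indexEquiv₂ α c₁ c₂ ψ)
  obtain ⟨hm₃, hsum₃⟩ := exists_memLp_tsum_eq_shearSum hψ hG.integrable_Ψ hG.memLp_Ψ
    perm13_transpose_mul (indexEquiv₃ α) (shear₃System_indexEquiv₃ α c₁ c₂ ψ)
  have hm : ∀ q, MemLp (pyramidSystem α c₁ c₂ (tensor3 φ) ψ (swap12 ψ) (swap13 ψ) q) 2 := by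
    rintro (q | q | q | q)
    exacts [hm₀ q, hm₁ q, hm₂ q, hm₃ q]
  have hsum : ∀ u : L2R3, ∑' q, ‖inner ℂ ((hm q).toLp _) u‖ₑ ^ 2 =
      scalingSum c₁ Φ (𝓕 u : L2R3) + (shearSum α c₁ c₂ 1 Ψ (𝓕 u : L2R3) +
        (shearSum α c₁ c₂ perm12 Ψ (𝓕 u : L2R3) + shearSum α c₁ c₂ perm13 Ψ (𝓕 u : L2R3))) := by
    intro u
    rw [← hsum₀, ← hsum₁, ← hsum₂, ← hsum₃,
      Summable.tsum_sum ENNReal.summable ENNReal.summable]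
    congr 1
    refine (Summable.tsum_sum ENNReal.summable ENNReal.summable).trans ?_
    congr 1
    exact Summable.tsum_sum ENNReal.summable ENNReal.summable
  have hone : |(1 : Matrix (Fin 3) (Fin 3) ℝ).det| = 1 := by simp
  refine isL2FrameOn_of_bounds hm (A := A' / (4 * (c₁ * c₁ ^ 2)))
    (B := (c₁ * c₂ ^ 2)⁻¹ * (2 * Q).toReal) (by positivity) (fun f _ => ?_) (fun f _ => ?_)
  · rw [hsum]
    refine lower_bound_of_remainder hA'0 hv₀ hsmall (lintegral_fourier_ne_top f) ?_
    have h0 := (scalingSum_bounds hG hc₁0 hc₁ (measurable_fourier f) (Lp.memLp (𝓕 f : L2R3))).2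
    have hs : ∀ {P : Matrix (Fin 3) (Fin 3) ℝ}, |P.det| = 1 → _ := fun {P} hP =>
      lintegral_cone_le_shearSum (P := P) hG hα hα' hP hc₂ h21 hc₁ (measurable_fourier f)
        (Lp.memLp (𝓕 f : L2R3))
    have h1 := hs hone
    have h2 := hs abs_det_perm12
    have h3 := hs abs_det_perm13
    have hle := lintegral_le_add_four (μ := (volume : Measure R3)) iUnion_cones_eq_univ
      (fun ξ => ‖(𝓕 f : L2R3) ξ‖ₑ ^ 2)
    have hAA : ENNReal.ofReal A' ≤ ENNReal.ofReal A := ENNReal.ofReal_le_ofReal (min_le_left _ _)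
    have hAA3 : ENNReal.ofReal A' ≤ ENNReal.ofReal (A ^ 3) :=
      ENNReal.ofReal_le_ofReal (min_le_right _ _)
    rw [ENNReal.ofReal_mul (by norm_num : (0 : ℝ) ≤ 2),
      ENNReal.ofReal_mul (p := c₁ ^ 2) (by positivity), ENNReal.ofReal_ofNat, ← hRc, hQ]
    refine (mul_le_mul_right hle _).trans ?_
    rw [mul_add, mul_add, mul_add]
    refine (add_le_add (add_le_add (add_le_add
      ((mul_le_mul_left hAA3 _).trans h0) ((mul_le_mul_left hAA _).trans h1))
      ((mul_le_mul_left hAA _).trans h2)) ((mul_le_mul_left hAA _).trans h3)).trans ?_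
    generalize ∫⁻ ξ, ‖(𝓕 f : L2R3) ξ‖ₑ ^ 2 = I
    generalize ENNReal.ofReal (c₁ ^ 2) = e
    generalize ENNReal.ofReal (c₁ * c₂ ^ 2) = v at *
    generalize ENNReal.ofReal (c₁ * c₁ ^ 2) = v₀ at *
    calc _ ≤ 2 * (v₀ * scalingSum c₁ Φ (𝓕 f : L2R3) + e * remainderConst (C ^ 6) * I) +
          2 * (v₀ * shearSum α c₁ c₂ 1 Ψ (𝓕 f : L2R3) + e * remainderConst C * I) +
          2 * (v₀ * shearSum α c₁ c₂ perm12 Ψ (𝓕 f : L2R3) + e * remainderConst C * I) +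
          2 * (v₀ * shearSum α c₁ c₂ perm13 Ψ (𝓕 f : L2R3) + e * remainderConst C * I) := by
          gcongr
      _ = _ := by ring
  · rw [hsum]
    refine upper_bound_of_weighted hv (ENNReal.mul_ne_top ENNReal.ofNat_ne_top hQt) ?_
    have h0 := (scalingSum_bounds hG hc₁0 hc₁ (measurable_fourier f) (Lp.memLp (𝓕 f : L2R3))).1
    have hs : ∀ {P : Matrix (Fin 3) (Fin 3) ℝ}, |P.det| = 1 → _ := fun {P} hP =>
      shearSum_le (P := P) hG hα hP hc₂ h21 hc₁ (measurable_fourier f) (Lp.memLp (𝓕 f : L2R3))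
    rw [mul_add, mul_add, mul_add]
    refine (add_le_add ((mul_le_mul_left hvv _).trans h0) (add_le_add (hs hone)
      (add_le_add (hs abs_det_perm12) (hs abs_det_perm13)))).trans (le_of_eq ?_)
    rw [hQ]
    ring

end Frames

end Shearlet

end

/-! ### The theorem -/

theorem mainTheorem6 (α : ℝ) (hα : 1 < α) (hα' : α ≤ 2) (K L : ℕ) (hL : 10 ≤ L)
    (hKL : (3 * L : ℝ) / 2 ≤ K) (hKL' : (K : ℝ) ≤ 3 * L - 2) (m₀ m₁ : ℝ → ℂ)
    (hm₀ : Shearlet.IsLowPassFilter m₀) (hm₁ : Shearlet.IsFilter m₁)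
    (hm₀_sq : ∀ ξ : ℝ, ‖m₀ ξ‖ ^ 2 = Shearlet.lowPassSq K L ξ)
    (hm₁_sq : ∀ ξ : ℝ, ‖m₁ ξ‖ ^ 2 = ‖m₀ (ξ + 1 / 2)‖ ^ 2) :
    MemLp (Shearlet.scalingHat m₀) 2 volume ∧
    MemLp (Shearlet.shearletHat m₀ m₁) 2 volume ∧
    ∀ (φ : ℝ → ℂ) (ψ : Shearlet.R3 → ℂ),
      Shearlet.HasL2Fourier φ (Shearlet.scalingHat m₀) →
      Shearlet.HasL2Fourier ψ (Shearlet.shearletHat m₀ m₁) →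
      ∃ ĉ₁ : ℝ, 0 < ĉ₁ ∧ ∀ c₁ c₂ : ℝ, 0 < c₂ → c₂ ≤ c₁ → c₁ ≤ ĉ₁ →
        Shearlet.IsL2FrameOn Shearlet.L2Pyramid (Shearlet.shear₁System α c₁ c₂ ψ) ∧
        Shearlet.IsL2Frame
          (Shearlet.pyramidSystem α c₁ c₂ (Shearlet.tensor3 φ) ψ
            (Shearlet.swap12 ψ) (Shearlet.swap13 ψ)) := by
  -- From 2K ≥ 3L and L ≥ 10 one gets 2(K - L) ≥ L ≥ 10, more than the decay estimate needs.
  have hLK : L + 3 ≤ K := by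
    have h1 : (3 * L : ℝ) ≤ 2 * K := by linarith
    have h2 : 3 * L ≤ 2 * K := by exact_mod_cast h1
    omega
  obtain ⟨C, A, hG⟩ :=
    Shearlet.exists_generatorBounds hm₀ hm₁ hm₀_sq hm₁_sq (by omega : 1 ≤ L) hLK
  refine ⟨Shearlet.memLp_of_norm_le_decay hG.measurable_Φ hG.norm_Φ_le, hG.memLp_Ψ,
    fun φ ψ hφ hψ => ?_⟩
  obtain ⟨c, hc, hframe⟩ := Shearlet.isL2FrameOn_shear₁System hG hψ hα hα'
  obtain ⟨c', hc', hframe'⟩ := Shearlet.isL2Frame_pyramidSystem hG hφ hψ hα hα'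
  exact ⟨min c c', lt_min hc hc', fun c₁ c₂ h0 h1 h2 =>
    ⟨hframe c₁ c₂ h0 h1 (h2.trans (min_le_left _ _)),
      hframe' c₁ c₂ h0 h1 (h2.trans (min_le_right _ _))⟩⟩
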